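/- Let $M$ be a (real, finite-dimensional, Hausdorff, second countable) smooth manifold and $A\to M$ a smooth real vector bundle of rank $n$. A hom-Lie algebroid $\mathcal A=(A,\phi,[-,-],\rho,\alpha)$ consists of a smooth map $\phi:M\to M$, an $\mathbb R$-bilinear bracket on $\Gamma(A)$, a smooth bundle map $\rho:\phi^!A\to\phi^!TM$ over $\mathrm{id}_M$, and an $\mathbb R$-linear map $\alpha:\Gamma(A)\to\Gamma(A)$ with $\alpha(fX)=\phi^*(f)\alpha(X)$, such that * $(\Gamma(A),[-,-],\alpha)$ is a hom-Lie algebra: the bracket is skew-symmetric, $\alpha[X,Y]=[\alpha X,\alpha Y]$, and $[\alpha X,[Y,Z]]+[\alpha Y,[Z,X]]+[\alpha Z,[X,Y]]=0$; * $[X,fY]=\phi^*(f)[X,Y]+\rho(X)[f]\,\alpha(Y)$, where $\rho(X)[f](m)=\langle d_{\phi(m)}f,\rho_m(X_{\phi(m)})\rangle$; * $(\rho,\phi^*)$ is a representation of this hom-Lie algebra on $C^\infty(M)$. Here a representation of a hom-Lie algebra $(\mathfrak g,[-,-],\alpha)$ on a vector space $S$ is a pair $(\theta,\beta)$, with $\theta:\mathfrak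 g\to\mathrm{End}(S)$ and $\beta:S\to S$ linear, such that $\theta(\alpha x)\beta=\beta\,\theta(x)$ and $\theta([x,y])\beta=\theta(\alpha x)\theta(y)-\theta(\alpha y)\theta(x)$. The hom-Lie algebroid is regular if $\alpha$ is bijective and $\phi$ is a diffeomorphism. A representation of $\mathcal A$ on a hom-bundle $(B,\phi,\beta)$ (a vector bundle $B\to M$ with a linear map $\beta:\Gamma(B)\to\Gamma(B)$, $\beta(fs)=\phi^*(f)\beta(s)$) is an $\mathbb R$-bilinear map $\nabla:\Gamma(A)\times\Gamma(B)\to\Gamma(B)$ with $\nabla(fx,s)=\phi^*(f)\nabla(x,s)$ and $\nabla(x,fs)=\phi^*(f)\nabla(x,s)+\rho(x)[f]\,\beta(s)$, such that $(\nabla,\beta)$ is a representation of the hom-Lie algebra $\Gamma(A)$ on $\Gamma(B)$. Let $\mathfrak A=\bigoplus_{k\ge 0}\Gamma(\wedge^kA)$ be the algebra of multisections. A hom-Gerstenhaber structure on $\mathfrak A$ consists of a degree $0$ algebra endomorphism $\tilde\alpha$ and an $\mathbb R$-bilinear bracket of degree $-1$ such that, for $X,Y,Z$ homogeneous of degrees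 $i,j,k$: $[X,Y]=-(-1)^{(i-1)(j-1)}[Y,X]$; $\tilde\alpha[X,Y]=[\tilde\alpha X,\tilde\alpha Y]$; $$(-1)^{(i-1)(k-1)}[\tilde\alpha X,[Y,Z]]+(-1)^{(j-1)(i-1)}[\tilde\alpha Y,[Z,X]]+(-1)^{(k-1)(j-1)}[\tilde\alpha Z,[X,Y]]=0;$$ and $[X,Y\wedge Z]=[X,Y]\wedge\tilde\alpha(Z)+(-1)^{(i-1)j}\tilde\alpha(Y)\wedge[X,Z]$. An exact generator of it is an $\mathbb R$-linear operator $D:\mathfrak A\to\mathfrak A$ of degree $-1$ with $D\tilde\alpha=\tilde\alpha D$, $D^2=0$ and $$[X,Y]=(-1)^{|X|}\bigl(D(X\wedge Y)-(DX)\wedge\tilde\alpha(Y)-(-1)^{|X|}\tilde\alpha(X)\wedge DY\bigr)$$ for homogeneous $X,Y$. **Proposition.** Let $\mathcal A=(A,\phi,[-,-],\rho,\alpha)$ be a regular hom-Lie algebroid, where $A$ has rank $n$. Then there is exactly one hom-Gerstenhaber structure $(\tilde\alpha,[-,-]_{\mathcal A})$ on $\mathfrak A$ that extends $\mathcal A$,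 i.e. such that $\tilde\alpha(f)=\phi^*(f)$, $\tilde\alpha(X)=\alpha(X)$, $[X,Y]_{\mathcal A}=[X,Y]$ and $[X,f]_{\mathcal A}=\rho(X)[f]$ for all $f\in C^\infty(M)$ and $X,Y\in\Gamma(A)$ (the hom-Gerstenhaber algebra associated to $\mathcal A$). Moreover, the assignment $D\mapsto\nabla$ with $$\nabla(a,X)=[a,X]_{\mathcal A}-(Da)\,\tilde\alpha(X),\qquad a\in\Gamma(A),\ X\in\Gamma(\wedge^nA),$$ is a well-defined bijection from the set of exact generators of $(\mathfrak A,\wedge,[-,-]_{\mathcal A},\tilde\alpha)$ onto the set of representations of $\mathcal A$ on the hom-bundle $(\wedge^nA,\phi,\tilde\alpha)$. -/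

import Mathlib

open Bundle
open scoped Manifold ContDiff Bundle

noncomputable section

/-! ### Hom-Lie algebras, hom-Gerstenhaber algebras and exact generators -/

/-- `(g, [-,-], α)` is a hom-Lie algebra over `R`. -/
structure IsHomLie {R g : Type*} [CommRing R] [AddCommGroup g] [Module R g]
    (br : g →ₗ[R] g →ₗ[R] g) (α : g →ₗ[R] g) : Prop where
  skew : ∀ x y, br x y = -br y x
  map_bracket : ∀ x y, α (br x y) = br (α x) (α y)
  hom_jacobi : ∀ x y z, br (α x) (br y z) + br (α y) (br z x) + br (α z) (br x y) = 0

/-- `(ρ, β)` is a representation of the hom-Lie algebra `(g, [-,-], α)` on the module `S`. -/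
structure IsHomLieRep {R g S : Type*} [CommRing R] [AddCommGroup g] [Module R g]
    [AddCommGroup S] [Module R S] (br : g →ₗ[R] g →ₗ[R] g) (α : g →ₗ[R] g)
    (ρ : g →ₗ[R] S →ₗ[R] S) (β : S →ₗ[R] S) : Prop where
  map_twist : ∀ x s, ρ (α x) (β s) = β (ρ x s)
  map_bracket : ∀ x y s, ρ (br x y) (β s) = ρ (α x) (ρ y s) - ρ (α y) (ρ x s)

/-- `(⨁ₖ 𝒜 k, ∧, [-,-], α)` is a hom-Gerstenhaber algebra over `R`; the product `∧` is the
multiplication of `A`. The signs only depend on the parities of the exponents, and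
`(i - 1) * (j - 1)` has the parity of `(i + 1) * (j + 1)`. -/
structure IsHomGerstenhaber {R A : Type*} [CommRing R] [Ring A] [Algebra R A]
    (𝒜 : ℕ → Submodule R A) (α : A →ₐ[R] A) (br : A →ₗ[R] A →ₗ[R] A) : Prop where
  /-- `A` is graded by `𝒜`: products have the sum of the degrees ... -/
  graded : SetLike.GradedMonoid 𝒜
  /-- ... and `A` is the direct sum of the `𝒜 k`. -/
  internal : DirectSum.IsInternal 𝒜
  graded_comm : ∀ i j, ∀ X ∈ 𝒜 i, ∀ Y ∈ 𝒜 j, X * Y = (-1 : R) ^ (i * j) • (Y * X)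
  /-- `α` has degree `0`. -/
  twist_degree : ∀ i, ∀ X ∈ 𝒜 i, α X ∈ 𝒜 i
  /-- The bracket has degree `-1` ... -/
  bracket_degree : ∀ i j k, k + 1 = i + j → ∀ X ∈ 𝒜 i, ∀ Y ∈ 𝒜 j, br X Y ∈ 𝒜 k
  /-- ... so that it vanishes on two elements of degree `0`. -/
  bracket_zero : ∀ X ∈ 𝒜 0, ∀ Y ∈ 𝒜 0, br X Y = 0
  skew : ∀ i j, ∀ X ∈ 𝒜 i, ∀ Y ∈ 𝒜 j, br X Y = -((-1 : R) ^ ((i + 1) * (j + 1)) • br Y X)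
  map_bracket : ∀ X Y, α (br X Y) = br (α X) (α Y)
  hom_jacobi : ∀ i j k, ∀ X ∈ 𝒜 i, ∀ Y ∈ 𝒜 j, ∀ Z ∈ 𝒜 k,
    (-1 : R) ^ ((i + 1) * (k + 1)) • br (α X) (br Y Z)
      + (-1 : R) ^ ((j + 1) * (i + 1)) • br (α Y) (br Z X)
      + (-1 : R) ^ ((k + 1) * (j + 1)) • br (α Z) (br X Y) = 0
  hom_leibniz : ∀ i j, ∀ X ∈ 𝒜 i, ∀ Y ∈ 𝒜 j, ∀ Z,
    br X (Y * Z) = br X Y * α Z + (-1 : R) ^ ((i + 1) * j) • (α Y * br X Z)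

/-- `D` is an exact generator of the hom-Gerstenhaber algebra `(⨁ₖ 𝒜 k, ∧, [-,-], α)`: an operator
of degree `-1` which commutes with `α`, generates the bracket and has square zero. -/
structure IsExactGenerator {R A : Type*} [CommRing R] [Ring A] [Algebra R A]
    (𝒜 : ℕ → Submodule R A) (α : A →ₐ[R] A) (br : A →ₗ[R] A →ₗ[R] A) (D : A →ₗ[R] A) : Prop where
  degree_succ : ∀ k, ∀ X ∈ 𝒜 (k + 1), D X ∈ 𝒜 k
  degree_zero : ∀ X ∈ 𝒜 0, D X = 0
  comm_twist : ∀ X, D (α X) = α (D X)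
  generates : ∀ i, ∀ X ∈ 𝒜 i, ∀ j, ∀ Y ∈ 𝒜 j,
    br X Y = (-1 : R) ^ i • (D (X * Y) - D X * α Y - (-1 : R) ^ i • (α X * D Y))
  sq_zero : ∀ X, D (D X) = 0

/-! ### Smooth functions, sections and multisections of a smooth vector bundle -/

section Bundles

variable (E : Type*) [NormedAddCommGroup E] [NormedSpace ℝ E]
  (M : Type*) [TopologicalSpace M] [ChartedSpace E M]
  (F : Type*) [NormedAddCommGroup F] [NormedSpace ℝ F]

/-- The algebra `C^∞(M)`. -/
abbrev SmoothFun : Type _ := C^∞⟮𝓘(ℝ, E), M; 𝓘(ℝ, ℝ), ℝ⟯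

/-- Smooth maps `M → M`. -/
abbrev SmoothSelfMap : Type _ := C^∞⟮𝓘(ℝ, E), M; 𝓘(ℝ, E), M⟯

variable {M} (V : M → Type*) [TopologicalSpace (TotalSpace F V)] [∀ m, TopologicalSpace (V m)]
  [∀ m, AddCommGroup (V m)] [∀ m, Module ℝ (V m)] [FiberBundle F V] [VectorBundle ℝ F V]

/-- The space `Γ(V)` of smooth sections of the vector bundle `V`. -/
abbrev SmoothSec : Type _ := Cₛ^∞⟮𝓘(ℝ, E); F, V⟯

variable {E F V}

instance : SMul (SmoothFun E M) (SmoothSec E F V) :=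
  ⟨fun f X => ⟨fun m => f m • X m, f.contMDiff.smul_section X.contMDiff⟩⟩

@[simp] theorem SmoothSec.fsmul_apply (f : SmoothFun E M) (X : SmoothSec E F V) (m : M) :
    (f • X) m = f m • X m := rfl

/-- Sections form a module over `C^∞(M)`, with pointwise multiplication. -/
instance : Module (SmoothFun E M) (SmoothSec E F V) where
  one_smul X := by ext m; exact one_smul ℝ (X m)
  mul_smul f g X := by ext m; exact mul_smul (f m) (g m) (X m)
  smul_zero f := by ext m; exact smul_zero (f m)
  smul_add f X Y := by ext m; exact smul_add (f m) (X m) (Y m)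
  add_smul f g X := by ext m; exact add_smul (f m) (g m) (X m)
  zero_smul X := by ext m; exact zero_smul ℝ (X m)

/-- The value `m ↦ s m ∈ Λ(V m)`, read in the trivialization of `Λ V` induced by the preferred
trivialization of `V` at `m₀`. -/
def multiCoord (s : ∀ m, ExteriorAlgebra ℝ (V m)) (m₀ m : M) : ExteriorAlgebra ℝ F :=
  ExteriorAlgebra.map ((trivializationAt F V m₀).linearMapAt ℝ m) (s m)

variable (E F) in
/-- A section `s` of the exterior algebra bundle `Λ V` is smooth if it is smooth in the
trivializations of `Λ V` induced by those of `V`, i.e. if all its coordinates (given by linear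
functionals on the finite-dimensional space `Λ F`) are smooth. -/
def IsSmoothMulti (s : ∀ m, ExteriorAlgebra ℝ (V m)) : Prop :=
  ∀ (m₀ : M) (l : Module.Dual ℝ (ExteriorAlgebra ℝ F)),
    ContMDiffAt 𝓘(ℝ, E) 𝓘(ℝ, ℝ) ∞ (fun m => l (multiCoord (F := F) s m₀ m)) m₀

theorem exteriorAlgebra_finite [FiniteDimensional ℝ F] :
    Module.Finite ℝ (ExteriorAlgebra ℝ F) := by
  have hz : ∀ k, Module.finrank ℝ F < k → (⋀[ℝ]^k F) = ⊥ := by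
    intro k hk
    apply Submodule.finrank_eq_zero.mp
    rw [exteriorPower.finrank_eq, Nat.choose_eq_zero_of_lt hk]
  have htop : (⨆ k : Fin (Module.finrank ℝ F + 1), (⋀[ℝ]^(k : ℕ) F)) = ⊤ := by
    rw [eq_top_iff, ← (DirectSum.Decomposition.isInternal
      (fun k : ℕ => ⋀[ℝ]^k F)).submodule_iSup_eq_top]
    refine iSup_le fun k => ?_
    by_cases hk : k ≤ Module.finrank ℝ F
    · exact le_iSup (fun k : Fin (Module.finrank ℝ F + 1) => (⋀[ℝ]^(k : ℕ) F))
        ⟨k, Nat.lt_succ_of_le hk⟩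
    · rw [hz k (not_le.mp hk)]
      exact bot_le
  refine ⟨?_⟩
  rw [← htop]
  exact Submodule.fg_iSup _ fun k => (Module.Finite.iff_fg).mp inferInstance

theorem IsSmoothMulti.mul [FiniteDimensional ℝ F] {s t : ∀ m, ExteriorAlgebra ℝ (V m)}
    (hs : IsSmoothMulti E F s) (ht : IsSmoothMulti E F t) : IsSmoothMulti E F (s * t) := by
  intro m₀ l
  have := exteriorAlgebra_finite (F := F)
  let b := Module.finBasis ℝ (ExteriorAlgebra ℝ F)
  have key : (fun m => l (multiCoord (F := F) (s * t) m₀ m)) =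
      fun m => ∑ i, ∑ j, (b.coord i (multiCoord (F := F) s m₀ m) *
        b.coord j (multiCoord (F := F) t m₀ m)) * l (b i * b j) := by
    funext m
    have h : multiCoord (F := F) (s * t) m₀ m =
        (∑ i, b.coord i (multiCoord (F := F) s m₀ m) • b i) *
        (∑ j, b.coord j (multiCoord (F := F) t m₀ m) • b j) := by
      simp only [Module.Basis.coord_apply, Module.Basis.sum_repr]
      simp [multiCoord]
    rw [h, Finset.sum_mul_sum, map_sum]
    refine Finset.sum_congr rfl fun i _ => ?_
    rw [map_sum]
    refine Finset.sum_congr rfl fun j _ => ?_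
    rw [smul_mul_smul_comm, map_smul, smul_eq_mul]
  rw [key]
  exact contMDiffAt_finsetSum fun i _ => contMDiffAt_finsetSum fun j _ =>
    ((hs m₀ _).mul (ht m₀ _)).mul contMDiffAt_const

variable [FiniteDimensional ℝ F]

variable (E F V) in
/-- The algebra `⨁ₖ Γ(∧^k V)` of multisections of `V`: the smooth sections of `Λ V`, with the
pointwise exterior product. -/
def Multisections : Subalgebra ℝ (∀ m, ExteriorAlgebra ℝ (V m)) where
  carrier := {s | IsSmoothMulti E F s}
  mul_mem' hs ht := hs.mul ht
  add_mem' {s t} hs ht m₀ l := by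
    have h : (fun m => l (multiCoord (F := F) (s + t) m₀ m)) =
        fun m => l (multiCoord (F := F) s m₀ m) + l (multiCoord (F := F) t m₀ m) := by
      funext m; simp [multiCoord]
    rw [h]
    exact (hs m₀ l).add (ht m₀ l)
  algebraMap_mem' r m₀ l := by
    have h : (fun m => l (multiCoord (F := F) (V := V) (algebraMap ℝ _ r) m₀ m)) =
        fun _ => l (algebraMap ℝ _ r) := by
      funext m; simp [multiCoord]
    rw [h]
    exact contMDiffAt_const

/-- Smooth functions as multisections of degree `0`. -/
def funMulti : SmoothFun E M →ₐ[ℝ] Multisections E F V where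
  toFun f := ⟨fun m => algebraMap ℝ _ (f m), by
    intro m₀ l
    have h : (fun m => l (multiCoord (F := F) (V := V) (fun m => algebraMap ℝ _ (f m)) m₀ m)) =
        fun m => f m * l 1 := by
      funext m; simp [multiCoord, Algebra.algebraMap_eq_smul_one]
    rw [h]
    exact f.contMDiff.contMDiffAt.mul contMDiffAt_const⟩
  map_one' := by ext m; exact map_one _
  map_mul' f g := by ext m; exact map_mul _ _ _
  map_zero' := by ext m; exact map_zero _
  map_add' f g := by ext m; exact map_add _ _ _
  commutes' r := rfl

/-- Smooth sections of `V` as multisections of degree `1`. -/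
def secMulti : SmoothSec E F V →ₗ[ℝ] Multisections E F V where
  toFun X := ⟨fun m => ExteriorAlgebra.ι ℝ (X m), by
    intro m₀ l
    have hX := (contMDiffAt_section m₀).mp (X.contMDiff m₀)
    have hl : ContMDiff 𝓘(ℝ, F) 𝓘(ℝ, ℝ) ∞
        (LinearMap.toContinuousLinearMap (l ∘ₗ ExteriorAlgebra.ι ℝ)) :=
      ContinuousLinearMap.contMDiff _
    refine (hl.contMDiffAt.comp m₀ hX).congr_of_eventuallyEq ?_
    filter_upwards [(trivializationAt F V m₀).open_baseSet.mem_nhds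
      (FiberBundle.mem_baseSet_trivializationAt' m₀)] with m hm
    simp [multiCoord, Trivialization.linearMapAt_apply, hm]⟩
  map_add' X Y := by ext m; exact map_add _ _ _
  map_smul' r X := by ext m; exact map_smul _ _ _

/-- Multisections form an algebra over `C^∞(M)`, with pointwise multiplication. -/
instance : Algebra (SmoothFun E M) (Multisections E F V) :=
  (funMulti (E := E) (F := F) (V := V)).toRingHom.toAlgebra' fun f s => by
    ext m; exact Algebra.commutes (f m) (s.1 m)

instance : IsScalarTower ℝ (SmoothFun E M) (Multisections E F V) :=
  IsScalarTower.of_algebraMap_eq fun _ => rfl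

variable (E F V) in
/-- `Γ(∧^k V)`: the multisections of degree `k`, as a module over `C^∞(M)`. -/
def MultiDeg (k : ℕ) : Submodule (SmoothFun E M) (Multisections E F V) where
  carrier := {s | ∀ m, s.1 m ∈ ⋀[ℝ]^k (V m)}
  add_mem' hs ht m := add_mem (hs m) (ht m)
  zero_mem' m := zero_mem _
  smul_mem' f s hs m := by
    have h : (f • s).1 m = f m • s.1 m := by
      rw [Algebra.smul_def, Algebra.smul_def]; rfl
    rw [h]
    exact Submodule.smul_mem _ _ (hs m)

variable (E F V) in
/-- The grading of the real algebra of multisections by the spaces `Γ(∧^k V)`. -/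
def multiGrading (k : ℕ) : Submodule ℝ (Multisections E F V) :=
  (MultiDeg E F V k).restrictScalars ℝ

end Bundles

/-! ### Hom-Lie algebroids -/

section Algebroids

variable {E : Type*} [NormedAddCommGroup E] [NormedSpace ℝ E]
  {M : Type*} [TopologicalSpace M] [ChartedSpace E M] [IsManifold 𝓘(ℝ, E) ∞ M]
  {F : Type*} [NormedAddCommGroup F] [NormedSpace ℝ F]

/-- A smooth bundle map `ρ : φ^! V → φ^! TM` over the identity of `M`. -/
structure Anchor (F : Type*) [NormedAddCommGroup F] [NormedSpace ℝ F]
    (V : M → Type*) [TopologicalSpace (TotalSpace F V)]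
    [∀ m, TopologicalSpace (V m)] [∀ m, AddCommGroup (V m)] [∀ m, Module ℝ (V m)]
    [FiberBundle F V] [VectorBundle ℝ F V] (φ : SmoothSelfMap E M) where
  toFun : ∀ m, V (φ m) →ₗ[ℝ] TangentSpace 𝓘(ℝ, E) (φ m)
  smooth : ContMDiff (𝓘(ℝ, E).prod 𝓘(ℝ, F)) (𝓘(ℝ, E).prod 𝓘(ℝ, E)) ∞
    (fun p : TotalSpace F (φ *ᵖ V) =>
      (⟨p.1, toFun p.1 p.2⟩ : TotalSpace E (φ *ᵖ (TangentSpace 𝓘(ℝ, E) : M → Type _))))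

variable {V : M → Type*} [TopologicalSpace (TotalSpace F V)] [∀ m, TopologicalSpace (V m)]
  [∀ m, AddCommGroup (V m)] [∀ m, Module ℝ (V m)] [FiberBundle F V] [VectorBundle ℝ F V]

theorem Anchor.contMDiff_apply {φ : SmoothSelfMap E M} (ρ : Anchor F V φ)
    (X : SmoothSec E F V) (f : SmoothFun E M) :
    ContMDiff 𝓘(ℝ, E) 𝓘(ℝ, ℝ) ∞
      (fun m => (mfderiv 𝓘(ℝ, E) 𝓘(ℝ, ℝ) f (φ m) (ρ.toFun m (X (φ m))) : ℝ)) := by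
  have h1 : ContMDiff 𝓘(ℝ, E) (𝓘(ℝ, E).prod 𝓘(ℝ, F)) ∞
      (fun m => (⟨m, X (φ m)⟩ : TotalSpace F (φ *ᵖ V))) := by
    intro m₀
    refine contMDiffAt_totalSpace.mpr ⟨contMDiffAt_id, ?_⟩
    exact (contMDiffAt_totalSpace.mp ((X.contMDiff.comp φ.contMDiff) m₀)).2
  have h2 := ρ.smooth.comp h1
  have h3 : ContMDiff 𝓘(ℝ, E) (𝓘(ℝ, E).prod 𝓘(ℝ, E)) ∞
      (fun m => (⟨φ m, ρ.toFun m (X (φ m))⟩ : TangentBundle 𝓘(ℝ, E) M)) := by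
    intro m₀
    refine contMDiffAt_totalSpace.mpr ⟨φ.contMDiff m₀, ?_⟩
    exact (contMDiffAt_totalSpace.mp (h2 m₀)).2
  have h4 := (f.contMDiff.contMDiff_tangentMap (m := ∞) (by simp)).comp h3
  exact (contMDiff_snd_tangentBundle_modelSpace ℝ 𝓘(ℝ, ℝ)).comp h4

/-- `ρ(X)[f] : m ↦ ⟨d_{φ m} f, ρ_m (X_{φ m})⟩`, as an `ℝ`-bilinear map. -/
def Anchor.act {φ : SmoothSelfMap E M} (ρ : Anchor F V φ) :
    SmoothSec E F V →ₗ[ℝ] SmoothFun E M →ₗ[ℝ] SmoothFun E M :=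
  LinearMap.mk₂ ℝ
    (fun X f => ⟨fun m => mfderiv 𝓘(ℝ, E) 𝓘(ℝ, ℝ) f (φ m) (ρ.toFun m (X (φ m))),
      ρ.contMDiff_apply X f⟩)
    (fun X Y f => by
      ext m
      change mfderiv 𝓘(ℝ, E) 𝓘(ℝ, ℝ) f (φ m) (ρ.toFun m ((X + Y) (φ m))) = _
      rw [ContMDiffSection.coe_add, Pi.add_apply, map_add, map_add]; rfl)
    (fun c X f => by
      ext m
      change mfderiv 𝓘(ℝ, E) 𝓘(ℝ, ℝ) f (φ m) (ρ.toFun m ((c • X) (φ m))) = _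
      rw [ContMDiffSection.coe_smul, Pi.smul_apply, map_smul, map_smul]; rfl)
    (fun X f g => by
      ext m
      have hf := f.contMDiff.mdifferentiableAt (x := φ m) (by simp)
      have hg := g.contMDiff.mdifferentiableAt (x := φ m) (by simp)
      exact congrArg (fun L => L (ρ.toFun m (X (φ m)))) (mfderiv_add hf hg))
    (fun c X f => by
      ext m
      have hf := f.contMDiff.mdifferentiableAt (x := φ m) (by simp)
      exact congrArg (fun L => L (ρ.toFun m (X (φ m)))) (const_smul_mfderiv hf c))

variable (E F V) in
/-- A hom-Lie algebroid `(V, φ, [-,-], ρ, α)` over `M`. -/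
structure HomLieAlgebroid where
  φ : SmoothSelfMap E M
  bracket : SmoothSec E F V →ₗ[ℝ] SmoothSec E F V →ₗ[ℝ] SmoothSec E F V
  ρ : Anchor F V φ
  α : SmoothSec E F V →ₗ[ℝ] SmoothSec E F V
  α_smul : ∀ (f : SmoothFun E M) X, α (f • X) = f.comp φ • α X
  homLie : IsHomLie bracket α
  hom_leibniz : ∀ X (f : SmoothFun E M) Y,
    bracket X (f • Y) = f.comp φ • bracket X Y + ρ.act X f • α Y
  /-- `(ρ, φ^*)` is a representation of the hom-Lie algebra `Γ(V)` on `C^∞(M)`. -/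
  anchor_rep : IsHomLieRep bracket α ρ.act
    { toFun := fun f => f.comp φ, map_add' := fun _ _ => rfl, map_smul' := fun _ _ => rfl }

/-- A hom-Lie algebroid is regular if `α` is invertible and `φ` is a diffeomorphism. -/
def HomLieAlgebroid.IsRegular (𝒜 : HomLieAlgebroid E F V) : Prop :=
  Function.Bijective 𝒜.α ∧ ∃ e : M ≃ₘ^∞⟮𝓘(ℝ, E), 𝓘(ℝ, E)⟯ M, ∀ m, e m = 𝒜.φ m

/-- `∇` is a representation of the hom-Lie algebroid `𝒜` on a hom-bundle `(B, φ, β)`, where `S` is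
the `C^∞(M)`-module `Γ(B)` of sections and `β` acts on `S`. -/
structure HomLieAlgebroid.IsRep (𝒜 : HomLieAlgebroid E F V) {S : Type*} [AddCommGroup S]
    [Module ℝ S] [Module (SmoothFun E M) S] (β : S →ₗ[ℝ] S)
    (nabla : SmoothSec E F V →ₗ[ℝ] S →ₗ[ℝ] S) : Prop where
  smul_left : ∀ (f : SmoothFun E M) x s, nabla (f • x) s = f.comp 𝒜.φ • nabla x s
  smul_right : ∀ x (f : SmoothFun E M) s,
    nabla x (f • s) = f.comp 𝒜.φ • nabla x s + 𝒜.ρ.act x f • β s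
  homLieRep : IsHomLieRep 𝒜.bracket 𝒜.α nabla β

variable [FiniteDimensional ℝ F]

/-- A hom-Gerstenhaber algebra structure, with twist `α̃` and bracket, on the multisections of `V`
that is associated to the hom-Lie algebroid `𝒜`: `α̃` is the extension of `φ^*` and `α`, and the
bracket is the extension of the bracket of `Γ(V)` and of the action `[X, f] = ρ(X)[f]`. -/
structure AssocHomGerstenhaber (𝒜 : HomLieAlgebroid E F V) where
  twist : Multisections E F V →ₐ[ℝ] Multisections E F V
  bracket : Multisections E F V →ₗ[ℝ] Multisections E F V →ₗ[ℝ] Multisections E F V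
  isHomGerstenhaber : IsHomGerstenhaber (multiGrading E F V) twist bracket
  twist_fun : ∀ f : SmoothFun E M, twist (funMulti f) = funMulti (f.comp 𝒜.φ)
  twist_sec : ∀ X : SmoothSec E F V, twist (secMulti X) = secMulti (𝒜.α X)
  bracket_sec : ∀ X Y : SmoothSec E F V,
    bracket (secMulti X) (secMulti Y) = secMulti (𝒜.bracket X Y)
  bracket_fun : ∀ (X : SmoothSec E F V) (f : SmoothFun E M),
    bracket (secMulti X) (funMulti f) = funMulti (𝒜.ρ.act X f)

/-- The restriction of `α̃` to `Γ(∧^k V)`. -/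
def AssocHomGerstenhaber.twistDeg {𝒜 : HomLieAlgebroid E F V} (G : AssocHomGerstenhaber 𝒜)
    (k : ℕ) : MultiDeg E F V k →ₗ[ℝ] MultiDeg E F V k where
  toFun s := ⟨G.twist s, G.isHomGerstenhaber.twist_degree k s s.2⟩
  map_add' s t := Subtype.ext (map_add G.twist s.1 t.1)
  map_smul' c s := Subtype.ext (map_smul G.twist c s.1)

/-- The exact generators of the hom-Gerstenhaber algebra of multisections. -/
abbrev AssocHomGerstenhaber.ExactGenerator {𝒜 : HomLieAlgebroid E F V}
    (G : AssocHomGerstenhaber 𝒜) : Type _ :=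
  {D : Multisections E F V →ₗ[ℝ] Multisections E F V //
    IsExactGenerator (multiGrading E F V) G.twist G.bracket D}

/-- The representations of `𝒜` on the hom-bundle `(∧^k V, φ, α̃)`. -/
abbrev AssocHomGerstenhaber.RepOnPower {𝒜 : HomLieAlgebroid E F V}
    (G : AssocHomGerstenhaber 𝒜) (k : ℕ) : Type _ :=
  {nabla : SmoothSec E F V →ₗ[ℝ] MultiDeg E F V k →ₗ[ℝ] MultiDeg E F V k //
    𝒜.IsRep (S := MultiDeg E F V k) (G.twistDeg k) nabla}

end Algebroids

end

open Bundle
open scoped Manifold ContDiff Bundle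

set_option linter.unusedSectionVars false
set_option synthInstance.maxHeartbeats 200000

noncomputable section

/-! ### Operators on exterior algebras -/

/-! A regular hom-Lie algebroid is an ordinary Lie algebroid in disguise. Composing the bracket with
`α⁻¹` and the anchor action with `(φ^*)⁻¹` gives a Lie–Rinehart structure on the `C^∞(M)`-module of
sections, of which `(φ^*, α)` is an automorphism (`HomLieAlgebroid.IsRegular.nonempty_untwisting`).
The claims are proved for this untwisted structure and then twisted by the automorphism `τ` of
multisections induced by `φ^*` and `α`.

Algebra. On the exterior algebra of a Lie–Rinehart module, the Lie derivative, the bracket and the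
divergence are given by recursions over left multiplication by functions and vectors. Such a
recursion has a solution as soon as it respects the relations of the exterior algebra
(`ExteriorAlgebra.exists_firstOrder`). The identities then follow by induction over the same
generators, up to the graded Jacobi identity (`LieRinehart.bracket_bracket`).

Geometry. Each multisection agrees near each point with an element of the exterior algebra of the
module of sections (`exists_lift`), and an element that vanishes near a point is killed by a cutoff
function (`exists_smul_eq_zero`). Hence local operators pass to multisections (`exists_extension`)
and identities are checked pointwise on lifts; no isomorphism between the two algebras is needed.
Following the bracket by `τ` gives existence. Uniqueness holds because an algebra endomorphism over
`φ^*` and a twisted derivation are both local, hence determined by functions and sections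
(`eq_multiTwist`, `AssocHomGerstenhaber.eq_of_derivation`).

Bijection. Both sides are parametrised by the divergences `d`, i.e. `d(fX) = f d(X) - ρ(X)f` and
`d[X,Y] = X(dY) - Y(dX)` for the untwisted structure, which satisfy `d ∘ α = φ^* ∘ d`. An untwisted
generator is determined by its restriction `d` to sections, and its square vanishing on `X ∧ Y` is
the second equation (`generator_isDivergence`, `generator_eq_multiDiv`). In top degree `X ∧ s = 0`
forces `L_{fX} s = f L_X s - (ρ(X)f) s`, so that `L_a - d(a)` is a flat connection; conversely a
flat connection differs from `L` by a `C^∞(M)`-linear endomorphism of sections of a line bundle,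
that is, by a function (`exists_fun_of_linear_top`). Twisted back, `D = τ ∘ div` and `∇ = τ ∘ (L -
d)`. -/

/-- Induction on the exterior algebra by left multiplication with vectors. -/
@[elab_as_elim]
theorem ExteriorAlgebra.left_induction {R P : Type*} [CommRing R] [AddCommGroup P] [Module R P]
    {C : ExteriorAlgebra R P → Prop}
    (algebraMap : ∀ f : R, C (algebraMap R _ f)) (add : ∀ u v, C u → C v → C (u + v))
    (ι_mul : ∀ X u, C u → C (ExteriorAlgebra.ι R X * u)) (u : ExteriorAlgebra R P) : C u :=
  CliffordAlgebra.left_induction 0 algebraMap add (fun u X => ι_mul X u) u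

section Operators

variable {k R P : Type*} [CommRing k] [CommRing R] [Algebra k R] [AddCommGroup P] [Module k P]
  [Module R P] [IsScalarTower k R P]

/-- Semilinear version of the universal property of the exterior algebra, for operators on a
`k`-module `N`. -/
theorem ExteriorAlgebra.exists_operator {N : Type*} [AddCommGroup N] [Module k N]
    (S : R →ₐ[k] Module.End k N) (T : P →ₗ[k] Module.End k N)
    (h1 : ∀ f X, T (f • X) = S f * T X) (h2 : ∀ f X, T X * S f = S f * T X)
    (h3 : ∀ X, T X * T X = 0) :
    ∃ Θ : ExteriorAlgebra R P →ₐ[k] Module.End k N,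
      (∀ f, Θ (algebraMap R _ f) = S f) ∧ ∀ X, Θ (ExteriorAlgebra.ι R X) = T X := by
  -- `N` becomes an `R`-module through `S`. Then `h2` says that each `T X` is `R`-linear, `h1` that
  -- `T` is, and the ordinary universal property applies.
  let _ : Module R N := Module.compHom N (S : R →+* Module.End k N)
  have hS : ∀ (f : R) (x : N), f • x = S f x := fun _ _ => rfl
  have : IsScalarTower k R N := ⟨fun r f x => by simp [hS]⟩
  let T' : P →ₗ[R] Module.End R N :=
    { toFun := fun X =>
        { toFun := T X
          map_add' := map_add _
          map_smul' := fun f x => by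
            simpa [hS] using congrArg (fun t : Module.End k N => t x) (h2 f X) }
      map_add' := fun X Y => by ext x; simp
      map_smul' := fun f X => by ext x; simp [h1, hS] }
  have hT' : ∀ X, T' X * T' X = 0 := fun X => by
    ext x
    exact congrArg (fun t : Module.End k N => t x) (h3 X)
  let Θ := ExteriorAlgebra.lift R ⟨T', hT'⟩
  refine ⟨{ toFun := fun u => (Θ u).restrictScalars k
            map_one' := by ext x; simp
            map_mul' := fun u v => by ext x; simp
            map_zero' := by ext x; simp
            map_add' := fun u v => by ext x; simp
            commutes' := fun r => by
              ext x
              rw [IsScalarTower.algebraMap_apply k R (ExteriorAlgebra R P)]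
              simp [hS] }, fun f => ?_, fun X => ?_⟩
  · ext x
    simp [hS]
  · ext x
    simp [Θ, T']

/-- Existence of operators on an exterior algebra which are given on functions and vectors. -/
theorem ExteriorAlgebra.exists_firstOrder {W : Type*} [AddCommGroup W] [Module k W] [Module R W]
    [Module (ExteriorAlgebra R P) W] [IsScalarTower R (ExteriorAlgebra R P) W]
    [IsScalarTower k (ExteriorAlgebra R P) W] [IsScalarTower k R W]
    (ε : k) (δ : R →ₗ[k] ExteriorAlgebra R P →ₗ[k] W) (d : P →ₗ[k] ExteriorAlgebra R P →ₗ[k] W)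
    (hδ : ∀ f g v, δ (f * g) v = f • δ g v + δ f (g • v))
    (hd : ∀ f X v, d (f • X) v = f • d X v + δ f (ExteriorAlgebra.ι R X * v))
    (hc : ∀ f X v, ε • ExteriorAlgebra.ι R X • δ f v + d X (f • v) =
      f • d X v + δ f (ExteriorAlgebra.ι R X * v))
    (hs : ∀ X v, ε • ExteriorAlgebra.ι R X • d X v + d X (ExteriorAlgebra.ι R X * v) = 0) :
    ∃ D : ExteriorAlgebra R P →ₗ[k] W, (∀ f v, D (f • v) = f • D v + δ f v) ∧
      (∀ X v, D (ExteriorAlgebra.ι R X * v) = ε • ExteriorAlgebra.ι R X • D v + d X v) ∧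
      D 1 = 0 := by
  have hcomm : ∀ (r : k) (u : ExteriorAlgebra R P) (w : W), u • r • w = r • u • w := fun r u w => by
    rw [← algebraMap_smul (ExteriorAlgebra R P) r w, ← mul_smul, ← Algebra.commutes, mul_smul,
      algebraMap_smul]
  have hcomm' : ∀ (r : k) (f : R) (w : W), f • r • w = r • f • w := fun r f w => by
    rw [← algebraMap_smul (ExteriorAlgebra R P) f, ← algebraMap_smul (ExteriorAlgebra R P) f w,
      hcomm]
  have hcomm'' : ∀ (f : R) (u : ExteriorAlgebra R P) (w : W), u • f • w = f • u • w :=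
    fun f u w => by
      rw [← algebraMap_smul (ExteriorAlgebra R P) f w, ← mul_smul, ← Algebra.commutes, mul_smul,
        algebraMap_smul]
  have hδ1 : ∀ v, δ 1 v = 0 := fun v => by simpa using hδ 1 1 v
  -- Functions and vectors act on `Λ × W` by triangular operators with `δ` and `d` off the diagonal.
  -- The hypotheses `hδ`, `hd`, `hc`, `hs` are exactly the relations needed for these operators to
  -- define an action of `Λ`.
  let S : R →ₐ[k] Module.End k (ExteriorAlgebra R P × W) := AlgHom.ofLinearMap
    (LinearMap.mk₂ k (fun f x => (f • x.1, f • x.2 + δ f x.1))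
      (fun f g x => by ext <;> simp [add_smul]; abel)
      (fun r f x => by ext <;> simp [smul_add, smul_assoc])
      (fun f x y => by ext <;> simp [smul_add]; abel)
      (fun r f x => by ext <;> simp [smul_add, hcomm', smul_comm f r x.1]))
    (by ext x <;> simp [hδ1])
    (fun f g => by ext x <;> simp [mul_smul, hδ])
  have hS : ∀ f x, S f x = (f • x.1, f • x.2 + δ f x.1) := fun _ _ => rfl
  let T : P →ₗ[k] Module.End k (ExteriorAlgebra R P × W) :=
    LinearMap.mk₂ k (fun X x => (ExteriorAlgebra.ι R X * x.1,
        ε • ExteriorAlgebra.ι R X • x.2 + d X x.1))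
      (fun f g x => by ext <;> simp [add_smul, add_mul]; abel)
      (fun r f x => by
        have h : ExteriorAlgebra.ι R (r • f) = r • ExteriorAlgebra.ι R f :=
          (ExteriorAlgebra.ι R).map_smul_of_tower r f
        ext <;> simp [h, smul_add, smul_comm r ε])
      (fun f x y => by ext <;> simp [smul_add, mul_add]; abel)
      (fun r f x => by ext <;> simp [smul_add, hcomm, smul_comm r ε])
  have hT : ∀ X x, T X x = (ExteriorAlgebra.ι R X * x.1,
        ε • ExteriorAlgebra.ι R X • x.2 + d X x.1) := fun _ _ => rfl
  obtain ⟨Θ, hΘ1, hΘ2⟩ := ExteriorAlgebra.exists_operator (N := ExteriorAlgebra R P × W) S T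
    (fun f X => LinearMap.ext fun x => by
      simp [hS, hT, hd, smul_add, hcomm', smul_assoc]; abel)
    (fun f X => LinearMap.ext fun x => by
      simp only [Module.End.mul_apply, hS, hT, smul_add, hcomm', hcomm'', add_assoc, hc]
      simp)
    (fun X => LinearMap.ext fun x => by
      simp only [Module.End.mul_apply, hT, smul_add, hcomm, add_assoc, hs]
      simp [← mul_assoc, ← mul_smul])
  -- The first component is plain multiplication, so the second component of `Θ u (1, 0)` satisfies
  -- the required recursion; this is `D u`.
  have h1 : ∀ u x, (Θ u x).1 = u * x.1 := by
    intro u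
    induction u using ExteriorAlgebra.left_induction with
    | algebraMap r => intro x; rw [hΘ1, hS, Algebra.smul_def]
    | add u v hu hv => intro x; simp [hu, hv, add_mul]
    | ι_mul X u hu => intro x; rw [map_mul, Module.End.mul_apply, hΘ2, hT, hu, mul_assoc]
  refine ⟨LinearMap.snd k _ _ ∘ₗ (LinearMap.applyₗ ((1, 0) : ExteriorAlgebra R P × W)) ∘ₗ
    Θ.toLinearMap, fun f v => ?_, fun X v => ?_, ?_⟩
  · simp [Algebra.smul_def f v, hΘ1, hS, h1]
  · simp [hΘ2, hT, h1]
  · simp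

end Operators

/-! ### Lie–Rinehart structures and their Gerstenhaber brackets -/

/-- A Lie–Rinehart structure on the `R`-module `P`, for a commutative `k`-algebra `R`. -/
structure LieRinehart (k R P : Type*) [CommRing k] [CommRing R] [Algebra k R] [AddCommGroup P]
    [Module k P] [Module R P] where
  br : P →ₗ[k] P →ₗ[k] P
  anchor : P →ₗ[R] Derivation k R R
  br_self : ∀ X, br X X = 0
  jacobi : ∀ X Y Z, br X (br Y Z) = br (br X Y) Z + br Y (br X Z)
  br_smul : ∀ X (f : R) Y, br X (f • Y) = f • br X Y + anchor X f • Y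
  anchor_br : ∀ X Y f, anchor (br X Y) f = anchor X (anchor Y f) - anchor Y (anchor X f)

namespace LieRinehart

open ExteriorAlgebra

variable {k R P : Type*} [CommRing k] [CommRing R] [Algebra k R] [AddCommGroup P] [Module k P]
  [Module R P] (A : LieRinehart k R P)

theorem br_comm (X Y : P) : A.br X Y = -A.br Y X := by
  have h := A.br_self (X + Y)
  simp only [map_add, LinearMap.add_apply, A.br_self, add_zero, zero_add] at h
  exact eq_neg_of_add_eq_zero_right h

theorem smul_br (f : R) (X Y : P) : A.br (f • X) Y = f • A.br X Y - A.anchor Y f • X := by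
  rw [A.br_comm, A.br_smul, A.br_comm Y X, smul_neg]
  abel

/-- The grading involution of the exterior algebra. -/
abbrev sgn : ExteriorAlgebra R P →ₐ[R] ExteriorAlgebra R P := CliffordAlgebra.involute

@[simp] theorem sgn_ι (X : P) : sgn (ι R X) = -ι R X := CliffordAlgebra.involute_ι X

theorem ι_mul_comm (X : P) (u : ExteriorAlgebra R P) : ι R X * u = sgn u * ι R X := by
  induction u using ExteriorAlgebra.left_induction with
  | algebraMap r => rw [AlgHom.commutes, Algebra.commutes]
  | add u v hu hv => rw [mul_add, hu, hv, map_add, add_mul]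
  | ι_mul Y u hu =>
    rw [map_mul]
    rw [sgn_ι]
    rw [mul_assoc, ← hu, ← mul_assoc, ← mul_assoc, neg_mul]
    congr 1
    exact eq_neg_of_add_eq_zero_left (ι_add_mul_swap X Y)

/-- The differential of a function, as a linear form on `P`. -/
def diff (f : R) : Module.Dual R P where
  toFun X := A.anchor X f
  map_add' X Y := by simp
  map_smul' g X := by simp

@[simp] theorem diff_apply (f : R) (X : P) : A.diff f X = A.anchor X f := rfl

variable [IsScalarTower k R P]

/-- Contraction with the differential of a function. -/
def contr : R →ₗ[k] ExteriorAlgebra R P →ₗ[k] ExteriorAlgebra R P :=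
  LinearMap.mk₂ k (fun f u => CliffordAlgebra.contractLeft (A.diff f) u)
    (fun f g u => by
      rw [show A.diff (f + g) = A.diff f + A.diff g by ext; simp, map_add]; rfl)
    (fun r f u => by
      rw [show A.diff (r • f) = algebraMap k R r • A.diff f by ext; simp [Algebra.smul_def],
        map_smul, ← algebraMap_smul R r]; rfl)
    (fun f u v => map_add _ _ _)
    (fun r f u => LinearMap.map_smul_of_tower _ _ _)

theorem contr_mul (f g : R) (u : ExteriorAlgebra R P) :
    A.contr (f * g) u = f • A.contr g u + g • A.contr f u := by
  change CliffordAlgebra.contractLeft (A.diff (f * g)) u = _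
  rw [show A.diff (f * g) = f • A.diff g + g • A.diff f by ext; simp, map_add, map_smul,
    map_smul]
  rfl

@[simp] theorem contr_smul (f g : R) (u : ExteriorAlgebra R P) :
    A.contr f (g • u) = g • A.contr f u :=
  (CliffordAlgebra.contractLeft (A.diff f)).map_smul g u

@[simp] theorem contr_algebraMap (f g : R) :
    A.contr f (algebraMap R (ExteriorAlgebra R P) g) = 0 :=
  CliffordAlgebra.contractLeft_algebraMap (Q := 0) (d := A.diff f) g

@[simp] theorem contr_ι_mul (f : R) (X : P) (u : ExteriorAlgebra R P) :
    A.contr f (ι R X * u) = A.anchor X f • u - ι R X * A.contr f u :=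
  CliffordAlgebra.contractLeft_ι_mul _ _ _

theorem contr_contr (f g : R) (u : ExteriorAlgebra R P) :
    A.contr f (A.contr g u) = -A.contr g (A.contr f u) :=
  CliffordAlgebra.contractLeft_comm _ _ _

/-- This is a first-order recursion with `ε = 1`. It is consistent by the Leibniz rule of `A.br`,
and because `[X, Y]` and `Y` anticommute in the exterior algebra. -/
theorem exists_lie (X : P) : ∃ L : ExteriorAlgebra R P →ₗ[k] ExteriorAlgebra R P,
    (∀ f v, L (f • v) = f • L v + A.anchor X f • v) ∧
    (∀ Y v, L (ι R Y * v) = ι R Y * L v + ι R (A.br X Y) * v) ∧ L 1 = 0 := by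
  obtain ⟨D, h1, h2, h3⟩ := ExteriorAlgebra.exists_firstOrder (P := P)
    (W := ExteriorAlgebra R P) (1 : k)
    (LinearMap.mk₂ k (fun f v => A.anchor X f • v)
      (fun f g v => by simp [add_smul]) (fun r f v => by simp)
      (fun f u v => by simp) (fun r f v => by simp [smul_comm r]))
    (LinearMap.mk₂ k (fun Y v => ι R (A.br X Y) * v)
      (fun f g v => by simp [add_mul])
      (fun r f v => by
        rw [map_smul, show ι R (r • A.br X f) = r • ι R (A.br X f) from
          (ι R).map_smul_of_tower r _, smul_mul_assoc])
      (fun f u v => by simp [mul_add]) (fun r f v => by simp))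
    (fun f g v => by simp [add_smul, mul_smul, smul_comm g])
    (fun f Y v => by simp [A.br_smul, add_mul])
    (fun f Y v => by simp; abel)
    (fun Y v => by
      simp only [LinearMap.mk₂_apply, one_smul, smul_eq_mul, ← mul_assoc]
      rw [← add_mul, ι_add_mul_swap, zero_mul])
  exact ⟨D, h1, fun Y v => by simpa using h2 Y v, h3⟩

/-- The Lie derivative along `X ∈ P`. -/
def lieAux (X : P) : ExteriorAlgebra R P →ₗ[k] ExteriorAlgebra R P := (A.exists_lie X).choose

theorem lieAux_smul (X : P) (f : R) (v : ExteriorAlgebra R P) :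
    A.lieAux X (f • v) = f • A.lieAux X v + A.anchor X f • v :=
  (A.exists_lie X).choose_spec.1 f v

theorem lieAux_ι_mul (X Y : P) (v : ExteriorAlgebra R P) :
    A.lieAux X (ι R Y * v) = ι R Y * A.lieAux X v + ι R (A.br X Y) * v :=
  (A.exists_lie X).choose_spec.2.1 Y v

theorem lieAux_algebraMap (X : P) (f : R) :
    A.lieAux X (algebraMap R _ f) = algebraMap R _ (A.anchor X f) := by
  have h : A.lieAux X 1 = 0 := (A.exists_lie X).choose_spec.2.2
  rw [Algebra.algebraMap_eq_smul_one, lieAux_smul, h, smul_zero, zero_add,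
    Algebra.algebraMap_eq_smul_one]

/-- The Lie derivative along `X ∈ P`, depending linearly on `X`. -/
def lie : P →ₗ[k] ExteriorAlgebra R P →ₗ[k] ExteriorAlgebra R P :=
  LinearMap.mk₂ k (fun X v => A.lieAux X v)
    -- `lieAux` is chosen separately for each `X`, so linearity in `X` has to be recovered by
    -- induction on `v`.
    (fun X Y v => by
      induction v using ExteriorAlgebra.left_induction with
      | algebraMap r => rw [lieAux_algebraMap, lieAux_algebraMap, lieAux_algebraMap]; simp
      | add u v hu hv => simp only [map_add, hu, hv]; abel
      | ι_mul Z u hu =>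
        rw [lieAux_ι_mul, lieAux_ι_mul, lieAux_ι_mul]
        simp only [hu, map_add, LinearMap.add_apply, mul_add, add_mul]; abel)
    (fun r X v => by
      induction v using ExteriorAlgebra.left_induction with
      | algebraMap f =>
        rw [lieAux_algebraMap, lieAux_algebraMap]
        rw [← algebraMap_smul R r X, map_smul, ← algebraMap_smul R r]
        simp [Algebra.smul_def]
      | add u v hu hv => simp only [map_add, hu, hv, smul_add]
      | ι_mul Z u hu =>
        rw [lieAux_ι_mul, lieAux_ι_mul]
        rw [hu, map_smul, LinearMap.smul_apply, show ι R (r • A.br X Z) = r • ι R (A.br X Z) from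
          (ι R).map_smul_of_tower r _, smul_mul_assoc, mul_smul_comm, smul_add])
    (fun X u v => map_add _ _ _) (fun r X v => map_smul _ _ _)

theorem lie_smul (X : P) (f : R) (v : ExteriorAlgebra R P) :
    A.lie X (f • v) = f • A.lie X v + A.anchor X f • v := A.lieAux_smul X f v

theorem lie_ι_mul (X Y : P) (v : ExteriorAlgebra R P) :
    A.lie X (ι R Y * v) = ι R Y * A.lie X v + ι R (A.br X Y) * v := A.lieAux_ι_mul X Y v

@[simp] theorem lie_algebraMap (X : P) (f : R) :
    A.lie X (algebraMap R _ f) = algebraMap R _ (A.anchor X f) := A.lieAux_algebraMap X f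

theorem lie_ι (X Y : P) : A.lie X (ι R Y) = ι R (A.br X Y) := by
  have h := A.lie_ι_mul X Y 1
  rwa [← map_one (algebraMap R _), lie_algebraMap, map_one, mul_one, mul_one,
    Derivation.map_one_eq_zero, map_zero, mul_zero, zero_add] at h

/-- The defect comes from the term `-ρ(Y)f · X` in `[fX, Y]`. It is the correction that makes the
recursion of `exists_bracket` consistent under `X ↦ f • X`. -/
theorem smul_lie (f : R) (X : P) (v : ExteriorAlgebra R P) :
    A.lie (f • X) v = f • A.lie X v - ι R X * A.contr f v := by
  induction v using ExteriorAlgebra.left_induction with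
  | algebraMap g => simp [Algebra.smul_def]
  | add u v hu hv => simp only [map_add, hu, hv, smul_add, mul_add]; abel
  | ι_mul Y u hu =>
    rw [lie_ι_mul, lie_ι_mul, contr_ι_mul]
    rw [hu, smul_br, map_sub, map_smul, map_smul, sub_mul, smul_mul_assoc, smul_mul_assoc, mul_sub,
      mul_sub, mul_smul_comm, mul_smul_comm, smul_add, ← mul_assoc, ← mul_assoc,
      eq_neg_of_add_eq_zero_left (ι_add_mul_swap X Y)]
    simp only [neg_mul]
    abel

/-- A Cartan relation: on a product with a vector `Y` it reduces to `anchor_br` for `X` and `Y`. It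
is the base case of `lie_bracket`. -/
theorem lie_contr (X : P) (f : R) (v : ExteriorAlgebra R P) :
    A.lie X (A.contr f v) = A.contr f (A.lie X v) + A.contr (A.anchor X f) v := by
  induction v using ExteriorAlgebra.left_induction with
  | algebraMap g => simp
  | add u v hu hv => simp only [map_add, hu, hv]; abel
  | ι_mul Y u hu =>
    rw [lie_ι_mul, contr_ι_mul, contr_ι_mul]
    simp only [map_sub, map_add, lie_smul]
    rw [lie_ι_mul, contr_ι_mul, contr_ι_mul]
    simp only [hu, A.anchor_br, sub_smul, mul_add]
    abel

/-- Both sides are derivations, so it suffices to compare them on functions (`anchor_br`) and on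
vectors (`jacobi`). -/
theorem lie_br (X Y : P) (v : ExteriorAlgebra R P) :
    A.lie (A.br X Y) v = A.lie X (A.lie Y v) - A.lie Y (A.lie X v) := by
  induction v using ExteriorAlgebra.left_induction with
  | algebraMap g => simp [A.anchor_br]
  | add u v hu hv => simp only [map_add, hu, hv]; abel
  | ι_mul Z u hu =>
    rw [lie_ι_mul, lie_ι_mul, lie_ι_mul]
    simp only [map_add]
    rw [lie_ι_mul, lie_ι_mul, lie_ι_mul, lie_ι_mul]
    simp only [hu, A.jacobi X Y Z, mul_sub, map_add, add_mul]
    abel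

/-- The map `u ↦ [u, ·]` is built as one operator-valued recursion, with `W` the space of `k`-linear
endomorphisms of the exterior algebra. A function contributes contraction with its differential, a
vector its Lie derivative. -/
theorem exists_bracket :
    ∃ B : ExteriorAlgebra R P →ₗ[k] ExteriorAlgebra R P →ₗ[k] ExteriorAlgebra R P,
    (∀ f v w, B (f • v) w = f • B v w - v * A.contr f w) ∧
    (∀ X v w, B (ι R X * v) w = ι R X * B v w + sgn v * A.lie X w) ∧ B 1 = 0 := by
  have hsm : ∀ (f : R) (v : ExteriorAlgebra R P)
      (T : ExteriorAlgebra R P →ₗ[k] ExteriorAlgebra R P), (f • v) • T = f • v • T :=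
    fun f v T => smul_assoc f v T
  have hsk : ∀ (f : k) (v : ExteriorAlgebra R P)
      (T : ExteriorAlgebra R P →ₗ[k] ExteriorAlgebra R P), (f • v) • T = f • v • T :=
    fun f v T => smul_assoc f v T
  have hc : ∀ (f : R) (v : ExteriorAlgebra R P)
      (T : ExteriorAlgebra R P →ₗ[k] ExteriorAlgebra R P), v • f • T = f • v • T :=
    fun f v T => by ext w; simp
  have hsg : ∀ (r : k) (v : ExteriorAlgebra R P), sgn (r • v) = r • sgn v := fun r v =>
    (sgn : ExteriorAlgebra R P →ₐ[R] ExteriorAlgebra R P).toLinearMap.map_smul_of_tower r v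
  obtain ⟨D, h1, h2, h3⟩ := ExteriorAlgebra.exists_firstOrder (P := P)
    (W := ExteriorAlgebra R P →ₗ[k] ExteriorAlgebra R P) (1 : k)
    (LinearMap.mk₂ k (fun f v => -(v • A.contr f))
      (fun f g v => by simp; abel) (fun r f v => by ext w; simp)
      (fun f u v => by simp [add_smul]; abel) (fun r f v => by ext w; simp))
    (LinearMap.mk₂ k (fun X v => sgn v • A.lie X)
      (fun X Y v => by simp) (fun r X v => by ext w; simp)
      (fun f u v => by simp [add_smul]) (fun r X v => by rw [hsg, hsk]))
    (fun f g v => by ext w; simp [contr_mul, mul_add]; abel)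
    (fun f X v => by
      ext w
      simp only [LinearMap.mk₂_apply, LinearMap.smul_apply, smul_lie, smul_eq_mul, mul_sub,
        LinearMap.add_apply, LinearMap.neg_apply, ι_mul_comm X v, mul_assoc, mul_smul_comm]
      abel)
    (fun f X v => by
      ext w
      simp [mul_assoc]
      abel)
    (fun X v => by
      ext w
      simp [← mul_assoc])
  refine ⟨D, fun f v w => ?_, fun X v w => ?_, h3⟩
  · rw [h1]; simp [sub_eq_add_neg]
  · rw [h2]; simp

/-- The Gerstenhaber bracket on the exterior algebra. -/
def bracket : ExteriorAlgebra R P →ₗ[k] ExteriorAlgebra R P →ₗ[k] ExteriorAlgebra R P :=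
  A.exists_bracket.choose

theorem smul_bracket (f : R) (v w : ExteriorAlgebra R P) :
    A.bracket (f • v) w = f • A.bracket v w - v * A.contr f w :=
  A.exists_bracket.choose_spec.1 f v w

theorem ι_mul_bracket (X : P) (v w : ExteriorAlgebra R P) :
    A.bracket (ι R X * v) w = ι R X * A.bracket v w + sgn v * A.lie X w :=
  A.exists_bracket.choose_spec.2.1 X v w

theorem algebraMap_bracket (f : R) (w : ExteriorAlgebra R P) :
    A.bracket (algebraMap R _ f) w = -A.contr f w := by
  have h : A.bracket 1 = 0 := A.exists_bracket.choose_spec.2.2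
  simp [Algebra.algebraMap_eq_smul_one, smul_bracket, h]

theorem ι_bracket (X : P) (w : ExteriorAlgebra R P) : A.bracket (ι R X) w = A.lie X w := by
  have h : A.bracket 1 = 0 := A.exists_bracket.choose_spec.2.2
  simpa [h] using A.ι_mul_bracket X 1 w

end LieRinehart

/-! ### Degrees in the exterior algebra -/

theorem ExteriorAlgebra.algebraMap_mem (R P : Type*) [CommRing R] [AddCommGroup P] [Module R P]
    (f : R) : algebraMap R (ExteriorAlgebra R P) f ∈ ⋀[R]^0 P := by
  rw [exteriorPower, pow_zero]
  exact Submodule.algebraMap_mem f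

theorem ExteriorAlgebra.ι_mem {R P : Type*} [CommRing R] [AddCommGroup P] [Module R P] (X : P) :
    ExteriorAlgebra.ι R X ∈ ⋀[R]^1 P := by
  rw [exteriorPower, pow_one]
  exact ⟨X, rfl⟩

theorem ExteriorAlgebra.mul_mem {R P : Type*} [CommRing R] [AddCommGroup P] [Module R P]
    {i j l : ℕ} (h : l = i + j) {u v : ExteriorAlgebra R P} (hu : u ∈ ⋀[R]^i P)
    (hv : v ∈ ⋀[R]^j P) : u * v ∈ ⋀[R]^l P := by
  subst h
  rw [exteriorPower, pow_add]
  exact Submodule.mul_mem_mul hu hv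

/-- Induction on homogeneous elements of the exterior algebra by left multiplication with
vectors. -/
@[elab_as_elim]
theorem ExteriorAlgebra.homogeneous_induction {R P : Type*} [CommRing R] [AddCommGroup P]
    [Module R P] {C : ∀ (i : ℕ) (u : ExteriorAlgebra R P), u ∈ ⋀[R]^i P → Prop}
    (algebraMap : ∀ f : R, C 0 (algebraMap R _ f) (algebraMap_mem R P f))
    (add : ∀ i u v hu hv, C i u hu → C i v hv → C i (u + v) (add_mem hu hv))
    (ι_mul : ∀ i X u hu, C i u hu →
      C (i + 1) (ExteriorAlgebra.ι R X * u) (mul_mem (add_comm i 1) (ι_mem X) hu))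
    {i : ℕ} {u : ExteriorAlgebra R P} (hu : u ∈ ⋀[R]^i P) : C i u hu := by
  refine Submodule.pow_induction_on_left' (C := C) _ algebraMap
    (fun x y i hx hy => add i x y hx hy) ?_ hu
  rintro _ ⟨X, rfl⟩ i u hu h
  exact ι_mul i X u hu h

/-! ### Graded identities of the Gerstenhaber bracket -/

namespace LieRinehart

open ExteriorAlgebra

section Signs

variable {k R P : Type*} [CommRing k] [CommRing R] [Algebra k R] [AddCommGroup P] [Module k P]
  [Module R P] [IsScalarTower k R P]

variable (k) in
theorem sgn_of_mem {i : ℕ} {u : ExteriorAlgebra R P} (hu : u ∈ ⋀[R]^i P) :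
    sgn u = (-1 : k) ^ i • u := by
  induction hu using homogeneous_induction with
  | algebraMap f => rw [AlgHom.commutes]; simp
  | add i u v _ _ hu hv => rw [map_add, hu, hv, smul_add]
  | ι_mul i X u _ hu => rw [map_mul, sgn_ι, hu]; simp [pow_succ]

theorem sgn_mem {i : ℕ} {u : ExteriorAlgebra R P} (hu : u ∈ ⋀[R]^i P) : sgn u ∈ ⋀[R]^i P := by
  rw [sgn_of_mem R hu]
  exact Submodule.smul_mem _ _ hu

variable (k) in
theorem graded_comm {i j : ℕ} {u v : ExteriorAlgebra R P} (hu : u ∈ ⋀[R]^i P)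
    (hv : v ∈ ⋀[R]^j P) : u * v = (-1 : k) ^ (i * j) • (v * u) := by
  induction hu using homogeneous_induction with
  | algebraMap f => rw [Algebra.commutes]; simp
  | add i u u' _ _ hu hu' => rw [add_mul, hu, hu', mul_add, smul_add]
  | ι_mul i X u _ hu =>
    rw [mul_assoc, hu, mul_smul_comm, ← mul_assoc, ι_mul_comm, sgn_of_mem k hv, smul_mul_assoc,
      smul_mul_assoc, smul_smul, mul_assoc, add_mul, one_mul, pow_add]

end Signs

variable {k R P : Type*} [CommRing k] [CommRing R] [Algebra k R] [AddCommGroup P] [Module k P]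
  [Module R P] [IsScalarTower k R P] (A : LieRinehart k R P)

/-- Degree `-1` is split into two clauses to avoid truncated subtraction. The vanishing clause also
serves the induction step at `i = 0`, where the product of `X` with the contraction has to
disappear. -/
theorem contr_degree (f : R) {i : ℕ} {u : ExteriorAlgebra R P} (hu : u ∈ ⋀[R]^i P) :
    (i = 0 → A.contr f u = 0) ∧ ∀ j, j + 1 = i → A.contr f u ∈ ⋀[R]^j P := by
  induction hu using homogeneous_induction with
  | algebraMap g => exact ⟨fun _ => by simp, fun j h => by omega⟩
  | add i u v _ _ hu hv =>
    refine ⟨fun h => by rw [map_add, hu.1 h, hv.1 h, add_zero], fun j h => ?_⟩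
    rw [map_add]
    exact add_mem (hu.2 j h) (hv.2 j h)
  | ι_mul i X u hu h =>
    refine ⟨fun h => by omega, fun j hj => ?_⟩
    obtain rfl : j = i := by omega
    rw [contr_ι_mul]
    refine sub_mem (Submodule.smul_mem _ _ hu) ?_
    rcases j with _ | j
    · rw [h.1 rfl, mul_zero]; exact zero_mem _
    · exact mul_mem (add_comm _ _) (ι_mem X) (h.2 j rfl)

theorem lie_mem (X : P) {i : ℕ} {u : ExteriorAlgebra R P} (hu : u ∈ ⋀[R]^i P) :
    A.lie X u ∈ ⋀[R]^i P := by
  induction hu using homogeneous_induction with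
  | algebraMap g => rw [lie_algebraMap]; exact algebraMap_mem _ _ _
  | add i u v _ _ hu hv => rw [map_add]; exact add_mem hu hv
  | ι_mul i Y u hu h =>
    rw [lie_ι_mul]
    exact add_mem (mul_mem (add_comm _ _) (ι_mem Y) h) (mul_mem (add_comm _ _) (ι_mem _) hu)

theorem bracket_degree {i j : ℕ} {u v : ExteriorAlgebra R P} (hu : u ∈ ⋀[R]^i P)
    (hv : v ∈ ⋀[R]^j P) :
    (i + j = 0 → A.bracket u v = 0) ∧ ∀ l, l + 1 = i + j → A.bracket u v ∈ ⋀[R]^l P := by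
  induction hu using homogeneous_induction with
  | algebraMap f =>
    rw [algebraMap_bracket, zero_add]
    refine ⟨fun h => by rw [(A.contr_degree f hv).1 h, neg_zero], fun l hl => ?_⟩
    exact neg_mem ((A.contr_degree f hv).2 l hl)
  | add i u u' _ _ hu hu' =>
    rw [map_add, LinearMap.add_apply]
    exact ⟨fun h => by rw [hu.1 h, hu'.1 h, add_zero], fun l h => add_mem (hu.2 l h) (hu'.2 l h)⟩
  | ι_mul i X u hu h =>
    refine ⟨fun h => by omega, fun l hl => ?_⟩
    rw [ι_mul_bracket]
    refine add_mem ?_ (mul_mem (by omega) (sgn_mem hu) (A.lie_mem X hv))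
    rcases l with _ | l
    · rw [h.1 (by omega), mul_zero]; exact zero_mem _
    · exact mul_mem (add_comm _ _) (ι_mem X) (h.2 l (by omega))

theorem contr_mul_right (f : R) (u w : ExteriorAlgebra R P) :
    A.contr f (u * w) = A.contr f u * w + sgn u * A.contr f w := by
  induction u using ExteriorAlgebra.left_induction with
  | algebraMap g => rw [AlgHom.commutes, ← Algebra.smul_def, contr_smul]; simp [Algebra.smul_def]
  | add u v hu hv => simp only [add_mul, map_add, hu, hv]; abel
  | ι_mul X u hu =>
    rw [mul_assoc, contr_ι_mul, contr_ι_mul, hu, map_mul, sgn_ι, sub_mul, mul_add, smul_mul_assoc]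
    simp only [mul_assoc, neg_mul]
    abel

theorem lie_mul (X : P) (u w : ExteriorAlgebra R P) :
    A.lie X (u * w) = A.lie X u * w + u * A.lie X w := by
  induction u using ExteriorAlgebra.left_induction with
  | algebraMap g => rw [← Algebra.smul_def, lie_smul]; simp [Algebra.smul_def, add_comm]
  | add u v hu hv => simp only [add_mul, map_add, hu, hv]; abel
  | ι_mul Y u hu =>
    rw [mul_assoc, lie_ι_mul, lie_ι_mul, hu, mul_add, add_mul]
    simp only [mul_assoc]
    abel

theorem bracket_mul {i j : ℕ} {u v : ExteriorAlgebra R P} (hu : u ∈ ⋀[R]^i P)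
    (hv : v ∈ ⋀[R]^j P) (w : ExteriorAlgebra R P) :
    A.bracket u (v * w) =
      A.bracket u v * w + (-1 : k) ^ ((i + 1) * j) • (v * A.bracket u w) := by
  induction hu using homogeneous_induction with
  | algebraMap f =>
    simp only [algebraMap_bracket, contr_mul_right, sgn_of_mem k hv]
    simp
    abel
  | add i u u' _ _ hu hu' => 
    simp only [map_add, LinearMap.add_apply, hu, hu', add_mul (A.bracket u v), mul_add v, smul_add]
    abel
  | ι_mul i X u hu h =>
    have h1 : ι R X * v = (-1 : k) ^ j • (v * ι R X) := by
      rw [ι_mul_comm, sgn_of_mem k hv, smul_mul_assoc]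
    have h2 := graded_comm k hu hv
    simp only [ι_mul_bracket, h, lie_mul, sgn_of_mem k hu, mul_add, add_mul, smul_mul_assoc,
      mul_smul_comm, smul_add, ← mul_assoc, h1, h2, smul_smul]
    -- Both sides now consist of the same products up to sign, and the signs depend only on the
    -- parities of `i` and `j`.
    rcases Nat.even_or_odd i with hi | hi <;> rcases Nat.even_or_odd j with hj | hj <;>
        simp [pow_add, pow_mul, hi.neg_one_pow, hj.neg_one_pow] <;> abel

theorem mul_bracket {i j : ℕ} {u v : ExteriorAlgebra R P} (hu : u ∈ ⋀[R]^i P)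
    (hv : v ∈ ⋀[R]^j P) (w : ExteriorAlgebra R P) :
    A.bracket (u * v) w =
      u * A.bracket v w + (-1 : k) ^ (i * j) • (v * A.bracket u w) := by
  induction hu using homogeneous_induction with
  | algebraMap f =>
    rw [← Algebra.smul_def, smul_bracket, algebraMap_bracket, ← Algebra.smul_def]
    simp [sub_eq_add_neg]
  | add i u u' _ _ hu hu' => 
    simp only [map_add, LinearMap.add_apply, hu, hu', add_mul u, mul_add v, smul_add]
    abel
  | ι_mul i X u hu h =>
    have h1 : ι R X * v = (-1 : k) ^ j • (v * ι R X) := by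
      rw [ι_mul_comm, sgn_of_mem k hv, smul_mul_assoc]
    have h2 := graded_comm k hu hv
    simp only [mul_assoc, ι_mul_bracket, h, map_mul, sgn_of_mem k hu, sgn_of_mem k hv, mul_add,
      smul_mul_assoc, mul_smul_comm, smul_add, smul_smul]
    simp only [← mul_assoc, h1, h2, smul_mul_assoc, smul_smul]
    rcases Nat.even_or_odd i with hi | hi <;> rcases Nat.even_or_odd j with hj | hj <;>
        simp [add_mul, pow_add, pow_mul, hi.neg_one_pow, hj.neg_one_pow] <;> abel

theorem bracket_algebraMap {i : ℕ} {u : ExteriorAlgebra R P} (hu : u ∈ ⋀[R]^i P) (f : R) :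
    A.bracket u (algebraMap R _ f) = (-1 : k) ^ (i + 1) • A.contr f u := by
  induction hu using homogeneous_induction with
  | algebraMap g => simp [algebraMap_bracket]
  | add i u u' _ _ hu hu' => simp only [map_add, LinearMap.add_apply, hu, hu', smul_add]
  | ι_mul i X u hu h =>
    rw [ι_mul_bracket, h, lie_algebraMap, sgn_of_mem k hu, contr_ι_mul, smul_mul_assoc,
      mul_smul_comm, ← Algebra.commutes, ← Algebra.smul_def, smul_sub]
    simp only [pow_succ, mul_neg, mul_one, neg_neg, neg_smul]
    abel

/-- Skew-symmetry against a vector, needed before the general case because the bracket is defined by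
recursion on its first argument only. -/
theorem bracket_ι (u : ExteriorAlgebra R P) (Y : P) :
    A.bracket u (ι R Y) = -A.lie Y u := by
  induction u using ExteriorAlgebra.left_induction with
  | algebraMap g => 
    rw [algebraMap_bracket, lie_algebraMap, ← mul_one (ι R Y), contr_ι_mul,
      ← map_one (algebraMap R (ExteriorAlgebra R P)), contr_algebraMap, mul_zero, sub_zero,
      map_one, Algebra.algebraMap_eq_smul_one]
  | add u u' hu hu' => simp only [map_add, LinearMap.add_apply, hu, hu']; abel
  | ι_mul X u h =>
    rw [ι_mul_bracket, h, lie_ι_mul, lie_ι, ← ι_mul_comm, A.br_comm]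
    simp only [map_neg, neg_mul, mul_neg]
    abel

/-- Induction on `u`: functions are covered by `bracket_algebraMap`, and for `X ∧ u` the Leibniz
rule in the second argument expands `[v, X ∧ u]`, with `[v, X] = -L_X v`. -/
theorem bracket_skew {i j : ℕ} {u v : ExteriorAlgebra R P} (hu : u ∈ ⋀[R]^i P)
    (hv : v ∈ ⋀[R]^j P) :
    A.bracket u v = -((-1 : k) ^ ((i + 1) * (j + 1)) • A.bracket v u) := by
  induction hu using homogeneous_induction with
  | algebraMap f =>
    rw [algebraMap_bracket, bracket_algebraMap A hv, smul_smul, ← pow_add]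
    simp [← two_mul]
  | add i u u' _ _ hu hu' => simp only [map_add, LinearMap.add_apply, hu, hu', smul_add]; abel
  | ι_mul i X u hu h =>
    have hX := A.lie_mem X hv
    rw [ι_mul_bracket, h, bracket_mul A hv (ι_mem X), bracket_ι, sgn_of_mem k hu, smul_mul_assoc,
      graded_comm k hu hX]
    simp only [neg_mul, mul_neg, smul_add, smul_neg, neg_neg, neg_add, mul_smul_comm, smul_smul]
    rcases Nat.even_or_odd i with hi | hi <;> rcases Nat.even_or_odd j with hj | hj <;>
        simp [add_mul, mul_add, pow_add, pow_mul, hi.neg_one_pow, hj.neg_one_pow] <;> abel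

/-- The Jacobi identity with a vector in the first slot. It comes from `lie_contr` when `v` is a
function and from `lie_br` in the induction step. -/
theorem lie_bracket (X : P) (v w : ExteriorAlgebra R P) :
    A.lie X (A.bracket v w) = A.bracket (A.lie X v) w + A.bracket v (A.lie X w) := by
  induction v using ExteriorAlgebra.left_induction with
  | algebraMap f => simp only [algebraMap_bracket, map_neg, lie_contr, lie_algebraMap]; abel
  | add u u' hu hu' => simp only [map_add, LinearMap.add_apply, hu, hu']; abel
  | ι_mul Y v h =>
    have h1 : ∀ v, A.lie X (sgn v) = sgn (A.lie X v) := fun v => by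
      induction v using ExteriorAlgebra.left_induction with
      | algebraMap f => simp
      | add u u' hu hu' => simp only [map_add, hu, hu']
      | ι_mul Y v h => 
        rw [map_mul sgn, sgn_ι, lie_ι_mul, map_add, map_mul sgn, map_mul sgn, sgn_ι, sgn_ι,
          neg_mul, map_neg, lie_ι_mul, h, neg_mul, neg_mul, neg_add]
    have h2 := A.lie_mul X (sgn v) (A.lie Y w)
    simp only [ι_mul_bracket, map_add, lie_ι_mul, h, h2, LinearMap.add_apply, h1, mul_add,
      A.lie_br X Y, mul_sub]
    abel

/-- The Jacobi identity with a function in the first slot, where the bracket is minus a contraction.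
-/
theorem contr_bracket (f : R) {j : ℕ} {v : ExteriorAlgebra R P} (hv : v ∈ ⋀[R]^j P)
    (w : ExteriorAlgebra R P) :
    A.contr f (A.bracket v w) =
      A.bracket (A.contr f v) w - (-1 : k) ^ j • A.bracket v (A.contr f w) := by
  induction hv using homogeneous_induction with
  | algebraMap g => simp [algebraMap_bracket, A.contr_contr f g]
  | add i u u' _ _ hu hu' => simp only [map_add, LinearMap.add_apply, hu, hu', smul_add]; abel
  | ι_mul j X v hv h =>
    have hs : sgn (A.contr f v) = -(-1 : k) ^ j • A.contr f v := by
      rcases j with _ | j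
      · simp [(A.contr_degree f hv).1 rfl]
      · rw [sgn_of_mem k ((A.contr_degree f hv).2 j rfl), pow_succ]; simp
    have h1 := A.lie_contr X f w
    have h2 := A.contr_mul_right f v (A.lie X w)
    simp only [ι_mul_bracket, map_add, contr_ι_mul, h, h2, sgn_of_mem k hv, map_sub, map_smul,
      LinearMap.sub_apply, smul_bracket, hs, smul_mul_assoc, mul_smul_comm, smul_smul,
      mul_sub, mul_add, h1, smul_add]
    rcases Nat.even_or_odd j with hj | hj <;> simp [pow_add, hj.neg_one_pow] <;> abel

/-- `contr_bracket` is the base case. For `X ∧ u`, `lie_bracket` treats the contribution of `X`, and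
the mixed terms cancel once the two Leibniz rules and skew-symmetry are inserted. -/
theorem bracket_bracket {i j : ℕ} {u v : ExteriorAlgebra R P} (hu : u ∈ ⋀[R]^i P)
    (hv : v ∈ ⋀[R]^j P) (w : ExteriorAlgebra R P) :
    A.bracket u (A.bracket v w) = A.bracket (A.bracket u v) w +
      (-1 : k) ^ ((i + 1) * (j + 1)) • A.bracket v (A.bracket u w) := by
  induction hu using homogeneous_induction with
  | algebraMap f =>
    rw [algebraMap_bracket, contr_bracket A f hv]
    simp [algebraMap_bracket, pow_succ]
    abel
  | add i u u' _ _ hu hu' => simp only [map_add, LinearMap.add_apply, hu, hu', smul_add]; abel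
  | ι_mul i X u hu h =>
    -- The degree of the bracket is `i + j - 1`; the exponent `i + j + 1` has the same parity. For
    -- `i + j = 0` the bracket is zero and any sign will do.
    have hs : sgn (A.bracket u v) = (-1 : k) ^ (i + j + 1) • A.bracket u v := by
      rcases h0 : i + j with _ | l
      · rw [(A.bracket_degree hu hv).1 h0, map_zero, smul_zero]
      · rw [sgn_of_mem k ((A.bracket_degree hu hv).2 l h0.symm), pow_succ, pow_succ]
        simp
    have h1 := A.mul_bracket hu (A.lie_mem X hv) w
    have h2 := A.bracket_mul hv hu (A.lie X w)
    have h3 := A.bracket_mul hv (ι_mem X) (A.bracket u w)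
    rw [bracket_ι] at h3
    rw [A.bracket_skew hv hu] at h2
    simp only [ι_mul_bracket, h, lie_bracket, sgn_of_mem k hu, hs, map_add, map_smul,
      LinearMap.add_apply, LinearMap.smul_apply, smul_mul_assoc, mul_smul_comm, smul_smul, mul_add,
      h1, h2, h3, smul_add, neg_mul, smul_neg]
    rcases Nat.even_or_odd i with hi | hi <;> rcases Nat.even_or_odd j with hj | hj <;>
        simp [add_mul, pow_add, pow_mul, hi.neg_one_pow, hj.neg_one_pow] <;> abel

end LieRinehart

/-! ### The Gerstenhaber algebra and its divergence operators -/

namespace LieRinehart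

open ExteriorAlgebra

variable {k R P : Type*} [CommRing k] [CommRing R] [Algebra k R] [AddCommGroup P] [Module k P]
  [Module R P] [IsScalarTower k R P] (A : LieRinehart k R P)

/-- The exterior algebra of a Lie–Rinehart algebra is a Gerstenhaber algebra. -/
theorem isHomGerstenhaber :
    IsHomGerstenhaber (fun i => (⋀[R]^i P).restrictScalars k) (AlgHom.id k _) A.bracket where
  graded := 
    { one_mem := by simp
      mul_mem := fun _ _ _ _ hu hv => mul_mem rfl hu hv }
  internal := DirectSum.Decomposition.isInternal (fun i : ℕ => ⋀[R]^i P)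
  graded_comm _ _ _ hu _ hv := graded_comm k hu hv
  twist_degree _ _ h := h
  bracket_degree _ _ l h _ hu _ hv := (A.bracket_degree hu hv).2 l h
  bracket_zero _ hu _ hv := (A.bracket_degree hu hv).1 rfl
  skew _ _ _ hu _ hv := A.bracket_skew hu hv
  map_bracket _ _ := rfl
  hom_leibniz _ _ _ hu _ hv w := A.bracket_mul hu hv w
  hom_jacobi i j l u hu v hv w hw := by
    have h1 := A.bracket_bracket hu hv w
    -- The inner bracket has degree `m` with `m + 1 = i + j`, whence the exponent `(l + 1) * (i +
    -- j)`. The cyclic Jacobi identity is then the Leibniz form `h1` with signs sorted by parity.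
    have h2 : A.bracket w (A.bracket u v) =
        -((-1 : k) ^ ((l + 1) * (i + j)) • A.bracket (A.bracket u v) w) := by
      rcases h0 : i + j with _ | m
      · simp [(A.bracket_degree hu hv).1 h0]
      · exact A.bracket_skew hw ((A.bracket_degree hu hv).2 m h0.symm)
    simp only [AlgHom.id_apply]
    rw [A.bracket_skew hw hu, map_neg, map_smul, h2, h1]
    rcases Nat.even_or_odd i with hi | hi <;> rcases Nat.even_or_odd j with hj | hj <;>
      rcases Nat.even_or_odd l with hl | hl <;>
        simp [add_mul, pow_add, pow_mul, hi.neg_one_pow, hj.neg_one_pow, hl.neg_one_pow]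

/-- `d` is a divergence operator on `P`: the corresponding connection is flat. -/
structure IsDivergence (d : P →ₗ[k] R) : Prop where
  map_smul : ∀ (f : R) X, d (f • X) = f * d X - A.anchor X f
  flat : ∀ X Y, d (A.br X Y) = A.anchor X (d Y) - A.anchor Y (d X)

variable {A} {d : P →ₗ[k] R}

/-- The recursion is forced by the generating relation for a function or a vector in the first slot,
so `ε = -1`. Its consistency uses only the rule for `d (f • X)` and `[X, X] = 0`; flatness enters
later, in `div_lie`. -/
theorem IsDivergence.exists_div (hd : A.IsDivergence d) :
    ∃ D : ExteriorAlgebra R P →ₗ[k] ExteriorAlgebra R P,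
      (∀ f v, D (f • v) = f • D v - A.contr f v) ∧
      (∀ X v, D (ι R X * v) = d X • v - ι R X * D v - A.lie X v) ∧ D 1 = 0 := by
  obtain ⟨D, h1, h2, h3⟩ := ExteriorAlgebra.exists_firstOrder (P := P)
    (W := ExteriorAlgebra R P) (-1 : k) (-A.contr)
    (LinearMap.mk₂ k (fun X v => d X • v - A.lie X v)
      (fun X Y v => by simp [add_smul]; abel) (fun r X v => by simp [smul_sub])
      (fun X u v => by simp; abel) (fun r X v => by simp [smul_sub, smul_comm r]))
    (fun f g v => by simp [contr_mul]; abel)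
    (fun f X v => by
      simp [hd.map_smul, smul_lie, sub_smul, mul_smul, smul_sub]
      abel)
    (fun f X v => by
      simp [lie_smul, smul_sub, smul_comm f]
      abel)
    (fun X v => by
      simp [lie_ι_mul, A.br_self, mul_sub])
  refine ⟨D, fun f v => by rw [h1]; simp [sub_eq_add_neg], fun X v => ?_, h3⟩
  rw [h2]
  simp
  abel

/-- The operator on the exterior algebra which is determined by a divergence operator on `P`. -/
def IsDivergence.div (hd : A.IsDivergence d) : ExteriorAlgebra R P →ₗ[k] ExteriorAlgebra R P :=
  hd.exists_div.choose

theorem IsDivergence.div_smul (hd : A.IsDivergence d) (f : R) (v : ExteriorAlgebra R P) :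
    hd.div (f • v) = f • hd.div v - A.contr f v := hd.exists_div.choose_spec.1 f v

theorem IsDivergence.div_ι_mul (hd : A.IsDivergence d) (X : P) (v : ExteriorAlgebra R P) :
    hd.div (ι R X * v) = d X • v - ι R X * hd.div v - A.lie X v :=
  hd.exists_div.choose_spec.2.1 X v

theorem IsDivergence.div_algebraMap (hd : A.IsDivergence d) (f : R) :
    hd.div (algebraMap R _ f) = 0 := by
  have h : hd.div 1 = 0 := hd.exists_div.choose_spec.2.2
  rw [Algebra.algebraMap_eq_smul_one, div_smul, h, ← map_one (algebraMap R _), contr_algebraMap]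
  simp

theorem IsDivergence.div_ι (hd : A.IsDivergence d) (X : P) :
    hd.div (ι R X) = algebraMap R _ (d X) := by
  have h := hd.div_ι_mul X 1
  rw [← map_one (algebraMap R _), lie_algebraMap, div_algebraMap] at h
  simpa [Algebra.algebraMap_eq_smul_one] using h

theorem IsDivergence.div_degree (hd : A.IsDivergence d) {i : ℕ} {u : ExteriorAlgebra R P}
    (hu : u ∈ ⋀[R]^i P) : ∀ j, j + 1 = i → hd.div u ∈ ⋀[R]^j P := by
  induction hu using homogeneous_induction with
  | algebraMap f => intro j h; omega
  | add i u v _ _ hu hv => intro j h; rw [map_add]; exact add_mem (hu j h) (hv j h)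
  | ι_mul i X u hu h =>
    intro j hj
    obtain rfl : j = i := by omega
    rw [div_ι_mul]
    refine sub_mem (sub_mem (Submodule.smul_mem _ _ hu) ?_) (A.lie_mem X hu)
    rcases j with _ | j
    · have : hd.div u = 0 := by
        rw [exteriorPower, pow_zero] at hu
        obtain ⟨f, rfl⟩ := Submodule.mem_one.mp hu
        exact hd.div_algebraMap f
      rw [this, mul_zero]
      exact zero_mem _
    · exact mul_mem (add_comm _ _) (ι_mem X) (h j rfl)

/-- This is the generating relation solved for `div (u * v)`. The recursions of `div` and of the
bracket contain the same Lie derivative, which matches in the induction step. -/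
theorem IsDivergence.div_mul (hd : A.IsDivergence d) {i : ℕ} {u : ExteriorAlgebra R P}
    (hu : u ∈ ⋀[R]^i P) (v : ExteriorAlgebra R P) :
    hd.div (u * v) = hd.div u * v + (-1 : k) ^ i • (u * hd.div v + A.bracket u v) := by
  induction hu using homogeneous_induction with
  | algebraMap f =>
    rw [← Algebra.smul_def, div_smul, div_algebraMap, algebraMap_bracket, ← Algebra.smul_def]
    simp [sub_eq_add_neg]
  | add i u u' _ _ hu hu' => simp only [map_add, LinearMap.add_apply, hu, hu', add_mul, smul_add]; abel
  | ι_mul i X u hu h =>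
    rw [mul_assoc, div_ι_mul, div_ι_mul, h, ι_mul_bracket, lie_mul, sgn_of_mem k hu]
    simp only [sub_mul, mul_add, smul_add, mul_smul_comm, smul_mul_assoc, smul_smul, mul_assoc]
    rcases Nat.even_or_odd i with hi | hi <;>
        simp [pow_add, hi.neg_one_pow] <;> abel

/-- Here flatness is used: on a product with a vector `Y`, the only new terms are `d[X, Y]` and the
derivatives of `d X` and `d Y`. -/
theorem IsDivergence.div_lie (hd : A.IsDivergence d) (X : P) (v : ExteriorAlgebra R P) :
    hd.div (A.lie X v) = A.lie X (hd.div v) - A.contr (d X) v := by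
  induction v using ExteriorAlgebra.left_induction with
  | algebraMap f => simp [div_algebraMap]
  | add u u' hu hu' => simp only [map_add, hu, hu']; abel
  | ι_mul Y v h =>
    simp only [lie_ι_mul, map_add, div_ι_mul, h, map_sub, lie_smul, contr_ι_mul, lie_br, hd.flat,
      sub_smul, mul_sub]
    abel

/-- In the square on `Y ∧ v`, the contraction with the differential of `d Y` occurs twice, once from
`div_smul` and once from `div_lie`, with opposite signs. -/
theorem IsDivergence.div_div (hd : A.IsDivergence d) (v : ExteriorAlgebra R P) :
    hd.div (hd.div v) = 0 := by
  induction v using ExteriorAlgebra.left_induction with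
  | algebraMap f => simp [div_algebraMap]
  | add u u' hu hu' => simp only [map_add, hu, hu', add_zero]
  | ι_mul Y v h =>
    simp only [div_ι_mul, map_sub, h, div_smul, div_lie, mul_zero]
    abel

end LieRinehart

/-! ### Semilinear extensions to the exterior algebra -/

namespace ExteriorAlgebra

variable {k R P : Type*} [CommRing k] [CommRing R] [Algebra k R] [AddCommGroup P] [Module k P]
  [Module R P] [IsScalarTower k R P]

/-- Let `f` act on the exterior algebra as multiplication by `θ f` and `X` as multiplication by `α
X`. The resulting operator of `u` is left multiplication by its value at `1`, so evaluation at `1`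
is multiplicative. -/
theorem exists_semilinearMap (θ : R →ₐ[k] R) (α : P →ₗ[k] P)
    (h : ∀ (f : R) X, α (f • X) = θ f • α X) :
    ∃ τ : ExteriorAlgebra R P →ₐ[k] ExteriorAlgebra R P,
      (∀ f, τ (algebraMap R _ f) = algebraMap R _ (θ f)) ∧ ∀ X, τ (ι R X) = ι R (α X) := by
  obtain ⟨Θ, h1, h2⟩ := ExteriorAlgebra.exists_operator (P := P) (N := ExteriorAlgebra R P)
    ((Algebra.lmul k (ExteriorAlgebra R P)).comp
      (((Algebra.ofId R (ExteriorAlgebra R P)).restrictScalars k).comp θ))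
    ((Algebra.lmul k (ExteriorAlgebra R P)).toLinearMap ∘ₗ (ι R).restrictScalars k ∘ₗ α)
    (fun f X => by ext v; simp [h, Algebra.ofId_apply, Algebra.smul_def, mul_assoc])
    (fun f X => by
      ext v
      simp only [Module.End.mul_apply, LinearMap.coe_comp, Function.comp_apply, AlgHom.coe_comp,
        AlgHom.toLinearMap_apply, Algebra.coe_lmul_eq_mul,
        LinearMap.mul_apply', AlgHom.restrictScalars_apply, Algebra.ofId_apply,
        LinearMap.restrictScalars_apply, ← mul_assoc]
      rw [Algebra.commutes])
    (fun X => by ext v; simp [← mul_assoc])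
  have h3 : ∀ u v, Θ u v = Θ u 1 * v := fun u => by
    induction u using ExteriorAlgebra.left_induction with
    | algebraMap f => intro v; rw [h1]; simp
    | add u u' hu hu' => intro v; simp only [map_add, LinearMap.add_apply, add_mul, ← hu, ← hu']
    | ι_mul X u hu =>
      intro v
      rw [map_mul, h2, Module.End.mul_apply, Module.End.mul_apply, hu]
      simp [mul_assoc]
  refine ⟨AlgHom.ofLinearMap (LinearMap.applyₗ (1 : ExteriorAlgebra R P) ∘ₗ Θ.toLinearMap)
    (by simp) (fun u v => by simp [← h3]), fun f => by simp [h1, Algebra.ofId_apply],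
    fun X => by simp [h2]⟩

/-- The extension of a semilinear map to the exterior algebra. -/
def semilinearMap (θ : R →ₐ[k] R) (α : P →ₗ[k] P)
    (h : ∀ (f : R) X, α (f • X) = θ f • α X) :
    ExteriorAlgebra R P →ₐ[k] ExteriorAlgebra R P := (exists_semilinearMap θ α h).choose

variable {θ : R →ₐ[k] R} {α : P →ₗ[k] P} (hα : ∀ (f : R) X, α (f • X) = θ f • α X)

@[simp] theorem semilinearMap_algebraMap (f : R) :
    semilinearMap θ α hα (algebraMap R _ f) = algebraMap R _ (θ f) :=
  (exists_semilinearMap θ α hα).choose_spec.1 f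

@[simp] theorem semilinearMap_ι (X : P) : semilinearMap θ α hα (ι R X) = ι R (α X) :=
  (exists_semilinearMap θ α hα).choose_spec.2 X

theorem semilinearMap_smul (f : R) (u : ExteriorAlgebra R P) :
    semilinearMap θ α hα (f • u) = θ f • semilinearMap θ α hα u := by
  simp [Algebra.smul_def]

theorem semilinearMap_mem {i : ℕ} {u : ExteriorAlgebra R P} (hu : u ∈ ⋀[R]^i P) :
    semilinearMap θ α hα u ∈ ⋀[R]^i P := by
  induction hu using homogeneous_induction with
  | algebraMap f => rw [semilinearMap_algebraMap]; exact algebraMap_mem _ _ _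
  | add i u v _ _ hu hv => rw [map_add]; exact add_mem hu hv
  | ι_mul i X u _ hu =>
    rw [map_mul, semilinearMap_ι]
    exact mul_mem (add_comm _ _) (ι_mem _) hu

theorem semilinearMap_comp {θ' : R →ₐ[k] R} {α' : P →ₗ[k] P}
    (hα' : ∀ (f : R) X, α' (f • X) = θ' f • α' X) (h1 : ∀ f, θ' (θ f) = f)
    (h2 : ∀ X, α' (α X) = X) (u : ExteriorAlgebra R P) :
    semilinearMap θ' α' hα' (semilinearMap θ α hα u) = u := by
  induction u using ExteriorAlgebra.left_induction with
  | algebraMap f => simp [h1]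
  | add u v hu hv => simp only [map_add, hu, hv]
  | ι_mul X u hu => simp [hu, h2]

variable {A : LieRinehart k R P} (hbr : ∀ X Y, α (A.br X Y) = A.br (α X) (α Y))
  (han : ∀ X f, A.anchor (α X) (θ f) = θ (A.anchor X f))

include han in
theorem semilinearMap_contr (f : R) (u : ExteriorAlgebra R P) :
    semilinearMap θ α hα (A.contr f u) = A.contr (θ f) (semilinearMap θ α hα u) := by
  induction u using ExteriorAlgebra.left_induction with
  | algebraMap f => simp
  | add u v hu hv => simp only [map_add, hu, hv]
  | ι_mul X u hu => simp [hu, han, semilinearMap_smul]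

include hbr han in
theorem semilinearMap_lie (X : P) (u : ExteriorAlgebra R P) :
    semilinearMap θ α hα (A.lie X u) = A.lie (α X) (semilinearMap θ α hα u) := by
  induction u using ExteriorAlgebra.left_induction with
  | algebraMap f => simp [han]
  | add u v hu hv => simp only [map_add, hu, hv]
  | ι_mul Y u hu => simp [A.lie_ι_mul, hu, hbr]

-- The recursion for the bracket involves only contractions, Lie derivatives and the grading
-- involution, and the extended map is compatible with each of them.
include hbr han in
theorem semilinearMap_bracket (u v : ExteriorAlgebra R P) :
    semilinearMap θ α hα (A.bracket u v) =
      A.bracket (semilinearMap θ α hα u) (semilinearMap θ α hα v) := by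
  have hs : ∀ u, semilinearMap θ α hα (LieRinehart.sgn u) =
      LieRinehart.sgn (semilinearMap θ α hα u) := fun u => by
    induction u using ExteriorAlgebra.left_induction with
    | algebraMap f => simp
    | add u v hu hv => simp only [map_add, hu, hv]
    | ι_mul Y u hu => simp [hu]
  induction u using ExteriorAlgebra.left_induction with
  | algebraMap f => simp [A.algebraMap_bracket, semilinearMap_contr hα han]
  | add u v hu hv => simp only [map_add, LinearMap.add_apply, hu, hv]
  | ι_mul Y u hu =>
    simp [A.ι_mul_bracket, hu, hs, semilinearMap_lie hα hbr han]

include hbr han in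
theorem semilinearMap_div {d : P →ₗ[k] R} (hd : A.IsDivergence d)
    (hdα : ∀ X, d (α X) = θ (d X)) (u : ExteriorAlgebra R P) :
    semilinearMap θ α hα (hd.div u) = hd.div (semilinearMap θ α hα u) := by
  induction u using ExteriorAlgebra.left_induction with
  | algebraMap f => simp [hd.div_algebraMap]
  | add u v hu hv => simp only [map_add, hu, hv]
  | ι_mul Y u hu =>
    simp [hd.div_ι_mul, hu, semilinearMap_lie hα hbr han, hdα, semilinearMap_smul]

end ExteriorAlgebra

/-! ### Multisections and the exterior algebra of the module of sections -/

section Multisections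

open ExteriorAlgebra Topology

variable {E : Type*} [NormedAddCommGroup E] [NormedSpace ℝ E]
  {M : Type*} [TopologicalSpace M] [ChartedSpace E M]
  {F : Type*} [NormedAddCommGroup F] [NormedSpace ℝ F]
  {V : M → Type*} [TopologicalSpace (TotalSpace F V)] [∀ m, TopologicalSpace (V m)]
  [∀ m, AddCommGroup (V m)] [∀ m, Module ℝ (V m)] [FiberBundle F V] [VectorBundle ℝ F V]

instance : IsScalarTower ℝ (SmoothFun E M) (SmoothSec E F V) :=
  ⟨fun r f X => by ext m; exact smul_assoc r (f m) (X m)⟩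

/-- Smooth functions can be multiplied with a cutoff function. -/
def SmoothFun.cutoff (χ : SmoothFun E M) {U : Set M} (hU : IsOpen U) (hχ : tsupport χ ⊆ U)
    {g : M → ℝ} (hg : ContMDiffOn 𝓘(ℝ, E) 𝓘(ℝ, ℝ) ∞ g U) : SmoothFun E M :=
  ⟨fun m => χ m * g m, contMDiff_of_tsupport fun _ hm =>
    χ.contMDiff.contMDiffAt.mul
      (hg.contMDiffAt (hU.mem_nhds (hχ (tsupport_mul_subset_left hm))))⟩

theorem SmoothFun.exists_cutoff [FiniteDimensional ℝ E] [T2Space M] [IsManifold 𝓘(ℝ, E) ∞ M]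
    (m₀ : M) {U : Set M} (hU : U ∈ 𝓝 m₀) :
    ∃ χ : SmoothFun E M, (∀ᶠ m in 𝓝 m₀, χ m = 1) ∧ tsupport χ ⊆ U := by
  obtain ⟨f, -, hf⟩ := (SmoothBumpFunction.nhds_basis_tsupport (I := 𝓘(ℝ, E)) m₀).mem_iff.mp hU
  exact ⟨⟨f, f.contMDiff⟩, f.eventuallyEq_one, hf⟩

variable [FiniteDimensional ℝ F]

theorem Multisections.fsmul_apply (f : SmoothFun E M) (s : Multisections E F V) (m : M) :
    (f • s).1 m = f m • s.1 m := by
  rw [Algebra.smul_def, Algebra.smul_def]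
  rfl

/-- The exterior algebra of the module of sections, mapped to multisections. -/
def toMulti : ExteriorAlgebra (SmoothFun E M) (SmoothSec E F V) →ₐ[SmoothFun E M]
    Multisections E F V :=
  ExteriorAlgebra.lift _
    ⟨{ toFun := secMulti
       map_add' := map_add _
       map_smul' := fun f X => by
        ext m
        rw [RingHom.id_apply, Multisections.fsmul_apply]
        exact map_smul (ExteriorAlgebra.ι ℝ) (f m) (X m) },
      fun X => by ext m; exact ι_sq_zero (X m)⟩

@[simp] theorem toMulti_ι (X : SmoothSec E F V) :
    toMulti (ι (SmoothFun E M) X) = secMulti X := by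
  simp [toMulti]

@[simp] theorem toMulti_algebraMap (f : SmoothFun E M) :
    toMulti (V := V) (F := F) (algebraMap _ _ f) = funMulti f := AlgHom.commutes _ f

/-- The value of an element of the exterior algebra of the module of sections at a point. -/
def evalMulti (m : M) : ExteriorAlgebra (SmoothFun E M) (SmoothSec E F V) →ₐ[ℝ]
    ExteriorAlgebra ℝ (V m) :=
  ((Pi.evalAlgHom ℝ (fun m => ExteriorAlgebra ℝ (V m)) m).comp (Multisections E F V).val).comp
    (toMulti.restrictScalars ℝ)

theorem evalMulti_apply (m : M) (u : ExteriorAlgebra (SmoothFun E M) (SmoothSec E F V)) :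
    evalMulti m u = (toMulti u).1 m := rfl

@[simp] theorem evalMulti_ι (m : M) (X : SmoothSec E F V) :
    evalMulti m (ι (SmoothFun E M) X) = ι ℝ (X m) := by
  rw [evalMulti_apply, toMulti_ι]
  rfl

@[simp] theorem evalMulti_algebraMap (m : M) (f : SmoothFun E M) :
    evalMulti m (algebraMap _ (ExteriorAlgebra (SmoothFun E M) (SmoothSec E F V)) f) = algebraMap ℝ _ (f m) := by
  rw [evalMulti_apply, toMulti_algebraMap]
  rfl

theorem evalMulti_smul (m : M) (f : SmoothFun E M)
    (u : ExteriorAlgebra (SmoothFun E M) (SmoothSec E F V)) :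
    evalMulti m (f • u) = f m • evalMulti m u := by
  rw [evalMulti_apply, map_smul, Multisections.fsmul_apply, evalMulti_apply]

theorem evalMulti_mem (m : M) {k : ℕ} {u : ExteriorAlgebra (SmoothFun E M) (SmoothSec E F V)}
    (hu : u ∈ ⋀[SmoothFun E M]^k (SmoothSec E F V)) : evalMulti m u ∈ ⋀[ℝ]^k (V m) := by
  induction hu using homogeneous_induction with
  | algebraMap f => rw [evalMulti_algebraMap]; exact algebraMap_mem _ _ _
  | add i u v _ _ hu hv => rw [map_add]; exact add_mem hu hv
  | ι_mul i X u _ hu =>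
    rw [map_mul, evalMulti_ι]
    exact mul_mem (add_comm _ _) (ι_mem _) hu

/-- Maps of exterior algebras preserve degrees. -/
theorem ExteriorAlgebra.map_mem {R P Q : Type*} [CommRing R] [AddCommGroup P] [Module R P]
    [AddCommGroup Q] [Module R Q] (f : P →ₗ[R] Q) {k : ℕ} {u : ExteriorAlgebra R P}
    (hu : u ∈ ⋀[R]^k P) : ExteriorAlgebra.map f u ∈ ⋀[R]^k Q := by
  induction hu using homogeneous_induction with
  | algebraMap f => rw [AlgHom.commutes]; exact algebraMap_mem _ _ _
  | add i u v _ _ hu hv => rw [map_add]; exact add_mem hu hv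
  | ι_mul i X u _ hu =>
    rw [map_mul, map_apply_ι]
    exact mul_mem (add_comm _ _) (ι_mem _) hu

section Coordinates

variable {N : Type*} [TopologicalSpace N] [ChartedSpace E N]

theorem Module.Basis.apply_eq_sum {ι W : Type*} [Fintype ι] [AddCommGroup W] [Module ℝ W]
    (b : Module.Basis ι ℝ W) (l : Module.Dual ℝ W) (w : W) :
    l w = ∑ i, b.coord i w * l (b i) := by
  conv_lhs => rw [← b.sum_repr w, map_sum]
  simp only [map_smul, smul_eq_mul, Module.Basis.coord_apply]

theorem contMDiffAt_coord_mul {g h : N → ExteriorAlgebra ℝ F} {m : N}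
    (hg : ∀ l : Module.Dual ℝ (ExteriorAlgebra ℝ F),
      ContMDiffAt 𝓘(ℝ, E) 𝓘(ℝ, ℝ) ∞ (fun x => l (g x)) m)
    (hh : ∀ l : Module.Dual ℝ (ExteriorAlgebra ℝ F),
      ContMDiffAt 𝓘(ℝ, E) 𝓘(ℝ, ℝ) ∞ (fun x => l (h x)) m)
    (l : Module.Dual ℝ (ExteriorAlgebra ℝ F)) :
    ContMDiffAt 𝓘(ℝ, E) 𝓘(ℝ, ℝ) ∞ (fun x => l (g x * h x)) m := by
  have := exteriorAlgebra_finite (F := F)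
  let b := Module.finBasis ℝ (ExteriorAlgebra ℝ F)
  have key : (fun x => l (g x * h x)) =
      fun x => ∑ i, ∑ j, (b.coord i (g x) * b.coord j (h x)) * l (b i * b j) := by
    funext x
    refine (b.apply_eq_sum (l ∘ₗ LinearMap.mulRight ℝ (h x)) (g x)).trans ?_
    refine Finset.sum_congr rfl fun i _ => ?_
    simp only [LinearMap.comp_apply, LinearMap.mulRight_apply]
    rw [show l (b i * h x) = _ from b.apply_eq_sum (l ∘ₗ LinearMap.mulLeft ℝ (b i)) (h x),
      Finset.mul_sum]
    simp [mul_assoc]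
  rw [key]
  exact contMDiffAt_finsetSum fun i _ => contMDiffAt_finsetSum fun j _ =>
    ((hg _).mul (hh _)).mul contMDiffAt_const

/-- The induced map on the exterior algebra is multiplicative and depends on `C` linearly on
vectors, so its coordinates are polynomial in `C`. -/
theorem contMDiffAt_coord_map {C : N → F →L[ℝ] F} {m : N}
    (hC : ContMDiffAt 𝓘(ℝ, E) 𝓘(ℝ, F →L[ℝ] F) ∞ C m) (u : ExteriorAlgebra ℝ F) :
    ∀ l : Module.Dual ℝ (ExteriorAlgebra ℝ F),
      ContMDiffAt 𝓘(ℝ, E) 𝓘(ℝ, ℝ) ∞ (fun x => l (ExteriorAlgebra.map (C x : F →ₗ[ℝ] F) u)) m := by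
  induction u using ExteriorAlgebra.left_induction with
  | algebraMap r => intro l; simpa using contMDiffAt_const
  | add u v hu hv => intro l; simp only [map_add]; exact (hu l).add (hv l)
  | ι_mul v u hu =>
    intro l
    simp only [map_mul, map_apply_ι]
    refine contMDiffAt_coord_mul (fun l => ?_) hu l
    let L : (F →L[ℝ] F) →L[ℝ] ℝ :=
      (LinearMap.toContinuousLinearMap (l ∘ₗ ι ℝ)).comp (ContinuousLinearMap.apply ℝ F v)
    exact L.contMDiff.contMDiffAt.comp m hC

end Coordinates

/-- `IsSmoothMulti` only controls the coordinates at the centre of each trivialization. At another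
point `m₁` of the base set, the coordinates centred at `m₁` are transported by the exterior powers
of the transition map. -/
theorem IsSmoothMulti.contMDiffOn_coord [ContMDiffVectorBundle ∞ F V 𝓘(ℝ, E)]
    {s : ∀ m, ExteriorAlgebra ℝ (V m)} (hs : IsSmoothMulti E F s) (m₀ : M)
    (l : Module.Dual ℝ (ExteriorAlgebra ℝ F)) :
    ContMDiffOn 𝓘(ℝ, E) 𝓘(ℝ, ℝ) ∞ (fun m => l (multiCoord (F := F) s m₀ m))
      (trivializationAt F V m₀).baseSet := by
  intro m₁ hm₁
  apply ContMDiffAt.contMDiffWithinAt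
  set e := trivializationAt F V m₀
  set e' := trivializationAt F V m₁
  have hm₁' : m₁ ∈ e'.baseSet := FiberBundle.mem_baseSet_trivializationAt' m₁
  have hC : ContMDiffAt 𝓘(ℝ, E) 𝓘(ℝ, F →L[ℝ] F) ∞
      (fun m => (e'.coordChangeL ℝ e m : F →L[ℝ] F)) m₁ :=
    (contMDiffOn_coordChangeL (n := ∞) (IB := 𝓘(ℝ, E)) e' e).contMDiffAt
      ((e'.open_baseSet.inter e.open_baseSet).mem_nhds ⟨hm₁', hm₁⟩)
  have := exteriorAlgebra_finite (F := F)
  let b := Module.finBasis ℝ (ExteriorAlgebra ℝ F)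
  have key : (fun m => l (multiCoord (F := F) s m₀ m)) =ᶠ[𝓝 m₁] fun m =>
      ∑ i, b.coord i (multiCoord (F := F) s m₁ m) *
        l (ExteriorAlgebra.map ((e'.coordChangeL ℝ e m : F →L[ℝ] F) : F →ₗ[ℝ] F) (b i)) := by
    filter_upwards [(e'.open_baseSet.inter e.open_baseSet).mem_nhds ⟨hm₁', hm₁⟩] with m hm
    have h : multiCoord (F := F) s m₀ m =
        ExteriorAlgebra.map ((e'.coordChangeL ℝ e m : F →L[ℝ] F) : F →ₗ[ℝ] F)
          (multiCoord (F := F) s m₁ m) := by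
      rw [multiCoord, multiCoord, ← AlgHom.comp_apply, map_comp_map]
      congr 2
      ext v
      simp only [LinearMap.comp_apply, ContinuousLinearMap.coe_coe,
        ContinuousLinearEquiv.coe_coe]
      rw [e'.coordChangeL_apply e hm, e'.symm_linearMapAt hm.1, e.linearMapAt_def_of_mem hm.2]
      rfl
    rw [h]
    exact b.apply_eq_sum (l ∘ₗ (ExteriorAlgebra.map
      ((e'.coordChangeL ℝ e m : F →L[ℝ] F) : F →ₗ[ℝ] F)).toLinearMap) _
  refine ContMDiffAt.congr_of_eventuallyEq ?_ key
  exact contMDiffAt_finsetSum fun i _ => (hs m₁ _).mul (contMDiffAt_coord_map hC _ l)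

end Multisections

/-! ### Multisections are locally elements of the exterior algebra of sections -/

section LocalLifts

open ExteriorAlgebra Topology

variable {E : Type*} [NormedAddCommGroup E] [NormedSpace ℝ E]
  {M : Type*} [TopologicalSpace M] [ChartedSpace E M]
  {F : Type*} [NormedAddCommGroup F] [NormedSpace ℝ F]
  {V : M → Type*} [TopologicalSpace (TotalSpace F V)] [∀ m, TopologicalSpace (V m)]
  [∀ m, AddCommGroup (V m)] [∀ m, Module ℝ (V m)] [FiberBundle F V] [VectorBundle ℝ F V]

theorem eventually_mem_baseSet (m₀ : M) :
    ∀ᶠ m in 𝓝 m₀, m ∈ (trivializationAt F V m₀).baseSet :=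
  (trivializationAt F V m₀).open_baseSet.mem_nhds (FiberBundle.mem_baseSet_trivializationAt' m₀)

variable [ContMDiffVectorBundle ∞ F V 𝓘(ℝ, E)]

/-- The sections which are constant in the preferred trivialization at `m₀`, multiplied with a
cutoff function. -/
def constSec (m₀ : M) (χ : SmoothFun E M)
    (hχ : tsupport χ ⊆ (trivializationAt F V m₀).baseSet) : F →ₗ[ℝ] SmoothSec E F V where
  toFun v := ⟨fun m => χ m • (trivializationAt F V m₀).symmₗ ℝ m v, by
    refine ContMDiffOn.smul_section_of_tsupport (n := ∞) (u := (trivializationAt F V m₀).baseSet)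
      χ.contMDiff.contMDiffOn (trivializationAt F V m₀).open_baseSet hχ ?_
    rw [(trivializationAt F V m₀).contMDiffOn_section_baseSet_iff]
    refine (contMDiffOn_const (c := v)).congr fun m hm => ?_
    simp [hm]⟩
  map_add' v w := by
    ext m
    change χ m • (trivializationAt F V m₀).symmₗ ℝ m (v + w) =
      χ m • (trivializationAt F V m₀).symmₗ ℝ m v + χ m • (trivializationAt F V m₀).symmₗ ℝ m w
    rw [map_add, smul_add]
  map_smul' r v := by
    ext m
    change χ m • (trivializationAt F V m₀).symmₗ ℝ m (r • v) =
      r • χ m • (trivializationAt F V m₀).symmₗ ℝ m v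
    rw [map_smul, smul_comm]

/-- The multisections which are constant in the preferred trivialization at `m₀`, up to cutoff. -/
def constMulti (m₀ : M) (χ : SmoothFun E M)
    (hχ : tsupport χ ⊆ (trivializationAt F V m₀).baseSet) :
    ExteriorAlgebra ℝ F →ₐ[ℝ] ExteriorAlgebra (SmoothFun E M) (SmoothSec E F V) :=
  ExteriorAlgebra.lift ℝ ⟨(ι (SmoothFun E M)).restrictScalars ℝ ∘ₗ constSec m₀ χ hχ,
    fun _ => ι_sq_zero _⟩

variable {m₀ : M} {χ : SmoothFun E M} (hχ : tsupport χ ⊆ (trivializationAt F V m₀).baseSet)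

@[simp] theorem constMulti_ι (v : F) :
    constMulti m₀ χ hχ (ι ℝ v) = ι (SmoothFun E M) (constSec m₀ χ hχ v) :=
  ExteriorAlgebra.lift_ι_apply ℝ _ _ v

theorem constMulti_mem {k : ℕ} {u : ExteriorAlgebra ℝ F} (hu : u ∈ ⋀[ℝ]^k F) :
    constMulti m₀ χ hχ u ∈ ⋀[SmoothFun E M]^k (SmoothSec E F V) := by
  induction hu using homogeneous_induction with
  | algebraMap r =>
    rw [AlgHom.commutes, IsScalarTower.algebraMap_apply ℝ (SmoothFun E M)]
    exact algebraMap_mem _ _ _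
  | add i u v _ _ hu hv => rw [map_add]; exact add_mem hu hv
  | ι_mul i X u _ hu =>
    rw [map_mul, constMulti_ι]
    exact mul_mem (add_comm _ _) (ι_mem _) hu

variable [FiniteDimensional ℝ F]

theorem evalMulti_constMulti {m : M} (hm : χ m = 1) (u : ExteriorAlgebra ℝ F) :
    evalMulti m (constMulti m₀ χ hχ u) =
      ExteriorAlgebra.map ((trivializationAt F V m₀).symmₗ ℝ m) u := by
  induction u using ExteriorAlgebra.left_induction with
  | algebraMap r => simp only [AlgHom.commutes]
  | add u v hu hv => simp only [map_add, hu, hv]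
  | ι_mul X u hu =>
    simp only [map_mul, hu, constMulti_ι, evalMulti_ι, map_apply_ι]
    congr 2
    change χ m • (trivializationAt F V m₀).symmₗ ℝ m X = _
    rw [hm, one_smul]

theorem map_symm_multiCoord {m : M} (hm : m ∈ (trivializationAt F V m₀).baseSet)
    (s : ∀ m, ExteriorAlgebra ℝ (V m)) :
    ExteriorAlgebra.map ((trivializationAt F V m₀).symmₗ ℝ m) (multiCoord (F := F) s m₀ m) =
      s m := by
  rw [multiCoord, ← AlgHom.comp_apply, map_comp_map,
    show (trivializationAt F V m₀).symmₗ ℝ m ∘ₗ (trivializationAt F V m₀).linearMapAt ℝ m =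
      LinearMap.id from LinearMap.ext fun y => (trivializationAt F V m₀).symmₗ_linearMapAt hm y,
    map_id, AlgHom.id_apply]

theorem map_symm_injective {m : M} (hm : m ∈ (trivializationAt F V m₀).baseSet) :
    Function.Injective (ExteriorAlgebra.map ((trivializationAt F V m₀).symmₗ ℝ m)) :=
  ExteriorAlgebra.map_injective ⟨(trivializationAt F V m₀).linearMapAt ℝ m,
    LinearMap.ext fun y => (trivializationAt F V m₀).linearMapAt_symmₗ hm y⟩

variable [FiniteDimensional ℝ E] [T2Space M] [IsManifold 𝓘(ℝ, E) ∞ M]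

variable (E F V) in
theorem exists_bundle_cutoff (m₀ : M) : ∃ χ : SmoothFun E M, (∀ᶠ m in 𝓝 m₀, χ m = 1) ∧
    tsupport χ ⊆ (trivializationAt F V m₀).baseSet :=
  SmoothFun.exists_cutoff m₀ ((trivializationAt F V m₀).open_baseSet.mem_nhds
    (FiberBundle.mem_baseSet_trivializationAt' m₀))

/-- Multisections are locally given by elements of the exterior algebra of sections. -/
theorem exists_lift_of_multiCoord_mem (hχ1 : ∀ᶠ m in 𝓝 m₀, χ m = 1)
    (W : Submodule ℝ (ExteriorAlgebra ℝ F))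
    (s : Multisections E F V) (hs : ∀ m, multiCoord (F := F) s.1 m₀ m ∈ W) :
    ∃ η ∈ Submodule.span (SmoothFun E M) (constMulti m₀ χ hχ '' W),
      ∀ᶠ m in 𝓝 m₀, evalMulti m η = s.1 m := by
  have := exteriorAlgebra_finite (F := F)
  let b := Module.finBasis ℝ W
  -- Smoothness is known for functionals on all of `Λ F`, so the coordinates on `W` are first
  -- extended. Cut off by `χ`, they are the coefficients of the lift. Keeping `W` arbitrary yields
  -- homogeneous lifts and the local generator in top degree at once.
  choose l hl using fun i => (b.coord i).exists_extend
  refine ⟨∑ i, χ.cutoff (trivializationAt F V m₀).open_baseSet hχ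
    (IsSmoothMulti.contMDiffOn_coord s.2 m₀ (l i)) • constMulti m₀ χ hχ (b i),
    Submodule.sum_mem _ fun i _ => Submodule.smul_mem _ _
      (Submodule.subset_span ⟨_, (b i).2, rfl⟩), ?_⟩
  filter_upwards [hχ1, eventually_mem_baseSet (F := F) (V := V) m₀] with m hm hm'
  rw [map_sum, ← map_symm_multiCoord hm' s.1]
  have h1 : ∑ i, l i (multiCoord (F := F) s.1 m₀ m) • (b i : ExteriorAlgebra ℝ F) =
      multiCoord (F := F) s.1 m₀ m := by
    have h2 : ∀ x : W, ∑ i, l i x • (b i : ExteriorAlgebra ℝ F) = x := fun x => by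
      conv_rhs => rw [← b.sum_repr x, Submodule.coe_sum]
      refine Finset.sum_congr rfl fun i _ => ?_
      rw [Submodule.coe_smul, ← Module.Basis.coord_apply, ← hl i]
      rfl
    exact h2 ⟨_, hs m⟩
  conv_rhs => rw [← h1, map_sum]
  refine Finset.sum_congr rfl fun i _ => ?_
  rw [evalMulti_smul, evalMulti_constMulti hχ hm, map_smul]
  congr 1
  change χ m * _ = _
  rw [hm, one_mul]

theorem exists_lift (s : Multisections E F V) (m₀ : M) :
    ∃ η : ExteriorAlgebra (SmoothFun E M) (SmoothSec E F V),
      ∀ᶠ m in 𝓝 m₀, evalMulti m η = s.1 m := by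
  obtain ⟨χ, hχ1, hχ⟩ := exists_bundle_cutoff E F V m₀
  obtain ⟨η, -, h⟩ := exists_lift_of_multiCoord_mem hχ hχ1 ⊤ s (fun _ => trivial)
  exact ⟨η, h⟩

theorem exists_homogeneous_lift {k : ℕ} (s : Multisections E F V) (hs : s ∈ MultiDeg E F V k)
    (m₀ : M) : ∃ η ∈ ⋀[SmoothFun E M]^k (SmoothSec E F V),
      ∀ᶠ m in 𝓝 m₀, evalMulti m η = s.1 m := by
  obtain ⟨χ, hχ1, hχ⟩ := exists_bundle_cutoff E F V m₀
  obtain ⟨η, hη, h⟩ := exists_lift_of_multiCoord_mem hχ hχ1 (⋀[ℝ]^k F) s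
    (fun m => ExteriorAlgebra.map_mem _ (hs m))
  refine ⟨η, ?_, h⟩
  refine Submodule.span_le.mpr ?_ hη
  rintro _ ⟨u, hu, rfl⟩
  exact constMulti_mem hχ hu

variable (E F V) in
/-- If `V` has rank `n`, then `Γ(∧^n V)` is locally generated by one nowhere vanishing element. -/
theorem exists_generator_top (n : ℕ) (hn : Module.finrank ℝ F = n) (m₀ : M) :
    ∃ s ∈ MultiDeg E F V n, (∀ᶠ m in 𝓝 m₀, s.1 m ≠ 0) ∧
      ∀ t ∈ MultiDeg E F V n, ∃ h : SmoothFun E M, ∀ᶠ m in 𝓝 m₀, t.1 m = h m • s.1 m := by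
  obtain ⟨χ, hχ1, hχ⟩ := exists_bundle_cutoff E F V m₀
  have h1 : Module.finrank ℝ (⋀[ℝ]^n F) = 1 := by
    rw [exteriorPower.finrank_eq, hn, Nat.choose_self]
  obtain ⟨w, hw0, hw⟩ := finrank_eq_one_iff'.mp h1
  refine ⟨toMulti (constMulti m₀ χ hχ w), fun m => evalMulti_mem m (constMulti_mem hχ w.2), ?_,
    fun t ht => ?_⟩
  · filter_upwards [hχ1, eventually_mem_baseSet (F := F) (V := V) m₀] with m hm hm'
    rw [← evalMulti_apply, evalMulti_constMulti hχ hm]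
    intro h
    rw [← map_zero (ExteriorAlgebra.map ((trivializationAt F V m₀).symmₗ ℝ m))] at h
    exact hw0 (Subtype.ext (map_symm_injective hm' h))
  · obtain ⟨η, hη, h⟩ := exists_lift_of_multiCoord_mem hχ hχ1 (Submodule.span ℝ {w.1}) t
      (fun m => by
        obtain ⟨c, hc⟩ := hw ⟨_, ExteriorAlgebra.map_mem _ (ht m)⟩
        exact Submodule.mem_span_singleton.mpr ⟨c, congrArg Subtype.val hc⟩)
    have h2 : η ∈ Submodule.span (SmoothFun E M) {constMulti m₀ χ hχ w} := by
      refine Submodule.span_le.mpr ?_ hη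
      rintro _ ⟨u, hu, rfl⟩
      obtain ⟨c, rfl⟩ := Submodule.mem_span_singleton.mp hu
      rw [map_smul, ← algebraMap_smul (SmoothFun E M)]
      exact Submodule.smul_mem _ _ (Submodule.mem_span_singleton_self _)
    obtain ⟨g, rfl⟩ := Submodule.mem_span_singleton.mp h2
    refine ⟨g, ?_⟩
    filter_upwards [h] with m hm
    rw [← hm, evalMulti_smul, evalMulti_apply]

theorem SmoothSec.sum_apply {ι : Type*} (t : Finset ι) (Y : ι → SmoothSec E F V) (m : M) :
    (∑ i ∈ t, Y i) m = ∑ i ∈ t, Y i m := by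
  classical
  induction t using Finset.induction_on with
  | empty => rfl
  | insert a t ha ih => rw [Finset.sum_insert ha, Finset.sum_insert ha, ← ih]; rfl

/-- Up to cutoff, the exterior algebra of sections is generated by constant multisections. -/
theorem exists_smul_mem_span (hχ1 : ∀ᶠ m in 𝓝 m₀, χ m = 1)
    (η : ExteriorAlgebra (SmoothFun E M) (SmoothSec E F V)) :
    ∃ f : SmoothFun E M, (∀ᶠ m in 𝓝 m₀, f m = 1) ∧
      f • η ∈ Submodule.span (SmoothFun E M) (Set.range (constMulti m₀ χ hχ)) := by
  induction η using ExteriorAlgebra.left_induction with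
  | algebraMap g =>
    refine ⟨1, Filter.Eventually.of_forall fun _ => rfl, ?_⟩
    rw [one_smul, Algebra.algebraMap_eq_smul_one, ← map_one (constMulti m₀ χ hχ)]
    exact Submodule.smul_mem _ _ (Submodule.subset_span ⟨_, rfl⟩)
  | add u v hu hv =>
    obtain ⟨f, hf, hu⟩ := hu
    obtain ⟨g, hg, hv⟩ := hv
    refine ⟨f * g, ?_, ?_⟩
    · filter_upwards [hf, hg] with m hf hg
      change f m * g m = 1
      rw [hf, hg, one_mul]
    · rw [smul_add, mul_comm f g, mul_smul, mul_comm g f, mul_smul]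
      exact add_mem (Submodule.smul_mem _ _ hu) (Submodule.smul_mem _ _ hv)
  | ι_mul X u hu =>
    obtain ⟨f, hf, hu⟩ := hu
    -- One factor `χ` globalises the coordinates of `X`, the other is built into `constSec`.
    refine ⟨χ * χ * f, ?_, ?_⟩
    · filter_upwards [hf, hχ1] with m hf hg
      change χ m * χ m * f m = 1
      rw [hf, hg, one_mul, one_mul]
    · let b := Module.finBasis ℝ F
      have hX : ∀ i, ContMDiffOn 𝓘(ℝ, E) 𝓘(ℝ, ℝ) ∞
          (fun m => b.coord i (((trivializationAt F V m₀) ⟨m, X m⟩).2))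
          (trivializationAt F V m₀).baseSet := fun i =>
        (LinearMap.toContinuousLinearMap (b.coord i)).contMDiff.comp_contMDiffOn
          ((trivializationAt F V m₀).contMDiffOn_section_baseSet_iff.mp X.contMDiff.contMDiffOn)
      have key : (χ * χ) • X = ∑ i, χ.cutoff (trivializationAt F V m₀).open_baseSet hχ (hX i) •
          constSec m₀ χ hχ (b i) := by
        ext m
        rw [SmoothSec.sum_apply]
        change (χ m * χ m) • X m = ∑ i, (χ m * b.coord i _) •
          (χ m • (trivializationAt F V m₀).symmₗ ℝ m (b i))
        by_cases hm : m ∈ (trivializationAt F V m₀).baseSet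
        · simp only [mul_smul, smul_comm (b.coord _ _) (χ m)]
          rw [← Finset.smul_sum, ← Finset.smul_sum]
          simp only [← map_smul]
          rw [← map_sum]
          simp only [Module.Basis.coord_apply, b.sum_repr]
          congr 2
          rw [(trivializationAt F V m₀).symmₗ_apply hm]
          simp [hm]
        · have h0 : χ m = 0 := image_eq_zero_of_notMem_tsupport fun h => hm (hχ h)
          simp [h0]
      have hmul : ∀ v, ∀ y ∈ Submodule.span (SmoothFun E M) (Set.range (constMulti m₀ χ hχ)),
          constMulti m₀ χ hχ v * y ∈
            Submodule.span (SmoothFun E M) (Set.range (constMulti m₀ χ hχ)) := fun v y hy => by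
        induction hy using Submodule.span_induction with
        | mem y hy =>
          obtain ⟨w, rfl⟩ := hy
          rw [← map_mul]
          exact Submodule.subset_span ⟨_, rfl⟩
        | zero => rw [mul_zero]; exact zero_mem _
        | add y z _ _ hy hz => rw [mul_add]; exact add_mem hy hz
        | smul g y _ hy => rw [mul_smul_comm]; exact Submodule.smul_mem _ _ hy
      rw [← smul_mul_smul_comm, ← map_smul, key, map_sum, Finset.sum_mul]
      refine Submodule.sum_mem _ fun i _ => ?_
      rw [map_smul, smul_mul_assoc, ← constMulti_ι]
      exact Submodule.smul_mem _ _ (hmul _ _ hu)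

/-- Elements of the exterior algebra of sections which vanish near a point are killed by a cutoff
function. -/
theorem exists_smul_eq_zero (η : ExteriorAlgebra (SmoothFun E M) (SmoothSec E F V))
    (hη : ∀ᶠ m in 𝓝 m₀, evalMulti m η = 0) :
    ∃ f : SmoothFun E M, (∀ᶠ m in 𝓝 m₀, f m = 1) ∧ f • η = 0 := by
  obtain ⟨χ, hχ1, hχ⟩ := exists_bundle_cutoff E F V m₀
  obtain ⟨f, hf, h⟩ := exists_smul_mem_span hχ hχ1 η
  have := exteriorAlgebra_finite (F := F)
  let b := Module.finBasis ℝ (ExteriorAlgebra ℝ F)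
  have h1 : f • η ∈ Submodule.span (SmoothFun E M)
      (Set.range fun i => constMulti m₀ χ hχ (b i)) := by
    refine Submodule.span_le.mpr ?_ h
    rintro _ ⟨u, rfl⟩
    rw [← b.sum_repr u, map_sum]
    refine Submodule.sum_mem _ fun i _ => ?_
    rw [map_smul, ← algebraMap_smul (SmoothFun E M)]
    exact Submodule.smul_mem _ _ (Submodule.subset_span ⟨i, rfl⟩)
  obtain ⟨g, hg⟩ := (Submodule.mem_span_range_iff_exists_fun _).mp h1
  -- Near `m₀` the elements `constMulti m₀ χ hχ (b i)` evaluate to linearly independent vectors, so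
  -- the coefficients vanish there. A cutoff supported where all of them vanish then kills `f • η`
  -- itself, without injectivity of `toMulti`.
  have h2 : ∀ᶠ m in 𝓝 m₀, ∀ i, g i m = 0 := by
    filter_upwards [hη, hχ1, eventually_mem_baseSet (F := F) (V := V) m₀] with m h0 hm hm' i
    have h3 := congrArg (evalMulti m) hg
    simp only [map_sum, evalMulti_smul, h0, smul_zero, evalMulti_constMulti hχ hm, ← map_smul] at h3
    rw [← map_sum, ← map_zero (ExteriorAlgebra.map ((trivializationAt F V m₀).symmₗ ℝ m))] at h3
    have h4 := map_symm_injective hm' h3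
    exact Fintype.linearIndependent_iff.mp b.linearIndependent _ h4 i
  obtain ⟨c, hc1, hc⟩ := SmoothFun.exists_cutoff (E := E) m₀ h2
  refine ⟨c * f, ?_, ?_⟩
  · filter_upwards [hf, hc1] with m hf hg
    change c m * f m = 1
    rw [hf, hg, one_mul]
  · rw [mul_smul, ← hg, Finset.smul_sum]
    refine Finset.sum_eq_zero fun i _ => ?_
    rw [smul_smul]
    have : c * g i = 0 := by
      ext m
      change c m * g i m = 0
      by_cases hm : m ∈ tsupport c
      · rw [hc hm i, mul_zero]
      · rw [image_eq_zero_of_notMem_tsupport hm, zero_mul]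
    rw [this, zero_smul]

theorem multiDeg_eq_bot (k : ℕ) (hk : Module.finrank ℝ F < k) : MultiDeg E F V k = ⊥ := by
  refine (Submodule.eq_bot_iff _).mpr fun s hs => ?_
  ext m
  have e := (trivializationAt F V m).linearEquivAt ℝ m
    (FiberBundle.mem_baseSet_trivializationAt' m)
  have : FiniteDimensional ℝ (V m) := e.symm.finiteDimensional
  have h : (⋀[ℝ]^k (V m)) = ⊥ := by
    apply Submodule.finrank_eq_zero.mp
    rw [exteriorPower.finrank_eq, e.finrank_eq, Nat.choose_eq_zero_of_lt hk]
  have h1 := hs m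
  rw [h] at h1
  exact (Submodule.mem_bot ℝ).mp h1

end LocalLifts

/-! ### Extension of local operators to multisections -/

section LocalOperators

open ExteriorAlgebra Topology

variable {E : Type*} [NormedAddCommGroup E] [NormedSpace ℝ E]
  {M : Type*} [TopologicalSpace M] [ChartedSpace E M]
  {F : Type*} [NormedAddCommGroup F] [NormedSpace ℝ F]
  {V : M → Type*} [TopologicalSpace (TotalSpace F V)] [∀ m, TopologicalSpace (V m)]
  [∀ m, AddCommGroup (V m)] [∀ m, Module ℝ (V m)] [FiberBundle F V] [VectorBundle ℝ F V]

variable (E F V) in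
/-- The exterior algebra of the module of sections. -/
abbrev SecAlg : Type _ := ExteriorAlgebra (SmoothFun E M) (SmoothSec E F V)

variable [FiniteDimensional ℝ F]

/-- `η` represents the multisection `s` near `m`. -/
def Lifts (m : M) (η : SecAlg E F V) (s : Multisections E F V) : Prop :=
  ∀ᶠ m' in 𝓝 m, evalMulti m' η = s.1 m'

theorem Multisections.ext_of_lifts {s t : Multisections E F V}
    (h : ∀ m, s.1 m = t.1 m) : s = t := Subtype.ext (funext h)

theorem lifts_toMulti (m : M) (η : SecAlg E F V) : Lifts m η (toMulti η) :=
  Filter.Eventually.of_forall fun _ => rfl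

namespace Lifts

variable {m : M} {η ζ : SecAlg E F V} {s t : Multisections E F V}

theorem eval_eq (h : Lifts m η s) : evalMulti m η = s.1 m := h.self_of_nhds

theorem eventually (h : Lifts m η s) : ∀ᶠ m' in 𝓝 m, Lifts m' η s := h.eventually_nhds

theorem add (h : Lifts m η s) (h' : Lifts m ζ t) : Lifts m (η + ζ) (s + t) := by
  filter_upwards [h, h'] with m' h h'
  rw [map_add, h, h']
  rfl

theorem mul (h : Lifts m η s) (h' : Lifts m ζ t) : Lifts m (η * ζ) (s * t) := by
  filter_upwards [h, h'] with m' h h'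
  rw [map_mul, h, h']
  rfl

theorem smul (r : ℝ) (h : Lifts m η s) : Lifts m (r • η) (r • s) := by
  filter_upwards [h] with m' h
  rw [map_smul, h]
  rfl

theorem fsmul (f : SmoothFun E M) (h : Lifts m η s) : Lifts m (f • η) (f • s) := by
  filter_upwards [h] with m' h
  rw [evalMulti_smul, h, Multisections.fsmul_apply]

theorem sub_eq_zero (h : Lifts m η s) (h' : Lifts m ζ s) :
    ∀ᶠ m' in 𝓝 m, evalMulti m' (η - ζ) = 0 := by
  filter_upwards [h, h'] with m' h h'
  rw [map_sub, h, h', sub_self]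

end Lifts

theorem isSmoothMulti_of_eventuallyEq {s : ∀ m, ExteriorAlgebra ℝ (V m)}
    (h : ∀ m₀, ∃ t : Multisections E F V, ∀ᶠ m in 𝓝 m₀, s m = t.1 m) : IsSmoothMulti E F s := by
  intro m₀ l
  obtain ⟨t, ht⟩ := h m₀
  refine (t.2 m₀ l).congr_of_eventuallyEq ?_
  filter_upwards [ht] with m hm
  rw [multiCoord, multiCoord, hm]

variable [ContMDiffVectorBundle ∞ F V 𝓘(ℝ, E)]
variable [FiniteDimensional ℝ E] [T2Space M] [IsManifold 𝓘(ℝ, E) ∞ M]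

/-- Local operators on the exterior algebra of sections extend to multisections. -/
theorem exists_extension {φ : M → M} (hφ : Continuous φ) (T : SecAlg E F V →ₗ[ℝ] SecAlg E F V)
    (hT : ∀ m η, (∀ᶠ m' in 𝓝 (φ m), evalMulti m' η = 0) → evalMulti m (T η) = 0) :
    ∃ T' : Multisections E F V →ₗ[ℝ] Multisections E F V,
      ∀ m η s, Lifts (φ m) η s → (T' s).1 m = evalMulti m (T η) := by
  choose l hl using fun (s : Multisections E F V) (m : M) => exists_lift s m
  -- The value at `m` does not depend on the lift near `φ m`. Hence a single lift serves all points
  -- near `m₀`, which gives smoothness, and sums of lifts may be used for linearity.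
  have key : ∀ m η s, Lifts (φ m) η s → evalMulti m (T (l s (φ m))) = evalMulti m (T η) := by
    intro m η s h
    rw [← sub_eq_zero, ← map_sub, ← map_sub]
    exact hT m _ (Lifts.sub_eq_zero (hl s (φ m)) h)
  refine ⟨
    { toFun := fun s => ⟨fun m => evalMulti m (T (l s (φ m))),
        isSmoothMulti_of_eventuallyEq fun m₀ => ⟨toMulti (T (l s (φ m₀))), ?_⟩⟩
      map_add' := fun s t => Multisections.ext_of_lifts fun m => ?_
      map_smul' := fun r s => Multisections.ext_of_lifts fun m => ?_ }, key⟩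
  · filter_upwards [hφ.continuousAt.eventually (Lifts.eventually (hl s (φ m₀)))] with m hm
    rw [key m _ s hm, evalMulti_apply]
  · refine (key m _ _ (Lifts.add (hl s (φ m)) (hl t (φ m)))).trans ?_
    rw [map_add, map_add]
    rfl
  · refine (key m _ _ (Lifts.smul r (hl s (φ m)))).trans ?_
    rw [map_smul, map_smul]
    rfl

/-- Local bilinear operators on the exterior algebra of sections extend to multisections. -/
theorem exists_extension₂ (B : SecAlg E F V →ₗ[ℝ] SecAlg E F V →ₗ[ℝ] SecAlg E F V)
    (hl : ∀ m η ζ, (∀ᶠ m' in 𝓝 m, evalMulti m' η = 0) → evalMulti m (B η ζ) = 0)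
    (hr : ∀ m η ζ, (∀ᶠ m' in 𝓝 m, evalMulti m' ζ = 0) → evalMulti m (B η ζ) = 0) :
    ∃ B' : Multisections E F V →ₗ[ℝ] Multisections E F V →ₗ[ℝ] Multisections E F V,
      ∀ m η ζ s t, Lifts m η s → Lifts m ζ t → (B' s t).1 m = evalMulti m (B η ζ) := by
  choose l hlift using fun (s : Multisections E F V) (m : M) => exists_lift s m
  have key : ∀ m η ζ s t, Lifts m η s → Lifts m ζ t →
      evalMulti m (B (l s m) (l t m)) = evalMulti m (B η ζ) := by
    intro m η ζ s t h h'
    have h1 := hl m _ (l t m) (Lifts.sub_eq_zero (hlift s m) h)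
    have h2 := hr m η _ (Lifts.sub_eq_zero (hlift t m) h')
    rw [map_sub, LinearMap.sub_apply, map_sub, sub_eq_zero] at h1
    rw [map_sub, map_sub, sub_eq_zero] at h2
    rw [h1, h2]
  let B' : Multisections E F V → Multisections E F V → Multisections E F V := fun s t =>
    ⟨fun m => evalMulti m (B (l s m) (l t m)), isSmoothMulti_of_eventuallyEq fun m₀ =>
      ⟨toMulti (B (l s m₀) (l t m₀)), by
        filter_upwards [Lifts.eventually (hlift s m₀), Lifts.eventually (hlift t m₀)] with m h1 h2
        rw [key m _ _ s t h1 h2, evalMulti_apply]⟩⟩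
  have hB : ∀ m η ζ s t, Lifts m η s → Lifts m ζ t → (B' s t).1 m = evalMulti m (B η ζ) := key
  clear_value B'
  refine ⟨LinearMap.mk₂ ℝ B'
      (fun s s' t => Multisections.ext_of_lifts fun m => ?_)
      (fun r s t => Multisections.ext_of_lifts fun m => ?_)
      (fun s t t' => Multisections.ext_of_lifts fun m => ?_)
      (fun r s t => Multisections.ext_of_lifts fun m => ?_), hB⟩
  · rw [hB m _ _ _ _ (Lifts.add (hlift s m) (hlift s' m)) (hlift t m), map_add,
      LinearMap.add_apply, map_add, ← hB m _ _ _ _ (hlift s m) (hlift t m),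
      ← hB m _ _ _ _ (hlift s' m) (hlift t m)]
    rfl
  · rw [hB m _ _ _ _ (Lifts.smul r (hlift s m)) (hlift t m), map_smul,
      LinearMap.smul_apply, map_smul, ← hB m _ _ _ _ (hlift s m) (hlift t m)]
    rfl
  · rw [hB m _ _ _ _ (hlift s m) (Lifts.add (hlift t m) (hlift t' m)), map_add, map_add,
      ← hB m _ _ _ _ (hlift s m) (hlift t m), ← hB m _ _ _ _ (hlift s m) (hlift t' m)]
    rfl
  · rw [hB m _ _ _ _ (hlift s m) (Lifts.smul r (hlift t m)), map_smul, map_smul,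
      ← hB m _ _ _ _ (hlift s m) (hlift t m)]
    rfl

theorem exists_fun_smul_eq_zero {m : M} {η : SecAlg E F V}
    (h : ∀ᶠ m' in 𝓝 m, evalMulti m' η = 0) : ∃ f : SmoothFun E M, f m = 1 ∧ f • η = 0 := by
  obtain ⟨f, hf, h⟩ := exists_smul_eq_zero η h
  exact ⟨f, hf.self_of_nhds, h⟩

/-- If `f • η = 0` and `f m = 1`, then at `m` the value of `T η` is that of `f • T η = T (f • η) =
0`. -/
theorem evalMulti_map_eq_zero (T : SecAlg E F V →ₗ[SmoothFun E M] SecAlg E F V) (m : M)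
    (η : SecAlg E F V) (h : ∀ᶠ m' in 𝓝 m, evalMulti m' η = 0) : evalMulti m (T η) = 0 := by
  obtain ⟨f, hf, h⟩ := exists_fun_smul_eq_zero h
  have h1 := evalMulti_smul m f (T η)
  rwa [← map_smul, h, map_zero, map_zero, hf, one_smul, eq_comm] at h1

namespace LieRinehart

/-- A Leibniz rule for arbitrary `u`: the second factor `f` has degree zero, so no sign depending on
the degree of `u` arises. -/
theorem bracket_smul {k R P : Type*} [CommRing k] [CommRing R] [Algebra k R] [AddCommGroup P]
    [Module k P] [Module R P] [IsScalarTower k R P] (A : LieRinehart k R P)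
    (u : ExteriorAlgebra R P) (f : R) (w : ExteriorAlgebra R P) :
    A.bracket u (f • w) = f • A.bracket u w + A.bracket u (algebraMap R _ f) * w := by
  induction u using ExteriorAlgebra.left_induction with
  | algebraMap g => simp [algebraMap_bracket]
  | add u v hu hv => simp only [map_add, LinearMap.add_apply, hu, hv, smul_add, add_mul]; abel
  | ι_mul X u hu =>
    rw [ι_mul_bracket, ι_mul_bracket, ι_mul_bracket, hu, lie_smul, lie_algebraMap,
      ← Algebra.commutes, ← Algebra.smul_def]
    simp only [mul_add, add_mul, smul_add, mul_smul_comm, smul_mul_assoc, mul_assoc]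
    abel

variable (A : LieRinehart ℝ (SmoothFun E M) (SmoothSec E F V))

/-- With `f • η = 0` and `f m = 1`, the Leibniz rule leaves the bracket and a multiple of `η`, and
the latter vanishes at `m`. -/
theorem evalMulti_bracket_left (m : M) (η ζ : SecAlg E F V)
    (h : ∀ᶠ m' in 𝓝 m, evalMulti m' η = 0) : evalMulti m (A.bracket η ζ) = 0 := by
  obtain ⟨f, hf, h'⟩ := exists_fun_smul_eq_zero h
  have h1 := congrArg (evalMulti m) (A.smul_bracket f η ζ)
  rwa [h', map_zero, LinearMap.zero_apply, map_zero, map_sub, evalMulti_smul, hf, one_smul,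
    map_mul, h.self_of_nhds, zero_mul, sub_zero, eq_comm] at h1

theorem evalMulti_bracket_right (m : M) (η ζ : SecAlg E F V)
    (h : ∀ᶠ m' in 𝓝 m, evalMulti m' ζ = 0) : evalMulti m (A.bracket η ζ) = 0 := by
  obtain ⟨f, hf, h'⟩ := exists_fun_smul_eq_zero h
  have h1 := congrArg (evalMulti m) (A.bracket_smul η f ζ)
  rwa [h', map_zero, map_zero, map_add, evalMulti_smul, hf, one_smul,
    map_mul, h.self_of_nhds, mul_zero, add_zero, eq_comm] at h1

/-- The Gerstenhaber bracket on multisections. -/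
def multiBracket : Multisections E F V →ₗ[ℝ] Multisections E F V →ₗ[ℝ] Multisections E F V :=
  (exists_extension₂ A.bracket A.evalMulti_bracket_left A.evalMulti_bracket_right).choose

theorem multiBracket_apply {m : M} {η ζ : SecAlg E F V} {s t : Multisections E F V}
    (h : Lifts m η s) (h' : Lifts m ζ t) :
    (A.multiBracket s t).1 m = evalMulti m (A.bracket η ζ) :=
  (exists_extension₂ A.bracket A.evalMulti_bracket_left A.evalMulti_bracket_right).choose_spec
    m η ζ s t h h'

theorem _root_.Lifts.multiBracket {m : M} {η ζ : SecAlg E F V} {s t : Multisections E F V}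
    (h : Lifts m η s) (h' : Lifts m ζ t) : Lifts m (A.bracket η ζ) (A.multiBracket s t) := by
  filter_upwards [h.eventually, h'.eventually] with m' h h'
  exact (A.multiBracket_apply h h').symm

theorem multiBracket_toMulti (η ζ : SecAlg E F V) :
    A.multiBracket (toMulti η) (toMulti ζ) = toMulti (A.bracket η ζ) :=
  Multisections.ext_of_lifts fun m =>
    A.multiBracket_apply (lifts_toMulti m η) (lifts_toMulti m ζ)

variable {A} {d : SmoothSec E F V →ₗ[ℝ] SmoothFun E M} (hd : A.IsDivergence d)

/-- The error term in `div_smul` is the contraction of `η` with the differential of `f`. It vanishes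
at `m` too, because contraction is linear over functions. -/
theorem IsDivergence.evalMulti_div (m : M) (η : SecAlg E F V)
    (h : ∀ᶠ m' in 𝓝 m, evalMulti m' η = 0) : evalMulti m (hd.div η) = 0 := by
  obtain ⟨f, hf, h'⟩ := exists_fun_smul_eq_zero h
  have h1 := congrArg (evalMulti m) (hd.div_smul f η)
  have h2 := congrArg (evalMulti m) (A.contr_smul f f η)
  rw [h', map_zero, map_zero, evalMulti_smul, hf, one_smul] at h2
  rwa [h', map_zero, map_zero, map_sub, evalMulti_smul, hf, one_smul, ← h2, sub_zero,
    eq_comm] at h1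

/-- The operator on multisections which is determined by a divergence operator on sections. -/
def IsDivergence.multiDiv : Multisections E F V →ₗ[ℝ] Multisections E F V :=
  (exists_extension continuous_id hd.div hd.evalMulti_div).choose

theorem IsDivergence.multiDiv_apply {m : M} {η : SecAlg E F V} {s : Multisections E F V}
    (h : Lifts m η s) : (hd.multiDiv s).1 m = evalMulti m (hd.div η) :=
  (exists_extension continuous_id hd.div hd.evalMulti_div).choose_spec m η s h

theorem _root_.Lifts.multiDiv {m : M} {η : SecAlg E F V} {s : Multisections E F V}
    (h : Lifts m η s) : Lifts m (hd.div η) (hd.multiDiv s) := by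
  filter_upwards [h.eventually] with m' h
  exact (hd.multiDiv_apply h).symm

end LieRinehart

theorem exists_lifts (s : Multisections E F V) (m : M) : ∃ η, Lifts m η s := exists_lift s m

theorem exists_homogeneous_lifts {k : ℕ} {s : Multisections E F V}
    (hs : s ∈ multiGrading E F V k) (m : M) :
    ∃ η, η ∈ (⋀[SmoothFun E M]^k (SmoothSec E F V)).restrictScalars ℝ ∧ Lifts m η s := by
  obtain ⟨η, h1, h2⟩ := exists_homogeneous_lift s hs m
  exact ⟨η, h1, h2⟩

/-- Independence is inherited from the fibres. For spanning, the projections onto homogeneous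
components are linear over functions, hence local, and extend to multisections; only degrees up to
the rank contribute. -/
theorem multiGrading_isInternal : DirectSum.IsInternal (multiGrading E F V) := by
  rw [DirectSum.isInternal_submodule_iff_iSupIndep_and_iSup_eq_top]
  constructor
  · rw [iSupIndep_def]
    intro i
    rw [Submodule.disjoint_def]
    intro s hs hs'
    refine Multisections.ext_of_lifts fun m => ?_
    have h1 : (⨆ j, ⨆ (_ : j ≠ i), multiGrading E F V j) ≤
        (⨆ j, ⨆ (_ : j ≠ i), ⋀[ℝ]^j (V m)).comap
          ((Pi.evalAlgHom ℝ (fun m => ExteriorAlgebra ℝ (V m)) m).comp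
            (Multisections E F V).val).toLinearMap := by
      refine iSup₂_le fun j hj t ht => ?_
      exact Submodule.mem_iSup_of_mem j (Submodule.mem_iSup_of_mem hj (ht m))
    have h2 := (iSupIndep_def.mp (DirectSum.isInternal_submodule_iff_iSupIndep_and_iSup_eq_top
      (fun i : ℕ => ⋀[ℝ]^i (V m)) |>.mp (DirectSum.Decomposition.isInternal _)).1) i
    exact Submodule.disjoint_def.mp h2 _ (hs m) (h1 hs')
  · rw [eq_top_iff]
    intro s _
    let pr : ℕ → SecAlg E F V →ₗ[SmoothFun E M] SecAlg E F V := fun k =>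
      (GradedAlgebra.proj (fun i : ℕ => ⋀[SmoothFun E M]^i (SmoothSec E F V)) k)
    choose T hT using fun k => exists_extension continuous_id ((pr k).restrictScalars ℝ)
      (fun m η h => evalMulti_map_eq_zero (pr k) m η h)
    have hmem : ∀ k η, pr k η ∈ ⋀[SmoothFun E M]^k (SmoothSec E F V) := fun k η => by
      simp only [pr, GradedAlgebra.proj_apply]
      exact SetLike.coe_mem _
    have h1 : ∀ k, T k s ∈ multiGrading E F V k := fun k m => by
      obtain ⟨η, hη⟩ := exists_lifts s m
      rw [hT k m η s hη]
      exact evalMulti_mem m (hmem k η)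
    have h2 : s = ∑ k ∈ Finset.range (Module.finrank ℝ F + 1), T k s := by
      refine Multisections.ext_of_lifts fun m => ?_
      obtain ⟨η, hη⟩ := exists_lifts s m
      have h3 : (∑ k ∈ Finset.range (Module.finrank ℝ F + 1), T k s).1 m =
          ∑ k ∈ Finset.range (Module.finrank ℝ F + 1), evalMulti m (pr k η) := by
        rw [AddSubmonoidClass.coe_finsetSum, Finset.sum_apply]
        exact Finset.sum_congr rfl fun k _ => hT k m η s hη
      classical
      rw [h3, ← hη.eval_eq]
      conv_lhs => rw [← DirectSum.sum_support_decompose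
        (fun i : ℕ => ⋀[SmoothFun E M]^i (SmoothSec E F V)) η, map_sum]
      have h4 : ∀ k, evalMulti m (pr k η) ≠ 0 →
          k ∈ Finset.range (Module.finrank ℝ F + 1) := fun k hk => by
        by_contra h
        have h5 := multiDeg_eq_bot (E := E) (F := F) (V := V) k (by simpa using h)
        have h6 : toMulti (pr k η) ∈ MultiDeg E F V k := fun m => evalMulti_mem m (hmem k η)
        rw [h5, Submodule.mem_bot] at h6
        exact hk (by rw [evalMulti_apply, h6]; rfl)
      have h7 : ∀ k, evalMulti m (pr k η) ≠ 0 → k ∈ DFinsupp.support (DirectSum.decompose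
          (fun i : ℕ => ⋀[SmoothFun E M]^i (SmoothSec E F V)) η) := fun k hk => by
        rw [DFinsupp.mem_support_iff]
        intro h
        exact hk (by simp only [pr, GradedAlgebra.proj_apply]; rw [h]; simp)
      change ∑ k ∈ _, evalMulti m (pr k η) = _
      -- The lift may have components of degree above the rank, and the range contains degrees that
      -- the lift lacks. After evaluation at `m`, both sums have the same nonzero terms.
      rw [← Finset.sum_filter_ne_zero, ← Finset.sum_filter_ne_zero
        (s := Finset.range (Module.finrank ℝ F + 1))]
      refine Finset.sum_congr ?_ fun _ _ => rfl
      ext k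
      simp only [Finset.mem_filter]
      exact ⟨fun h => ⟨h4 k h.2, h.2⟩, fun h => ⟨h7 k h.2, h.2⟩⟩
    rw [h2]
    exact Submodule.sum_mem _ fun k _ => Submodule.mem_iSup_of_mem k (h1 k)

/-- At each point the identities are read off on lifts, homogeneous where a degree is prescribed,
from the corresponding identities in the exterior algebra. -/
theorem LieRinehart.multiBracket_isHomGerstenhaber
    (A : LieRinehart ℝ (SmoothFun E M) (SmoothSec E F V)) :
    IsHomGerstenhaber (multiGrading E F V) (AlgHom.id ℝ _) A.multiBracket where
  graded :=
    { one_mem := fun m => by simp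
      mul_mem := fun _ _ _ _ hs ht m => mul_mem rfl (hs m) (ht m) }
  internal := multiGrading_isInternal
  graded_comm i j s hs t ht := Multisections.ext_of_lifts fun m =>
    LieRinehart.graded_comm ℝ (hs m) (ht m)
  twist_degree _ _ h := h
  bracket_degree i j l h s hs t ht m := by
    obtain ⟨η, hη, h1⟩ := exists_homogeneous_lifts hs m
    obtain ⟨ζ, hζ, h2⟩ := exists_homogeneous_lifts ht m
    rw [A.multiBracket_apply h1 h2]
    exact evalMulti_mem m (A.isHomGerstenhaber.bracket_degree i j l h η hη ζ hζ)
  bracket_zero s hs t ht := Multisections.ext_of_lifts fun m => by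
    obtain ⟨η, hη, h1⟩ := exists_homogeneous_lifts hs m
    obtain ⟨ζ, hζ, h2⟩ := exists_homogeneous_lifts ht m
    rw [A.multiBracket_apply h1 h2, A.isHomGerstenhaber.bracket_zero η hη ζ hζ, map_zero]
    rfl
  skew i j s hs t ht := Multisections.ext_of_lifts fun m => by
    obtain ⟨η, hη, h1⟩ := exists_homogeneous_lifts hs m
    obtain ⟨ζ, hζ, h2⟩ := exists_homogeneous_lifts ht m
    rw [A.multiBracket_apply h1 h2, A.isHomGerstenhaber.skew i j η hη ζ hζ, map_neg, map_smul,
      ← A.multiBracket_apply h2 h1]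
    rfl
  map_bracket _ _ := rfl
  hom_leibniz i j s hs t ht r := Multisections.ext_of_lifts fun m => by
    obtain ⟨η, hη, h1⟩ := exists_homogeneous_lifts hs m
    obtain ⟨ζ, hζ, h2⟩ := exists_homogeneous_lifts ht m
    obtain ⟨ξ, h3⟩ := exists_lifts r m
    rw [A.multiBracket_apply h1 (h2.mul h3), A.isHomGerstenhaber.hom_leibniz i j η hη ζ hζ ξ]
    simp only [AlgHom.id_apply, map_add, map_smul, map_mul, ← A.multiBracket_apply h1 h2,
      ← A.multiBracket_apply h1 h3, h2.eval_eq, h3.eval_eq]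
    rfl
  hom_jacobi i j l s hs t ht r hr := Multisections.ext_of_lifts fun m => by
    obtain ⟨η, hη, h1⟩ := exists_homogeneous_lifts hs m
    obtain ⟨ζ, hζ, h2⟩ := exists_homogeneous_lifts ht m
    obtain ⟨ξ, hξ, h3⟩ := exists_homogeneous_lifts hr m
    have h := congrArg (evalMulti m) (A.isHomGerstenhaber.hom_jacobi i j l η hη ζ hζ ξ hξ)
    simp only [AlgHom.id_apply, map_add, map_smul, map_zero] at h
    rw [← A.multiBracket_apply h1 (Lifts.multiBracket A h2 h3),
      ← A.multiBracket_apply h2 (Lifts.multiBracket A h3 h1),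
      ← A.multiBracket_apply h3 (Lifts.multiBracket A h1 h2)] at h
    exact h

theorem LieRinehart.IsDivergence.multiDiv_isExactGenerator
    {A : LieRinehart ℝ (SmoothFun E M) (SmoothSec E F V)}
    {d : SmoothSec E F V →ₗ[ℝ] SmoothFun E M} (hd : A.IsDivergence d) :
    IsExactGenerator (multiGrading E F V) (AlgHom.id ℝ _) A.multiBracket hd.multiDiv where
  degree_succ k s hs m := by
    obtain ⟨η, hη, h1⟩ := exists_homogeneous_lifts hs m
    rw [hd.multiDiv_apply h1]
    exact evalMulti_mem m (hd.div_degree hη k rfl)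
  degree_zero s hs := Multisections.ext_of_lifts fun m => by
    obtain ⟨η, hη, h1⟩ := exists_homogeneous_lifts hs m
    obtain ⟨f, rfl⟩ : ∃ f, algebraMap _ _ f = η := by
      have h2 : η ∈ ⋀[SmoothFun E M]^0 (SmoothSec E F V) := hη
      rw [exteriorPower, pow_zero] at h2
      exact Submodule.mem_one.mp h2
    rw [hd.multiDiv_apply h1, hd.div_algebraMap, map_zero]
    rfl
  comm_twist _ := rfl
  generates i s hs j t ht := Multisections.ext_of_lifts fun m => by
    obtain ⟨η, hη, h1⟩ := exists_homogeneous_lifts hs m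
    obtain ⟨ζ, hζ, h2⟩ := exists_homogeneous_lifts ht m
    have h : A.bracket η ζ = (-1 : ℝ) ^ i •
        (hd.div (η * ζ) - hd.div η * ζ - (-1 : ℝ) ^ i • (η * hd.div ζ)) := by
      rw [hd.div_mul hη ζ]
      rcases Nat.even_or_odd i with hi | hi <;>
        · simp only [hi.neg_one_pow, one_smul, neg_smul]
          abel
    rw [A.multiBracket_apply h1 h2, h, _root_.map_smul, map_sub, map_sub, _root_.map_smul,
      map_mul (evalMulti m), map_mul (evalMulti m),
      ← hd.multiDiv_apply h1, ← hd.multiDiv_apply h2, ← hd.multiDiv_apply (h1.mul h2),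
      h1.eval_eq, h2.eval_eq]
    rfl
  sq_zero s := Multisections.ext_of_lifts fun m => by
    obtain ⟨η, h1⟩ := exists_lifts s m
    rw [hd.multiDiv_apply (Lifts.multiDiv hd h1), hd.div_div, map_zero]
    rfl

end LocalOperators

/-! ### Twisting and untwisting of Gerstenhaber algebras and generators -/

section Twisting

variable {R A : Type*} [CommRing R] [Ring A] [Algebra R A] {𝒜 : ℕ → Submodule R A}
  {br : A →ₗ[R] A →ₗ[R] A}

/-- A Gerstenhaber algebra can be twisted by an endomorphism. -/
theorem IsHomGerstenhaber.twist (h : IsHomGerstenhaber 𝒜 (AlgHom.id R A) br) (τ : A →ₐ[R] A)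
    (hτ : ∀ i, ∀ X ∈ 𝒜 i, τ X ∈ 𝒜 i) (hbr : ∀ X Y, τ (br X Y) = br (τ X) (τ Y)) :
    IsHomGerstenhaber 𝒜 τ (br.compr₂ τ.toLinearMap) where
  graded := h.graded
  internal := h.internal
  graded_comm := h.graded_comm
  twist_degree := hτ
  bracket_degree i j k hk X hX Y hY := hτ _ _ (h.bracket_degree i j k hk X hX Y hY)
  bracket_zero X hX Y hY := by simp [h.bracket_zero X hX Y hY]
  skew i j X hX Y hY := by
    simp only [LinearMap.compr₂_apply, AlgHom.toLinearMap_apply]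
    rw [h.skew i j X hX Y hY, map_neg, map_smul]
  map_bracket X Y := by
    simp only [LinearMap.compr₂_apply, AlgHom.toLinearMap_apply, hbr]
  hom_jacobi i j k X hX Y hY Z hZ := by
    -- The hom-Jacobi expression of the twisted bracket is `τ²` applied to the ordinary one.
    have h1 := congrArg (fun u => τ (τ u)) (h.hom_jacobi i j k X hX Y hY Z hZ)
    simp only [LinearMap.compr₂_apply, AlgHom.toLinearMap_apply, ← hbr]
    simpa using h1
  hom_leibniz i j X hX Y hY Z := by
    simp only [LinearMap.compr₂_apply, AlgHom.toLinearMap_apply]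
    rw [h.hom_leibniz i j X hX Y hY Z]
    simp

/-- Twisting of exact generators. -/
theorem IsExactGenerator.twist {D : A →ₗ[R] A}
    (h : IsExactGenerator 𝒜 (AlgHom.id R A) br D) (τ : A →ₐ[R] A)
    (hτ : ∀ i, ∀ X ∈ 𝒜 i, τ X ∈ 𝒜 i) (hD : ∀ X, τ (D X) = D (τ X)) :
    IsExactGenerator 𝒜 τ (br.compr₂ τ.toLinearMap) (τ.toLinearMap ∘ₗ D) where
  degree_succ k X hX := hτ _ _ (h.degree_succ k X hX)
  degree_zero X hX := by simp [h.degree_zero X hX]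
  comm_twist X := by simp [hD]
  generates i X hX j Y hY := by
    simp only [LinearMap.compr₂_apply, AlgHom.toLinearMap_apply, LinearMap.comp_apply]
    rw [h.generates i X hX j Y hY]
    simp
  sq_zero X := by simp [← hD, h.sq_zero]

/-- Exact generators of a twisted Gerstenhaber algebra can be untwisted. -/
theorem IsExactGenerator.untwist {D : A →ₗ[R] A} {τ τ' : A →ₐ[R] A}
    (h : IsExactGenerator 𝒜 τ (br.compr₂ τ.toLinearMap) D)
    (hτ : ∀ i, ∀ X ∈ 𝒜 i, τ' X ∈ 𝒜 i) (h1 : ∀ X, τ' (τ X) = X) (h2 : ∀ X, τ (τ' X) = X) :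
    IsExactGenerator 𝒜 (AlgHom.id R A) br (τ'.toLinearMap ∘ₗ D) where
  degree_succ k X hX := hτ _ _ (h.degree_succ k X hX)
  degree_zero X hX := by simp [h.degree_zero X hX]
  comm_twist X := rfl
  generates i X hX j Y hY := by
    have h3 := congrArg τ' (h.generates i X hX j Y hY)
    simpa [h1] using h3
  sq_zero X := by
    have h3 := h.comm_twist (τ' (τ' (D X)))
    rw [h2] at h3
    -- Commutation with the twist gives `τ D τ' D = D τ τ' D = D² = 0`, and `τ` is cancelled by
    -- `τ'`.
    have h4 := h.comm_twist (τ' (D X))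
    rw [h2, h.sq_zero] at h4
    simp only [LinearMap.comp_apply, AlgHom.toLinearMap_apply]
    have h5 := congrArg τ' h4
    rw [h1, map_zero] at h5
    rw [← h5, map_zero]

end Twisting

/-! ### The twist on multisections -/

section MultiTwist

open ExteriorAlgebra Topology

variable {E : Type*} [NormedAddCommGroup E] [NormedSpace ℝ E]
  {M : Type*} [TopologicalSpace M] [ChartedSpace E M]
  {F : Type*} [NormedAddCommGroup F] [NormedSpace ℝ F]
  {V : M → Type*} [TopologicalSpace (TotalSpace F V)] [∀ m, TopologicalSpace (V m)]
  [∀ m, AddCommGroup (V m)] [∀ m, Module ℝ (V m)] [FiberBundle F V] [VectorBundle ℝ F V]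

/-- The pullback `f ↦ f ∘ φ` of smooth functions. -/
def SmoothFun.pullback (φ : SmoothSelfMap E M) : SmoothFun E M →ₐ[ℝ] SmoothFun E M where
  toFun f := f.comp φ
  map_one' := rfl
  map_mul' _ _ := rfl
  map_zero' := rfl
  map_add' _ _ := rfl
  commutes' _ := rfl

@[simp] theorem SmoothFun.pullback_apply (φ : SmoothSelfMap E M) (f : SmoothFun E M) (m : M) :
    SmoothFun.pullback φ f m = f (φ m) := rfl

variable [FiniteDimensional ℝ F]

theorem funMulti_mul (f : SmoothFun E M) (s : Multisections E F V) :
    funMulti f * s = f • s := (Algebra.smul_def f s).symm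

theorem funMulti_mem (f : SmoothFun E M) : funMulti f ∈ multiGrading E F V 0 :=
  fun m => algebraMap_mem ℝ (V m) (f m)

theorem secMulti_mem (X : SmoothSec E F V) : secMulti X ∈ multiGrading E F V 1 :=
  fun m => ι_mem (X m)

theorem funMulti_injective : Function.Injective (funMulti (E := E) (F := F) (V := V)) := by
  intro f g h
  ext m
  have h1 := congrFun (congrArg Subtype.val h) m
  exact (ExteriorAlgebra.algebraMap_inj _ _ _).mp h1

/-- The component of degree `0` of a multisection. -/
def Multisections.scalar : Multisections E F V →ₗ[ℝ] SmoothFun E M where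
  toFun s := ⟨fun m => algebraMapInv (s.1 m), fun m₀ => by
    refine (s.2 m₀ algebraMapInv.toLinearMap).congr_of_eventuallyEq
      (Filter.Eventually.of_forall fun m => ?_)
    -- The scalar part is invariant under maps induced on exterior algebras, so it can be read in
    -- any trivialization.
    have h : (algebraMapInv (R := ℝ) (M := F)).comp
        (ExteriorAlgebra.map ((trivializationAt F V m₀).linearMapAt ℝ m)) = algebraMapInv := by
      apply ExteriorAlgebra.hom_ext
      ext v
      simp [algebraMapInv]
    exact (DFunLike.congr_fun h (s.1 m)).symm⟩
  map_add' s t := by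
    ext m
    exact map_add (algebraMapInv (R := ℝ) (M := V m)) (s.1 m) (t.1 m)
  map_smul' r s := by
    ext m
    exact map_smul (algebraMapInv (R := ℝ) (M := V m)) r (s.1 m)

theorem Multisections.funMulti_scalar {s : Multisections E F V} (hs : s ∈ multiGrading E F V 0) :
    funMulti (Multisections.scalar s) = s := by
  refine Multisections.ext_of_lifts fun m => ?_
  have h := hs m
  rw [exteriorPower, pow_zero] at h
  obtain ⟨r, hr⟩ := Submodule.mem_one.mp h
  change algebraMap ℝ _ (algebraMapInv (s.1 m)) = s.1 m
  rw [← hr, algebraMap_leftInverse (V m) r]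

variable [ContMDiffVectorBundle ∞ F V 𝓘(ℝ, E)]
variable [FiniteDimensional ℝ E] [T2Space M] [IsManifold 𝓘(ℝ, E) ∞ M]

theorem Multisections.exists_smul_eq_zero {s : Multisections E F V} {m : M}
    (h : ∀ᶠ m' in 𝓝 m, s.1 m' = 0) : ∃ f : SmoothFun E M, f m = 1 ∧ f • s = 0 := by
  obtain ⟨χ, h1, h2⟩ := SmoothFun.exists_cutoff (E := E) m h
  refine ⟨χ, h1.self_of_nhds, Multisections.ext_of_lifts fun m' => ?_⟩
  rw [Multisections.fsmul_apply]
  by_cases hm : m' ∈ tsupport χ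
  · have : s.1 m' = 0 := h2 hm
    rw [this, smul_zero]
    rfl
  · rw [image_eq_zero_of_notMem_tsupport hm, zero_smul]
    rfl

/-- Local operators on multisections are determined by their values on the exterior algebra of
sections. -/
theorem Multisections.ext_of_local {φ : M → M}
    {T T' : Multisections E F V →ₗ[ℝ] Multisections E F V}
    (hT : ∀ m s, (∀ᶠ m' in 𝓝 (φ m), s.1 m' = 0) → (T s).1 m = (T' s).1 m)
    (h : ∀ η : SecAlg E F V, T (toMulti η) = T' (toMulti η)) : T = T' := by
  ext1 s
  refine Multisections.ext_of_lifts fun m => ?_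
  obtain ⟨η, hη⟩ := exists_lifts s (φ m)
  have h1 := hT m (toMulti η - s) (by
    filter_upwards [hη] with m' h'
    change (toMulti η).1 m' - s.1 m' = 0
    rw [← h', evalMulti_apply, sub_self])
  rw [map_sub, map_sub, h] at h1
  exact sub_right_injective h1

theorem Multisections.linearMap_ext {N : Type*} [AddCommMonoid N] [Module ℝ N]
    {T T' : Multisections E F V →ₗ[ℝ] N}
    (h : ∀ i, ∀ s ∈ multiGrading E F V i, T s = T' s) : T = T' := by
  ext1 s
  have hs : s ∈ ⨆ i, multiGrading E F V i := by
    rw [multiGrading_isInternal.submodule_iSup_eq_top]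
    trivial
  induction hs using Submodule.iSup_induction' with
  | mem i s hs => exact h i s hs
  | zero => simp
  | add s t _ _ hs ht => rw [map_add, map_add, hs, ht]

variable {φ : SmoothSelfMap E M} {α : SmoothSec E F V →ₗ[ℝ] SmoothSec E F V}
  (hα : ∀ (f : SmoothFun E M) X, α (f • X) = SmoothFun.pullback φ f • α X)

theorem evalMulti_semilinearMap (m : M) (η : SecAlg E F V)
    (h : ∀ᶠ m' in 𝓝 (φ m), evalMulti m' η = 0) :
    evalMulti m (semilinearMap (SmoothFun.pullback φ) α hα η) = 0 := by
  obtain ⟨f, hf, h'⟩ := exists_fun_smul_eq_zero h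
  have h1 := congrArg (evalMulti m) (semilinearMap_smul hα f η)
  rwa [h', map_zero, map_zero, evalMulti_smul, SmoothFun.pullback_apply, hf, one_smul,
    eq_comm] at h1

theorem exists_multiTwist : ∃ T : Multisections E F V →ₐ[ℝ] Multisections E F V,
    ∀ m η s, Lifts (φ m) η s →
      (T s).1 m = evalMulti m (semilinearMap (SmoothFun.pullback φ) α hα η) := by
  obtain ⟨T, hT⟩ := exists_extension φ.contMDiff.continuous
    (semilinearMap (SmoothFun.pullback φ) α hα).toLinearMap (evalMulti_semilinearMap hα)
  refine ⟨AlgHom.ofLinearMap T (Multisections.ext_of_lifts fun m => ?_)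
    (fun s t => Multisections.ext_of_lifts fun m => ?_), hT⟩
  · have hT : ∀ m η s, Lifts (φ m) η s →
        (T s).1 m = evalMulti m (semilinearMap (SmoothFun.pullback φ) α hα η) := hT
    have h := lifts_toMulti (φ m) (1 : SecAlg E F V)
    rw [map_one] at h
    rw [hT m _ _ h, map_one, map_one]
    rfl
  · have hT : ∀ m η s, Lifts (φ m) η s →
        (T s).1 m = evalMulti m (semilinearMap (SmoothFun.pullback φ) α hα η) := hT
    obtain ⟨η, hη⟩ := exists_lifts s (φ m)
    obtain ⟨ζ, hζ⟩ := exists_lifts t (φ m)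
    rw [hT m _ _ (hη.mul hζ), map_mul, map_mul, ← hT m _ _ hη, ← hT m _ _ hζ]
    rfl

/-- The extension to multisections of a map of sections which is semilinear over `φ`. -/
def multiTwist : Multisections E F V →ₐ[ℝ] Multisections E F V := (exists_multiTwist hα).choose

theorem multiTwist_apply {m : M} {η : SecAlg E F V} {s : Multisections E F V}
    (h : Lifts (φ m) η s) : (multiTwist hα s).1 m =
      evalMulti m (semilinearMap (SmoothFun.pullback φ) α hα η) :=
  (exists_multiTwist hα).choose_spec m η s h

theorem Lifts.multiTwist {m : M} {η : SecAlg E F V} {s : Multisections E F V}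
    (h : Lifts (φ m) η s) :
    Lifts m (semilinearMap (SmoothFun.pullback φ) α hα η) (multiTwist hα s) := by
  filter_upwards [φ.contMDiff.continuous.continuousAt.eventually h.eventually] with m' h
  exact (multiTwist_apply hα h).symm

theorem multiTwist_toMulti (η : SecAlg E F V) : multiTwist hα (toMulti η) =
    toMulti (semilinearMap (SmoothFun.pullback φ) α hα η) :=
  Multisections.ext_of_lifts fun m => multiTwist_apply hα (lifts_toMulti (φ m) η)

theorem multiTwist_funMulti (f : SmoothFun E M) :
    multiTwist hα (funMulti f) = funMulti (SmoothFun.pullback φ f) := by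
  rw [← toMulti_algebraMap, multiTwist_toMulti, semilinearMap_algebraMap, toMulti_algebraMap]

theorem multiTwist_secMulti (X : SmoothSec E F V) :
    multiTwist hα (secMulti X) = secMulti (α X) := by
  rw [← toMulti_ι, multiTwist_toMulti, semilinearMap_ι, toMulti_ι]

theorem multiTwist_smul (f : SmoothFun E M) (s : Multisections E F V) :
    multiTwist hα (f • s) = SmoothFun.pullback φ f • multiTwist hα s := by
  rw [← funMulti_mul, map_mul, multiTwist_funMulti, funMulti_mul]

theorem multiTwist_mem (k : ℕ) (s : Multisections E F V) (hs : s ∈ multiGrading E F V k) :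
    multiTwist hα s ∈ multiGrading E F V k := fun m => by
  obtain ⟨η, hη, h⟩ := exists_homogeneous_lifts hs (φ m)
  rw [multiTwist_apply hα h]
  exact evalMulti_mem m (semilinearMap_mem hα hη)

/-- An algebra endomorphism of the multisections which extends `φ^*` and `α` is unique. -/
theorem eq_multiTwist {T : Multisections E F V →ₐ[ℝ] Multisections E F V}
    (h1 : ∀ f, T (funMulti f) = funMulti (SmoothFun.pullback φ f))
    (h2 : ∀ X, T (secMulti X) = secMulti (α X)) : T = multiTwist hα := by
  have key : ∀ T : Multisections E F V →ₐ[ℝ] Multisections E F V,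
      (∀ f, T (funMulti f) = funMulti (SmoothFun.pullback φ f)) →
      ∀ m s, (∀ᶠ m' in 𝓝 (φ m), s.1 m' = 0) → (T s).1 m = 0 := by
    intro T h1 m s hs
    obtain ⟨f, hf, h⟩ := Multisections.exists_smul_eq_zero hs
    have h3 := congrArg (fun t => (T t).1 m) h
    simp only [← funMulti_mul, map_mul, h1] at h3
    rw [funMulti_mul, Multisections.fsmul_apply, SmoothFun.pullback_apply, hf, one_smul,
      map_zero] at h3
    exact h3
  have h : T.toLinearMap = (multiTwist hα).toLinearMap := by
    refine Multisections.ext_of_local (φ := φ) (fun m s hs => ?_) fun η => ?_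
    · exact (key T h1 m s hs).trans (key _ (multiTwist_funMulti hα) m s hs).symm
    · simp only [AlgHom.toLinearMap_apply]
      induction η using ExteriorAlgebra.left_induction with
      | algebraMap f => rw [toMulti_algebraMap, h1, multiTwist_funMulti]
      | add u v hu hv => simp only [map_add, hu, hv]
      | ι_mul X u hu => rw [map_mul, map_mul, map_mul, hu, toMulti_ι, h2, multiTwist_secMulti]
  exact AlgHom.toLinearMap_injective h

/-- Pullbacks compose contravariantly, so `φ ∘ φ' = id` is paired with `α' ∘ α = id`. -/
theorem multiTwist_comp {φ' : SmoothSelfMap E M} {α' : SmoothSec E F V →ₗ[ℝ] SmoothSec E F V}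
    (hα' : ∀ (f : SmoothFun E M) X, α' (f • X) = SmoothFun.pullback φ' f • α' X)
    (h1 : ∀ m, φ (φ' m) = m) (h2 : ∀ X, α' (α X) = X) (s : Multisections E F V) :
    multiTwist hα' (multiTwist hα s) = s := by
  refine Multisections.ext_of_lifts fun m => ?_
  obtain ⟨η, hη⟩ := exists_lifts s m
  have h3 := multiTwist_apply hα' (Lifts.multiTwist hα (m := φ' m) (by rwa [h1]))
  rw [h3, semilinearMap_comp hα hα' (fun f => ?_) h2, hη.eval_eq]
  ext m
  simp [h1]

variable {A : LieRinehart ℝ (SmoothFun E M) (SmoothSec E F V)}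
  (hbr : ∀ X Y, α (A.br X Y) = A.br (α X) (α Y))
  (han : ∀ X f, A.anchor (α X) (SmoothFun.pullback φ f) = SmoothFun.pullback φ (A.anchor X f))

include hbr han in
theorem multiTwist_multiBracket (s t : Multisections E F V) :
    multiTwist hα (A.multiBracket s t) = A.multiBracket (multiTwist hα s) (multiTwist hα t) := by
  refine Multisections.ext_of_lifts fun m => ?_
  obtain ⟨η, hη⟩ := exists_lifts s (φ m)
  obtain ⟨ζ, hζ⟩ := exists_lifts t (φ m)
  rw [multiTwist_apply hα (Lifts.multiBracket A hη hζ), semilinearMap_bracket hα hbr han,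
    A.multiBracket_apply (hη.multiTwist hα) (hζ.multiTwist hα)]

include hbr han in
theorem multiTwist_multiDiv {d : SmoothSec E F V →ₗ[ℝ] SmoothFun E M} (hd : A.IsDivergence d)
    (hdα : ∀ X, d (α X) = SmoothFun.pullback φ (d X)) (s : Multisections E F V) :
    multiTwist hα (hd.multiDiv s) = hd.multiDiv (multiTwist hα s) := by
  refine Multisections.ext_of_lifts fun m => ?_
  obtain ⟨η, hη⟩ := exists_lifts s (φ m)
  rw [multiTwist_apply hα (Lifts.multiDiv hd hη), semilinearMap_div hα hbr han hd hdα,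
    hd.multiDiv_apply (hη.multiTwist hα)]

end MultiTwist

/-! ### From regular hom-Lie algebroids to Lie–Rinehart structures -/

section Untwisting

open ExteriorAlgebra Topology

variable {E : Type*} [NormedAddCommGroup E] [NormedSpace ℝ E]
  {M : Type*} [TopologicalSpace M] [ChartedSpace E M] [IsManifold 𝓘(ℝ, E) ∞ M]
  {F : Type*} [NormedAddCommGroup F] [NormedSpace ℝ F]
  {V : M → Type*} [TopologicalSpace (TotalSpace F V)] [∀ m, TopologicalSpace (V m)]
  [∀ m, AddCommGroup (V m)] [∀ m, Module ℝ (V m)] [FiberBundle F V] [VectorBundle ℝ F V]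

theorem Anchor.act_mul {φ : SmoothSelfMap E M} (ρ : Anchor F V φ) (X : SmoothSec E F V)
    (f g : SmoothFun E M) : ρ.act X (f * g) =
      SmoothFun.pullback φ f * ρ.act X g + SmoothFun.pullback φ g * ρ.act X f := by
  ext m
  have hf := f.contMDiff.mdifferentiableAt (x := φ m) (by simp)
  have hg := g.contMDiff.mdifferentiableAt (x := φ m) (by simp)
  exact congrArg (fun L : TangentSpace 𝓘(ℝ, E) (φ m) →L[ℝ] ℝ => L (ρ.toFun m (X (φ m))))
    (hf.hasMFDerivAt.mul hg.hasMFDerivAt).mfderiv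

theorem Anchor.smul_act {φ : SmoothSelfMap E M} (ρ : Anchor F V φ) (g : SmoothFun E M)
    (X : SmoothSec E F V) (f : SmoothFun E M) :
    ρ.act (g • X) f = SmoothFun.pullback φ g * ρ.act X f := by
  ext m
  change mfderiv 𝓘(ℝ, E) 𝓘(ℝ, ℝ) f (φ m) (ρ.toFun m ((g • X) (φ m))) = _
  rw [SmoothSec.fsmul_apply, map_smul, map_smul]
  rfl

/-- The Lie–Rinehart structure which is obtained from a regular hom-Lie algebroid by composition
with the inverse of its twist. -/
structure HomLieAlgebroid.Untwisting (𝒜 : HomLieAlgebroid E F V) where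
  φinv : SmoothSelfMap E M
  αinv : SmoothSec E F V →ₗ[ℝ] SmoothSec E F V
  φ_φinv : ∀ m, 𝒜.φ (φinv m) = m
  φinv_φ : ∀ m, φinv (𝒜.φ m) = m
  α_αinv : ∀ X, 𝒜.α (αinv X) = X
  αinv_α : ∀ X, αinv (𝒜.α X) = X
  αinv_smul : ∀ (f : SmoothFun E M) X, αinv (f • X) = SmoothFun.pullback φinv f • αinv X
  A : LieRinehart ℝ (SmoothFun E M) (SmoothSec E F V)
  α_br : ∀ X Y, 𝒜.α (A.br X Y) = 𝒜.bracket X Y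
  pullback_anchor : ∀ X f, SmoothFun.pullback 𝒜.φ (A.anchor X f) = 𝒜.ρ.act X f
  br_α : ∀ X Y, 𝒜.α (A.br X Y) = A.br (𝒜.α X) (𝒜.α Y)
  anchor_α : ∀ X f, A.anchor (𝒜.α X) (SmoothFun.pullback 𝒜.φ f) =
    SmoothFun.pullback 𝒜.φ (A.anchor X f)

/-- The bracket is `α⁻¹ [·,·]` and the anchor is `(φ^*)⁻¹ ρ`. Each hom-axiom becomes the ordinary
axiom with one or two twists in front, which are cancelled by injectivity. The twisted product rule
for `ρ` becomes an honest derivation rule. -/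
theorem HomLieAlgebroid.IsRegular.nonempty_untwisting {𝒜 : HomLieAlgebroid E F V}
    (h : 𝒜.IsRegular) : Nonempty 𝒜.Untwisting := by
  obtain ⟨hα, e, he⟩ := h
  let a := LinearEquiv.ofBijective 𝒜.α hα
  let φ' : SmoothSelfMap E M := ⟨e.symm, e.symm.contMDiff⟩
  have h1 : ∀ m, 𝒜.φ (φ' m) = m := fun m => by
    rw [← he]
    exact e.apply_symm_apply m
  have h2 : ∀ m, φ' (𝒜.φ m) = m := fun m => by
    rw [← he]
    exact e.symm_apply_apply m
  have h3 : ∀ X, 𝒜.α (a.symm X) = X := fun X => a.apply_symm_apply X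
  have h4 : ∀ X, a.symm (𝒜.α X) = X := fun X => a.symm_apply_apply X
  let θ := SmoothFun.pullback 𝒜.φ
  let θ' := SmoothFun.pullback φ'
  have h5 : ∀ f, θ (θ' f) = f := fun f => by ext m; simp [θ, θ', h2]
  have h6 : ∀ f, θ' (θ f) = f := fun f => by ext m; simp [θ, θ', h1]
  have h7 : ∀ f X, 𝒜.α (f • X) = θ f • 𝒜.α X := 𝒜.α_smul
  have h8 : ∀ (f : SmoothFun E M) X, a.symm (f • X) = θ' f • a.symm X := fun f X => by
    apply a.injective
    change 𝒜.α _ = 𝒜.α _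
    rw [h3, h7, h5, h3]
  let br : SmoothSec E F V →ₗ[ℝ] SmoothSec E F V →ₗ[ℝ] SmoothSec E F V :=
    𝒜.bracket.compr₂ a.symm.toLinearMap
  have h9 : ∀ X Y, 𝒜.α (br X Y) = 𝒜.bracket X Y := fun X Y => h3 _
  have h10 : ∀ X Y, 𝒜.α (br X Y) = br (𝒜.α X) (𝒜.α Y) := fun X Y => by
    apply a.injective
    change 𝒜.α _ = 𝒜.α _
    rw [h9, h9, 𝒜.homLie.map_bracket]
  let anchor : SmoothSec E F V →ₗ[SmoothFun E M] Derivation ℝ (SmoothFun E M) (SmoothFun E M) :=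
    { toFun := fun X => Derivation.mk' (θ'.toLinearMap ∘ₗ 𝒜.ρ.act X) fun f g => by
        have h := congrArg θ' (𝒜.ρ.act_mul X f g)
        rw [map_add, map_mul θ', map_mul θ', h6, h6] at h
        exact h
      map_add' := fun X Y => by
        ext1 f
        change θ' (𝒜.ρ.act (X + Y) f) = θ' _ + θ' _
        rw [map_add, LinearMap.add_apply, map_add]
      map_smul' := fun g X => by
        ext1 f
        change θ' (𝒜.ρ.act (g • X) f) = g * θ' _
        rw [𝒜.ρ.smul_act, map_mul, h6] }
  have h11 : ∀ X f, θ (anchor X f) = 𝒜.ρ.act X f := fun X f => h5 _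
  have h12 : ∀ X f, anchor (𝒜.α X) (θ f) = θ (anchor X f) := fun X f => by
    have h := 𝒜.anchor_rep.map_twist X f
    change θ' (𝒜.ρ.act (𝒜.α X) (θ f)) = _
    rw [h11]
    refine Eq.trans ?_ (h6 _)
    exact congrArg θ' h
  have h13 : Function.Injective θ := fun f g h => by rw [← h6 f, h, h6]
  have h14 : ∀ X Y, br X Y = -br Y X := fun X Y => by
    apply hα.injective
    rw [map_neg, h9, h9, 𝒜.homLie.skew]
  have h15 : ∀ X Y f, anchor (br X Y) f = anchor X (anchor Y f) - anchor Y (anchor X f) := by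
    intro X Y f
    -- In terms of the untwisted anchor, each term of the representation axiom carries `θ` twice.
    apply h13
    apply h13
    have h : 𝒜.ρ.act (𝒜.bracket X Y) (θ f) =
        𝒜.ρ.act (𝒜.α X) (𝒜.ρ.act Y f) - 𝒜.ρ.act (𝒜.α Y) (𝒜.ρ.act X f) :=
      𝒜.anchor_rep.map_bracket X Y f
    simp only [← h9, ← h11, h12] at h
    rw [h, ← map_sub, ← map_sub]
  refine ⟨⟨φ', a.symm.toLinearMap, h1, h2, h3, h4, h8,
    ⟨br, anchor, fun X => ?_, fun X Y Z => ?_, fun X f Y => ?_, h15⟩, h9, h11, h10, h12⟩⟩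
  -- Skew-symmetry yields an alternating bracket because `2` is invertible.
  · have h := eq_neg_iff_add_eq_zero.mp (h14 X X)
    rwa [← two_smul ℝ, smul_eq_zero_iff_right (two_ne_zero' ℝ)] at h
  · have h := 𝒜.homLie.hom_jacobi X Y Z
    simp only [← h9, ← h10, ← map_add] at h
    have h' := (map_eq_zero_iff _ hα.injective).mp ((map_eq_zero_iff _ hα.injective).mp h)
    rw [h14 Z (br X Y), h14 Z X, map_neg] at h'
    rw [← sub_eq_zero, ← h']
    abel
  · have h := congrArg a.symm (𝒜.hom_leibniz X f Y)
    rw [map_add, h8, h8, h4] at h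
    refine h.trans ?_
    congr 2
    exact h6 f

namespace HomLieAlgebroid.Untwisting

variable [FiniteDimensional ℝ F] [ContMDiffVectorBundle ∞ F V 𝓘(ℝ, E)]
variable [FiniteDimensional ℝ E] [T2Space M]

variable {𝒜 : HomLieAlgebroid E F V} (U : 𝒜.Untwisting)

/-- The extension of `φ^*` and `α` to multisections. -/
abbrev _root_.HomLieAlgebroid.multiTwist (𝒜 : HomLieAlgebroid E F V) :
    Multisections E F V →ₐ[ℝ] Multisections E F V :=
  _root_.multiTwist (φ := 𝒜.φ) (α := 𝒜.α) 𝒜.α_smul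

theorem _root_.HomLieAlgebroid.multiTwist_secMulti (X : SmoothSec E F V) :
    𝒜.multiTwist (secMulti X) = secMulti (𝒜.α X) :=
  _root_.multiTwist_secMulti _ X

theorem _root_.HomLieAlgebroid.multiTwist_funMulti (f : SmoothFun E M) :
    𝒜.multiTwist (funMulti f) = funMulti (SmoothFun.pullback 𝒜.φ f) :=
  _root_.multiTwist_funMulti _ f

/-- The inverse of the extension of `φ^*` and `α` to multisections. -/
abbrev multiTwistInv : Multisections E F V →ₐ[ℝ] Multisections E F V :=
  _root_.multiTwist U.αinv_smul

@[simp] theorem multiTwistInv_multiTwist (s : Multisections E F V) :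
    U.multiTwistInv (𝒜.multiTwist s) = s :=
  multiTwist_comp _ _ U.φ_φinv U.αinv_α s

@[simp] theorem multiTwist_multiTwistInv (s : Multisections E F V) :
    𝒜.multiTwist (U.multiTwistInv s) = s :=
  multiTwist_comp _ _ U.φinv_φ U.α_αinv s

theorem multiTwist_multiBracket (s t : Multisections E F V) :
    𝒜.multiTwist (U.A.multiBracket s t) =
      U.A.multiBracket (𝒜.multiTwist s) (𝒜.multiTwist t) :=
  _root_.multiTwist_multiBracket _ U.br_α U.anchor_α s t

/-- The hom-Gerstenhaber algebra associated to a regular hom-Lie algebroid. -/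
def assoc : AssocHomGerstenhaber 𝒜 where
  twist := 𝒜.multiTwist
  bracket := U.A.multiBracket.compr₂ 𝒜.multiTwist.toLinearMap
  isHomGerstenhaber := U.A.multiBracket_isHomGerstenhaber.twist _ (multiTwist_mem _)
    U.multiTwist_multiBracket
  twist_fun f := HomLieAlgebroid.multiTwist_funMulti f
  twist_sec X := HomLieAlgebroid.multiTwist_secMulti X
  bracket_sec X Y := by
    rw [LinearMap.compr₂_apply, ← toMulti_ι, ← toMulti_ι, U.A.multiBracket_toMulti,
      LieRinehart.ι_bracket, LieRinehart.lie_ι, toMulti_ι, AlgHom.toLinearMap_apply,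
      HomLieAlgebroid.multiTwist_secMulti, U.α_br]
  bracket_fun X f := by
    rw [LinearMap.compr₂_apply, ← toMulti_ι, ← toMulti_algebraMap, U.A.multiBracket_toMulti,
      LieRinehart.ι_bracket, LieRinehart.lie_algebraMap, toMulti_algebraMap,
      AlgHom.toLinearMap_apply, HomLieAlgebroid.multiTwist_funMulti, U.pullback_anchor]

end HomLieAlgebroid.Untwisting

/-! ### Uniqueness of the associated hom-Gerstenhaber structure -/

namespace AssocHomGerstenhaber

variable [FiniteDimensional ℝ F] [ContMDiffVectorBundle ∞ F V 𝓘(ℝ, E)]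
variable [FiniteDimensional ℝ E] [T2Space M]

variable {𝒜 : HomLieAlgebroid E F V}

theorem twist_eq (G : AssocHomGerstenhaber 𝒜) : G.twist = 𝒜.multiTwist :=
  eq_multiTwist _ G.twist_fun G.twist_sec

/-- A twisted derivation of multisections which vanishes on functions and sections is zero. -/
theorem eq_of_derivation (T : Multisections E F V →ₐ[ℝ] Multisections E F V)
    (hT : ∀ f : SmoothFun E M, T (funMulti f) = funMulti (f.comp 𝒜.φ)) (i : ℕ)
    {D D' : Multisections E F V →ₗ[ℝ] Multisections E F V}
    (hD : ∀ j, ∀ Y ∈ multiGrading E F V j, ∀ Z,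
      D (Y * Z) = D Y * T Z + (-1 : ℝ) ^ ((i + 1) * j) • (T Y * D Z))
    (hD' : ∀ j, ∀ Y ∈ multiGrading E F V j, ∀ Z,
      D' (Y * Z) = D' Y * T Z + (-1 : ℝ) ^ ((i + 1) * j) • (T Y * D' Z))
    (h1 : ∀ f, D (funMulti f) = D' (funMulti f)) (h2 : ∀ X, D (secMulti X) = D' (secMulti X)) :
    D = D' := by
  refine Multisections.ext_of_local (φ := 𝒜.φ) (fun m s hs => ?_) fun η => ?_
  -- Locality: expand `D (f • s) = 0` and `D' (f • s) = 0` by the Leibniz rule for the degree zero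
  -- factor `f`. The terms that differentiate `f` agree, and `T f` has value `1` at `m`.
  · obtain ⟨f, hf, h⟩ := Multisections.exists_smul_eq_zero hs
    have h3 := hD 0 _ (funMulti_mem f) s
    have h4 := hD' 0 _ (funMulti_mem f) s
    rw [funMulti_mul, h, map_zero] at h3 h4
    rw [h3, h1, add_right_inj] at h4
    simp only [mul_zero, pow_zero, one_smul, hT, funMulti_mul] at h4
    have h5 := congrArg (fun t => t.1 m) h4
    simp only [Multisections.fsmul_apply] at h5
    change f (𝒜.φ m) • _ = f (𝒜.φ m) • _ at h5
    rwa [hf, one_smul, one_smul] at h5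
  · induction η using ExteriorAlgebra.left_induction with
    | algebraMap f => rw [toMulti_algebraMap, h1]
    | add u v hu hv => simp only [map_add, hu, hv]
    | ι_mul X u hu =>
      rw [map_mul, toMulti_ι, hD 1 _ (secMulti_mem X), hD' 1 _ (secMulti_mem X), h2, hu]

/-- By the hom-Leibniz rule, the bracket with a fixed homogeneous `s` is determined by its values on
functions and sections. This is applied with `s` a section, then a function, then arbitrary;
skew-symmetry reduces each case to the earlier ones. -/
theorem bracket_ext (G G' : AssocHomGerstenhaber 𝒜) : G.bracket = G'.bracket := by
  have hT : G'.twist = G.twist := by rw [twist_eq, twist_eq]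
  have hG := G.isHomGerstenhaber
  have hG' := G'.isHomGerstenhaber
  rw [hT] at hG'
  have key : ∀ i, ∀ s ∈ multiGrading E F V i,
      (∀ f, G.bracket s (funMulti f) = G'.bracket s (funMulti f)) →
      (∀ X, G.bracket s (secMulti X) = G'.bracket s (secMulti X)) →
      G.bracket s = G'.bracket s := fun i s hs h1 h2 =>
    eq_of_derivation (𝒜 := 𝒜) G.twist G.twist_fun i
      (fun j Y hY Z => hG.hom_leibniz i j s hs Y hY Z)
      (fun j Y hY Z => hG'.hom_leibniz i j s hs Y hY Z) h1 h2
  have hsec : ∀ X, G.bracket (secMulti X) = G'.bracket (secMulti X) := fun X =>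
    key 1 _ (secMulti_mem X) (fun f => by rw [G.bracket_fun, G'.bracket_fun])
      fun Y => by rw [G.bracket_sec, G'.bracket_sec]
  have hfun : ∀ f, G.bracket (funMulti f) = G'.bracket (funMulti f) := fun f =>
    key 0 _ (funMulti_mem f)
      (fun g => by
        rw [hG.bracket_zero _ (funMulti_mem f) _ (funMulti_mem g),
          hG'.bracket_zero _ (funMulti_mem f) _ (funMulti_mem g)])
      fun Y => by
        rw [hG.skew 0 1 _ (funMulti_mem f) _ (secMulti_mem Y),
          hG'.skew 0 1 _ (funMulti_mem f) _ (secMulti_mem Y), hsec]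
  have h : ∀ i, ∀ s ∈ multiGrading E F V i, G.bracket s = G'.bracket s := fun i s hs => by
    refine key i s hs (fun f => ?_) (fun X => ?_)
    · rw [hG.skew i 0 s hs _ (funMulti_mem f), hG'.skew i 0 s hs _ (funMulti_mem f), hfun]
    · rw [hG.skew i 1 s hs _ (secMulti_mem X), hG'.skew i 1 s hs _ (secMulti_mem X), hsec]
  exact Multisections.linearMap_ext h

/-- The associated hom-Gerstenhaber algebra is unique. -/
theorem unique (G G' : AssocHomGerstenhaber 𝒜) : G = G' := by
  have h1 : G.twist = G'.twist := by rw [twist_eq, twist_eq]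
  have h2 := bracket_ext G G'
  cases G
  cases G'
  subst h1
  subst h2
  rfl

end AssocHomGerstenhaber

end Untwisting


/-! ### Generators, divergence operators and flat connections on the top exterior power -/

/-- A flat connection on an `R`-module `S` along a Lie–Rinehart structure. -/
structure LieRinehart.IsFlatConnection {k R P S : Type*} [CommRing k] [CommRing R] [Algebra k R]
    [AddCommGroup P] [Module k P] [Module R P] (A : LieRinehart k R P)
    [AddCommGroup S] [Module k S] [Module R S] (nabla : P →ₗ[k] S →ₗ[k] S) : Prop where
  smul_left : ∀ (f : R) a s, nabla (f • a) s = f • nabla a s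
  smul_right : ∀ a (f : R) s, nabla a (f • s) = f • nabla a s + A.anchor a f • s
  flat : ∀ a b s, nabla (A.br a b) s = nabla a (nabla b s) - nabla b (nabla a s)

section Divergences

open ExteriorAlgebra Topology

variable {E : Type*} [NormedAddCommGroup E] [NormedSpace ℝ E] [FiniteDimensional ℝ E]
  {M : Type*} [TopologicalSpace M] [T2Space M] [ChartedSpace E M] [IsManifold 𝓘(ℝ, E) ∞ M]
  {F : Type*} [NormedAddCommGroup F] [NormedSpace ℝ F] [FiniteDimensional ℝ F]
  {V : M → Type*} [TopologicalSpace (TotalSpace F V)] [∀ m, TopologicalSpace (V m)]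
  [∀ m, AddCommGroup (V m)] [∀ m, Module ℝ (V m)] [FiberBundle F V] [VectorBundle ℝ F V]
  [ContMDiffVectorBundle ∞ F V 𝓘(ℝ, E)]

theorem Multisections.sub_smul (f g : SmoothFun E M) (s : Multisections E F V) :
    (f - g) • s = f • s - g • s := _root_.sub_smul f g s

namespace LieRinehart

variable (A : LieRinehart ℝ (SmoothFun E M) (SmoothSec E F V))

theorem multiBracket_secMulti_secMulti (X Y : SmoothSec E F V) :
    A.multiBracket (secMulti X) (secMulti Y) = secMulti (A.br X Y) := by
  rw [← toMulti_ι, ← toMulti_ι, multiBracket_toMulti, ι_bracket, lie_ι, toMulti_ι]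

theorem multiBracket_secMulti_funMulti (X : SmoothSec E F V) (f : SmoothFun E M) :
    A.multiBracket (secMulti X) (funMulti f) = funMulti (A.anchor X f) := by
  rw [← toMulti_ι, ← toMulti_algebraMap, multiBracket_toMulti, ι_bracket, lie_algebraMap,
    toMulti_algebraMap]

theorem multiBracket_funMulti_secMulti (X : SmoothSec E F V) (f : SmoothFun E M) :
    A.multiBracket (funMulti f) (secMulti X) = -funMulti (A.anchor X f) := by
  have h := A.multiBracket_isHomGerstenhaber.skew 0 1 _ (funMulti_mem f) _ (secMulti_mem X)
  rw [h, multiBracket_secMulti_funMulti]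
  simp

theorem lifts_secMulti (m : M) (X : SmoothSec E F V) :
    Lifts m (ι (SmoothFun E M) X) (secMulti X) := by
  rw [← toMulti_ι]
  exact lifts_toMulti m _

theorem multiLie_smul (X : SmoothSec E F V) (f : SmoothFun E M) (s : Multisections E F V) :
    A.multiBracket (secMulti X) (f • s) =
      f • A.multiBracket (secMulti X) s + A.anchor X f • s := by
  refine Multisections.ext_of_lifts fun m => ?_
  obtain ⟨η, h⟩ := exists_lifts s m
  rw [A.multiBracket_apply (lifts_secMulti m X) (h.fsmul f), ι_bracket, lie_smul, map_add,
    evalMulti_smul, evalMulti_smul, ← ι_bracket, ← A.multiBracket_apply (lifts_secMulti m X) h,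
    h.eval_eq, ← Multisections.fsmul_apply, ← Multisections.fsmul_apply]
  rfl

theorem multiLie_br (X Y : SmoothSec E F V) (s : Multisections E F V) :
    A.multiBracket (secMulti (A.br X Y)) s =
      A.multiBracket (secMulti X) (A.multiBracket (secMulti Y) s) -
        A.multiBracket (secMulti Y) (A.multiBracket (secMulti X) s) := by
  refine Multisections.ext_of_lifts fun m => ?_
  obtain ⟨η, h⟩ := exists_lifts s m
  rw [A.multiBracket_apply (lifts_secMulti m _) h, ι_bracket, lie_br, map_sub, ← ι_bracket,
    ← ι_bracket, ← ι_bracket, ← ι_bracket,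
    ← A.multiBracket_apply (lifts_secMulti m X) (Lifts.multiBracket A (lifts_secMulti m Y) h),
    ← A.multiBracket_apply (lifts_secMulti m Y) (Lifts.multiBracket A (lifts_secMulti m X) h)]
  rfl

theorem multiLie_mem (X : SmoothSec E F V) {k : ℕ} {s : Multisections E F V}
    (hs : s ∈ MultiDeg E F V k) : A.multiBracket (secMulti X) s ∈ MultiDeg E F V k :=
  A.multiBracket_isHomGerstenhaber.bracket_degree 1 k k (add_comm _ _) _ (secMulti_mem X) _ hs

/-- On top degree multisections, the Lie derivative is a connection up to a divergence term. -/
theorem smul_multiLie_top (f : SmoothFun E M) (X : SmoothSec E F V) {n : ℕ}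
    (hn : Module.finrank ℝ F = n) {s : Multisections E F V} (hs : s ∈ MultiDeg E F V n) :
    A.multiBracket (secMulti (f • X)) s =
      f • A.multiBracket (secMulti X) s - A.anchor X f • s := by
  refine Multisections.ext_of_lifts fun m => ?_
  obtain ⟨η, h⟩ := exists_lifts s m
  have h1 : secMulti X * s = 0 := by
    have h2 : secMulti X * s ∈ MultiDeg E F V (1 + n) :=
      fun m => mul_mem rfl (secMulti_mem X m) (hs m)
    rwa [multiDeg_eq_bot (1 + n) (by omega), Submodule.mem_bot] at h2
  have h2 : ∀ᶠ m' in 𝓝 m, evalMulti m' (ι (SmoothFun E M) X * η) = 0 := by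
    filter_upwards [(lifts_secMulti m X).mul h] with m' h'
    rw [h', h1]
    rfl
  -- `X ∧ s` lies in degree `n + 1` and is zero, so its lift `X ∧ η` vanishes near `m`. Contracting
  -- with the differential of `f` turns the correction in `smul_lie` into `ρ(X)f · s` at `m`.
  have h3 : evalMulti m (A.contr f (ι (SmoothFun E M) X * η)) = 0 := evalMulti_map_eq_zero
    { toFun := A.contr f, map_add' := map_add _, map_smul' := fun g v => A.contr_smul f g v } m _ h2
  rw [contr_ι_mul, map_sub, sub_eq_zero] at h3
  rw [A.multiBracket_apply (lifts_secMulti m _) h, ι_bracket, smul_lie, map_sub, ← h3,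
    evalMulti_smul, evalMulti_smul, ← ι_bracket, ← A.multiBracket_apply (lifts_secMulti m X) h,
    h.eval_eq, ← Multisections.fsmul_apply, ← Multisections.fsmul_apply]
  rfl

variable {A}

theorem IsDivergence.multiDiv_secMulti {d : SmoothSec E F V →ₗ[ℝ] SmoothFun E M}
    (hd : A.IsDivergence d) (X : SmoothSec E F V) :
    hd.multiDiv (secMulti X) = funMulti (d X) := by
  refine Multisections.ext_of_lifts fun m => ?_
  rw [hd.multiDiv_apply (lifts_secMulti m X), hd.div_ι, evalMulti_algebraMap]
  rfl

variable {D : Multisections E F V →ₗ[ℝ] Multisections E F V}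
  (hD : IsExactGenerator (multiGrading E F V) (AlgHom.id ℝ _) A.multiBracket D)

include hD

/-- The generating relation with a function in the first slot, where `D f = 0`. Written as an
equality of linear operators, it extends from homogeneous `s` to all `s`. -/
theorem generator_smul (f : SmoothFun E M) (s : Multisections E F V) :
    D (f • s) = f • D s + A.multiBracket (funMulti f) s := by
  have h : D ∘ₗ LinearMap.mulLeft ℝ (funMulti f) =
      LinearMap.mulLeft ℝ (funMulti f) ∘ₗ D + A.multiBracket (funMulti f) := by
    refine Multisections.linearMap_ext fun i s hs => ?_
    have h := hD.generates 0 _ (funMulti_mem f) i s hs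
    simp only [pow_zero, one_smul, AlgHom.id_apply, hD.degree_zero _ (funMulti_mem f),
      zero_mul, sub_zero] at h
    simp [h]
  simpa [funMulti_mul] using LinearMap.congr_fun h s

theorem generator_secMulti_mul (X : SmoothSec E F V) (s : Multisections E F V) :
    D (secMulti X * s) =
      D (secMulti X) * s - secMulti X * D s - A.multiBracket (secMulti X) s := by
  have h : D ∘ₗ LinearMap.mulLeft ℝ (secMulti X) = LinearMap.mulLeft ℝ (D (secMulti X)) -
      LinearMap.mulLeft ℝ (secMulti X) ∘ₗ D - A.multiBracket (secMulti X) := by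
    refine Multisections.linearMap_ext fun i s hs => ?_
    have h := hD.generates 1 _ (secMulti_mem X) i s hs
    simp only [pow_one, neg_smul, one_smul, AlgHom.id_apply] at h
    simp only [LinearMap.comp_apply, LinearMap.sub_apply, LinearMap.mulLeft_apply, h]
    abel
  exact LinearMap.congr_fun h s

theorem generator_secMulti (X : SmoothSec E F V) :
    funMulti (Multisections.scalar (D (secMulti X))) = D (secMulti X) :=
  Multisections.funMulti_scalar (hD.degree_succ 0 _ (secMulti_mem X))

/-- An exact generator of the Gerstenhaber algebra of multisections restricts to a divergence
operator. -/
theorem generator_isDivergence : A.IsDivergence (Multisections.scalar ∘ₗ D ∘ₗ secMulti) where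
  map_smul f X := by
    have h1 : secMulti (f • X) = f • secMulti (F := F) X := by
      rw [← toMulti_ι, map_smul, map_smul, toMulti_ι]
    apply funMulti_injective (F := F) (V := V)
    simp only [LinearMap.comp_apply]
    rw [generator_secMulti hD, h1, generator_smul hD, multiBracket_funMulti_secMulti, map_sub,
      map_mul, generator_secMulti hD, funMulti_mul, sub_eq_add_neg]
  flat X Y := by
    apply funMulti_injective (F := F) (V := V)
    simp only [LinearMap.comp_apply]
    -- Flatness is the degree zero identity `D² (X ∧ Y) = 0`, expanded by the generating relation.
    have h := hD.sq_zero (secMulti X * secMulti Y)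
    obtain ⟨d, hd'⟩ : ∃ d : SmoothSec E F V → SmoothFun E M,
        ∀ X, Multisections.scalar (D (secMulti X)) = d X := ⟨_, fun _ => rfl⟩
    have hd : ∀ X, D (secMulti X) = funMulti (d X) := fun X => by
      rw [← hd', generator_secMulti hD]
    have h1 : secMulti X * funMulti (d Y) = d Y • secMulti X := by
      rw [Algebra.smul_def, Algebra.commutes]
      rfl
    rw [generator_secMulti_mul hD, multiBracket_secMulti_secMulti, map_sub, map_sub, hd, hd,
      funMulti_mul, h1, generator_smul hD, generator_smul hD, multiBracket_funMulti_secMulti,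
      multiBracket_funMulti_secMulti, hd, hd, hd, ← funMulti_mul, ← funMulti_mul,
      ← map_mul funMulti, ← map_mul funMulti, mul_comm, sub_eq_zero] at h
    rw [hd', hd', hd', ← h, map_sub]
    abel

/-- Any generator is local and satisfies the recursion for `X ∧ u` fixed by its values on sections.
So it agrees with `multiDiv` on the image of `toMulti`, and by locality everywhere. -/
theorem generator_eq_multiDiv : D = (generator_isDivergence hD).multiDiv := by
  have hd := generator_isDivergence hD
  have key : ∀ D' : Multisections E F V →ₗ[ℝ] Multisections E F V,
      IsExactGenerator (multiGrading E F V) (AlgHom.id ℝ _) A.multiBracket D' →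
      ∀ m s, (∀ᶠ m' in 𝓝 m, s.1 m' = 0) → (D' s).1 m = 0 := by
    intro D' hD' m s hs
    obtain ⟨f, hf, h⟩ := Multisections.exists_smul_eq_zero hs
    have h1 := congrArg (fun t => t.1 m) (generator_smul hD' f s)
    rw [h, map_zero] at h1
    have h2 : (A.multiBracket (funMulti f) s).1 m = 0 := by
      have h3 : Lifts m (0 : SecAlg E F V) s := by
        filter_upwards [hs] with m' h'
        rw [h', map_zero]
      rw [← toMulti_algebraMap, A.multiBracket_apply (lifts_toMulti m _) h3, map_zero, map_zero]
    change 0 = (f • D' s).1 m + (A.multiBracket (funMulti f) s).1 m at h1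
    rwa [h2, Multisections.fsmul_apply, hf, one_smul, add_zero, eq_comm] at h1
  have hD' := hd.multiDiv_isExactGenerator
  refine Multisections.ext_of_local (φ := id) (fun m s hs => ?_) fun η => ?_
  · exact (key D hD m s hs).trans (key _ hD' m s hs).symm
  · have h1 : ∀ X, hd.multiDiv (secMulti X) = D (secMulti X) := fun X => by
      rw [hd.multiDiv_secMulti]
      exact generator_secMulti hD X
    induction η using ExteriorAlgebra.left_induction with
    | algebraMap f =>
      rw [toMulti_algebraMap, hD.degree_zero _ (funMulti_mem f), hD'.degree_zero _ (funMulti_mem f)]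
    | add u v hu hv => simp only [map_add, hu, hv]
    | ι_mul X u hu =>
      rw [map_mul, toMulti_ι, generator_secMulti_mul hD, generator_secMulti_mul hD', h1, hu]

end LieRinehart

/-- A function which annihilates the top degree multisections is zero. -/
theorem eq_zero_of_smul_top {n : ℕ} (hn : Module.finrank ℝ F = n) {f : SmoothFun E M}
    (h : ∀ s ∈ MultiDeg E F V n, f • s = 0) : f = 0 := by
  ext m
  obtain ⟨s, hs, h1, -⟩ := exists_generator_top E F V n hn m
  have h2 := congrArg (fun t => t.1 m) (h s hs)
  simp only [Multisections.fsmul_apply] at h2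
  exact (smul_eq_zero.mp h2).resolve_right h1.self_of_nhds

theorem eq_of_smul_top {n : ℕ} (hn : Module.finrank ℝ F = n) {f g : SmoothFun E M}
    (h : ∀ s ∈ MultiDeg E F V n, f • s = g • s) : f = g := by
  refine sub_eq_zero.mp (eq_zero_of_smul_top (F := F) (V := V) hn fun s hs => ?_)
  rw [Multisections.sub_smul, sub_eq_zero]
  exact h s hs

/-- Endomorphisms of the module of top degree multisections are given by functions. -/
theorem exists_fun_of_linear_top {n : ℕ} (hn : Module.finrank ℝ F = n)
    (L : MultiDeg E F V n →ₗ[SmoothFun E M] MultiDeg E F V n) :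
    ∃ f : SmoothFun E M, ∀ s, L s = f • s := by
  choose g hg h1 h2 using fun m => exists_generator_top E F V n hn m
  choose h hh using fun m => h2 m (L ⟨g m, hg m⟩).1 (L ⟨g m, hg m⟩).2
  -- Near `m`, `t` is a multiple `c` of the local generator `g m`, on which `L` acts as `h m`. The
  -- difference `t - c • g m` is killed by a cutoff function, so linearity makes its image vanish at
  -- `m`.
  have key : ∀ m t, (L t).1.1 m = h m m • t.1.1 m := by
    intro m t
    obtain ⟨c, hc⟩ := h2 m t.1 t.2
    have h3 : ∀ᶠ m' in 𝓝 m, (t - c • (⟨g m, hg m⟩ : MultiDeg E F V n)).1.1 m' = 0 := by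
      filter_upwards [hc] with m' h'
      change t.1.1 m' - (c • g m).1 m' = 0
      rw [h', Multisections.fsmul_apply, sub_self]
    obtain ⟨f, hf, h4⟩ := Multisections.exists_smul_eq_zero h3
    have h5 : f • (t - c • (⟨g m, hg m⟩ : MultiDeg E F V n)) = 0 := Subtype.ext h4
    have h6 : (L (f • (t - c • (⟨g m, hg m⟩ : MultiDeg E F V n)))).1.1 m = 0 := by
      rw [h5, map_zero]
      rfl
    have h7 : L (t - c • (⟨g m, hg m⟩ : MultiDeg E F V n)) = L t - c • L ⟨g m, hg m⟩ := by
      rw [← map_smul]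
      exact map_sub L _ _
    rw [map_smul, h7] at h6
    change (f • ((L t).1 - c • (L ⟨g m, hg m⟩).1)).1 m = 0 at h6
    rw [Multisections.fsmul_apply, hf, one_smul] at h6
    change (L t).1.1 m - (c • (L ⟨g m, hg m⟩).1).1 m = 0 at h6
    rw [sub_eq_zero.mp h6, Multisections.fsmul_apply, (hh m).self_of_nhds, hc.self_of_nhds,
      smul_comm]
  refine ⟨⟨fun m => h m m, fun m₀ => ?_⟩, fun s => ?_⟩
  -- Since `g m₀` does not vanish near `m₀`, the diagonal values `h m m` coincide there with the
  -- single smooth function `h m₀`.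
  · refine ((h m₀).contMDiff m₀).congr_of_eventuallyEq ?_
    filter_upwards [hh m₀, h1 m₀] with m h3 h4
    have h5 := key m ⟨g m₀, hg m₀⟩
    rw [h3] at h5
    exact (smul_left_injective ℝ h4 h5).symm
  · exact Subtype.ext (Multisections.ext_of_lifts fun m => by
      rw [key m s]
      exact (Multisections.fsmul_apply _ s.1 m).symm)

namespace LieRinehart

variable (A : LieRinehart ℝ (SmoothFun E M) (SmoothSec E F V))

/-- The connection `∇(a, s) = [a, s] - d(a) s` on multisections. -/
def connection (d : SmoothSec E F V →ₗ[ℝ] SmoothFun E M) (n : ℕ) :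
    SmoothSec E F V →ₗ[ℝ] MultiDeg E F V n →ₗ[ℝ] MultiDeg E F V n :=
  LinearMap.mk₂ ℝ
    (fun a s => ⟨A.multiBracket (secMulti a) s - d a • s,
      sub_mem (A.multiLie_mem a s.2) (Submodule.smul_mem _ _ s.2)⟩)
    (fun a b s => Subtype.ext (by simp [add_smul]; abel))
    (fun r a s => Subtype.ext (by simp [smul_sub]))
    (fun a s t => Subtype.ext (by simp; abel))
    (fun r a s => Subtype.ext (by simp [smul_sub, smul_comm r]))

theorem coe_connection (d : SmoothSec E F V →ₗ[ℝ] SmoothFun E M) (n : ℕ) (a : SmoothSec E F V)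
    (s : MultiDeg E F V n) : (A.connection d n a s : Multisections E F V) =
      A.multiBracket (secMulti a) s - d a • s := rfl

variable {A}

/-- The defect `-ρ(a)f` of `d` under `a ↦ f • a` cancels that of the Lie derivative in top degree.
The curvature is that of `L`, which vanishes, plus the flatness defect of `d`. -/
theorem IsDivergence.isFlatConnection {d : SmoothSec E F V →ₗ[ℝ] SmoothFun E M}
    (hd : A.IsDivergence d) {n : ℕ} (hn : Module.finrank ℝ F = n) :
    A.IsFlatConnection (S := MultiDeg E F V n) (A.connection d n) where
  smul_left f a s := Subtype.ext (by
    change _ = f • (A.connection d n a s : Multisections E F V)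
    rw [coe_connection, coe_connection, A.smul_multiLie_top f a hn s.2, hd.map_smul, Multisections.sub_smul,
      mul_smul, smul_sub]
    abel)
  smul_right a f s := Subtype.ext (by
    change _ = f • (A.connection d n a s : Multisections E F V) + A.anchor a f • s.1
    rw [coe_connection, coe_connection]
    change A.multiBracket (secMulti a) (f • s.1) - d a • f • s.1 = _
    rw [A.multiLie_smul, smul_comm (d a), smul_sub]
    abel)
  flat a b s := Subtype.ext (by
    change _ = (A.connection d n a (A.connection d n b s) : Multisections E F V) -
      A.connection d n b (A.connection d n a s)
    simp only [coe_connection, A.multiLie_br, hd.flat, map_sub, A.multiLie_smul, smul_sub,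
      Multisections.sub_smul]
    rw [smul_comm (d a) (d b)]
    abel)

/-- Flat connections on the top degree multisections are given by divergence operators. -/
theorem IsFlatConnection.exists_divergence {n : ℕ} (hn : Module.finrank ℝ F = n)
    {nabla : SmoothSec E F V →ₗ[ℝ] MultiDeg E F V n →ₗ[ℝ] MultiDeg E F V n}
    (h : A.IsFlatConnection (S := MultiDeg E F V n) nabla) : ∃ d, A.IsDivergence d ∧ nabla = A.connection d n := by
  -- `L_a` and `∇_a` satisfy the same Leibniz rule, so their difference is linear over functions and
  -- is multiplication by a function, the value `d a`.
  have h1 : ∀ a, ∃ f : SmoothFun E M, ∀ s : MultiDeg E F V n,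
      A.multiBracket (secMulti a) s - (nabla a s).1 = f • s.1 := fun a => by
    obtain ⟨f, hf⟩ := exists_fun_of_linear_top hn
      { toFun := fun s => ⟨A.multiBracket (secMulti a) s - (nabla a s).1,
          sub_mem (A.multiLie_mem a s.2) (nabla a s).2⟩
        map_add' := fun s t => Subtype.ext (by simp; abel)
        map_smul' := fun f s => Subtype.ext (by
          change A.multiBracket (secMulti a) (f • s.1) - (nabla a (f • s)).1 = f • (_ - _)
          rw [A.multiLie_smul, h.smul_right]
          change _ - (f • (nabla a s).1 + A.anchor a f • s.1) = _
          rw [smul_sub]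
          abel) }
    exact ⟨f, fun s => congrArg Subtype.val (hf s)⟩
  choose d hd using h1
  -- Functions act faithfully in top degree, so all properties of `d` can be verified after
  -- multiplication with `s`.
  have huniq : ∀ f g : SmoothFun E M,
      (∀ s : MultiDeg E F V n, f • s.1 = g • s.1) → f = g := fun f g hfg =>
    eq_of_smul_top (F := F) (V := V) hn fun s hs => hfg ⟨s, hs⟩
  let d' : SmoothSec E F V →ₗ[ℝ] SmoothFun E M :=
    { toFun := d
      map_add' := fun a b => huniq _ _ fun s => by
        rw [← hd, add_smul, ← hd, ← hd]
        simp
        abel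
      map_smul' := fun r a => huniq _ _ fun s => by
        rw [← hd, RingHom.id_apply, smul_assoc, ← hd]
        simp [smul_sub] }
  have h2 : nabla = A.connection d' n := by
    ext1 a
    ext1 s
    refine Subtype.ext ?_
    rw [coe_connection]
    exact (eq_sub_of_add_eq' (sub_eq_iff_eq_add.mp (hd a s)).symm)
  have h3 : ∀ a (s : MultiDeg E F V n),
      d' a • s.1 = A.multiBracket (secMulti a) s - (nabla a s).1 := fun a s => (hd a s).symm
  refine ⟨d', ⟨fun f a => huniq _ _ fun s => ?_, fun a b => huniq _ _ fun s => ?_⟩, h2⟩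
  · rw [h3, A.smul_multiLie_top f a hn s.2, h.smul_left, Multisections.sub_smul, mul_smul, h3]
    change _ - f • (nabla a s).1 = _
    rw [smul_sub]
    abel
  · have h4 := congrArg Subtype.val (h.flat a b s)
    rw [h2] at h4
    change _ = (A.connection d' n a (A.connection d' n b s) : Multisections E F V) -
      A.connection d' n b (A.connection d' n a s) at h4
    simp only [coe_connection, A.multiLie_br, map_sub, A.multiLie_smul, smul_sub] at h4
    rw [smul_comm (d' a) (d' b), sub_eq_iff_eq_add] at h4
    rw [Multisections.sub_smul]
    rw [← sub_eq_zero] at h4 ⊢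
    rw [← neg_eq_zero, ← h4]
    abel

end LieRinehart

end Divergences


/-! ### Twisting and untwisting of representations -/

section HomLieRep

variable {k P S : Type*} [CommRing k] [AddCommGroup P] [Module k P] [AddCommGroup S] [Module k S]
  {br br' : P →ₗ[k] P →ₗ[k] P} {α : P →ₗ[k] P} {T T' : S →ₗ[k] S} {nabla : P →ₗ[k] S →ₗ[k] S}

/-- Twisting of a representation of a Lie algebra. -/
theorem isHomLieRep_compr₂ (hbr : ∀ a b, α (br a b) = br' a b)
    (hflat : ∀ a b s, nabla (br a b) s = nabla a (nabla b s) - nabla b (nabla a s))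
    (hα : ∀ a s, nabla (α a) (T s) = T (nabla a s)) :
    IsHomLieRep br' α (nabla.compr₂ T) T where
  map_twist a s := by rw [LinearMap.compr₂_apply, LinearMap.compr₂_apply, hα]
  map_bracket a b s := by
    simp only [LinearMap.compr₂_apply, ← hbr, hα, hflat, map_sub]

/-- Untwisting of a representation: compatibility with the twist. -/
theorem IsHomLieRep.untwist_map_twist (h : IsHomLieRep br' α nabla T) (h1 : ∀ s, T (T' s) = s)
    (h2 : ∀ s, T' (T s) = s) (a : P) (s : S) :
    (nabla.compr₂ T') (α a) (T s) = T ((nabla.compr₂ T') a s) := by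
  rw [LinearMap.compr₂_apply, LinearMap.compr₂_apply, h.map_twist, h1, h2]

/-- Untwisting of a representation of a hom-Lie algebra. -/
theorem IsHomLieRep.untwist_flat (h : IsHomLieRep br' α nabla T) (h1 : ∀ s, T (T' s) = s)
    (h2 : ∀ s, T' (T s) = s) (hbr : ∀ a b, α (br a b) = br' a b) (a b : P) (s : S) :
    (nabla.compr₂ T') (br a b) s =
      (nabla.compr₂ T') a ((nabla.compr₂ T') b s) -
        (nabla.compr₂ T') b ((nabla.compr₂ T') a s) := by
  have hT : Function.Injective T := Function.LeftInverse.injective h2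
  -- Two twists are applied: `e` absorbs the inner one into the arguments, and the outer one cancels
  -- `T'`. What remains is `h.map_bracket`.
  apply hT
  apply hT
  have e := h.untwist_map_twist h1 h2
  rw [map_sub, map_sub, ← e (br a b) s, ← e a ((nabla.compr₂ T') b s),
    ← e b ((nabla.compr₂ T') a s)]
  simp only [LinearMap.compr₂_apply, h1, hbr, h.map_bracket]

end HomLieRep

/-! ### Equivariant divergences parametrise both sides -/

section Twisted

open ExteriorAlgebra Topology

variable {E : Type*} [NormedAddCommGroup E] [NormedSpace ℝ E] [FiniteDimensional ℝ E]
  {M : Type*} [TopologicalSpace M] [T2Space M] [ChartedSpace E M] [IsManifold 𝓘(ℝ, E) ∞ M]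
  {F : Type*} [NormedAddCommGroup F] [NormedSpace ℝ F] [FiniteDimensional ℝ F]
  {V : M → Type*} [TopologicalSpace (TotalSpace F V)] [∀ m, TopologicalSpace (V m)]
  [∀ m, AddCommGroup (V m)] [∀ m, Module ℝ (V m)] [FiberBundle F V] [VectorBundle ℝ F V]
  [ContMDiffVectorBundle ∞ F V 𝓘(ℝ, E)]

namespace HomLieAlgebroid.Untwisting

variable {𝒜 : HomLieAlgebroid E F V} (U : 𝒜.Untwisting)

/-- Compatibility of a divergence operator with the twist. -/
def IsEquivariant (𝒜 : HomLieAlgebroid E F V) (d : SmoothSec E F V →ₗ[ℝ] SmoothFun E M) : Prop :=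
  ∀ X, d (𝒜.α X) = SmoothFun.pullback 𝒜.φ (d X)

/-- Equivariance of `d` is what makes the divergence commute with the twist, as
`IsExactGenerator.twist` requires. -/
theorem isExactGenerator {d : SmoothSec E F V →ₗ[ℝ] SmoothFun E M} (hd : U.A.IsDivergence d)
    (hdα : IsEquivariant 𝒜 d) : IsExactGenerator (multiGrading E F V) U.assoc.twist U.assoc.bracket
      (𝒜.multiTwist.toLinearMap ∘ₗ hd.multiDiv) :=
  hd.multiDiv_isExactGenerator.twist _ (multiTwist_mem _)
    (multiTwist_multiDiv _ U.br_α U.anchor_α hd hdα)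

/-- Exact generators are given by equivariant divergence operators. -/
theorem exists_divergence (D : U.assoc.ExactGenerator) :
    ∃ (d : SmoothSec E F V →ₗ[ℝ] SmoothFun E M) (hd : U.A.IsDivergence d),
      IsEquivariant 𝒜 d ∧ D.1 = 𝒜.multiTwist.toLinearMap ∘ₗ hd.multiDiv := by
  have hD : IsExactGenerator (multiGrading E F V) (AlgHom.id ℝ _) U.A.multiBracket
      (U.multiTwistInv.toLinearMap ∘ₗ D.1) :=
    D.2.untwist (multiTwist_mem _) U.multiTwistInv_multiTwist U.multiTwist_multiTwistInv
  have hd := LieRinehart.generator_isDivergence hD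
  have h1 : D.1 = 𝒜.multiTwist.toLinearMap ∘ₗ hd.multiDiv := by
    rw [← LieRinehart.generator_eq_multiDiv hD]
    ext1 s
    exact (U.multiTwist_multiTwistInv _).symm
  refine ⟨_, hd, fun X => ?_, h1⟩
  -- On a section, after cancelling one twist, commutation of `D` with the twist reads `d (α X) =
  -- φ^* (d X)`.
  have h2 := D.2.comm_twist (secMulti X)
  rw [h1] at h2
  change 𝒜.multiTwist (hd.multiDiv (𝒜.multiTwist (secMulti X))) =
    𝒜.multiTwist (𝒜.multiTwist (hd.multiDiv (secMulti X))) at h2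
  have h3 := congrArg U.multiTwistInv h2
  rw [U.multiTwistInv_multiTwist, U.multiTwistInv_multiTwist, hd.multiDiv_secMulti,
    HomLieAlgebroid.multiTwist_secMulti, hd.multiDiv_secMulti,
    HomLieAlgebroid.multiTwist_funMulti] at h3
  exact funMulti_injective h3

theorem twistDeg_smul {n : ℕ} (f : SmoothFun E M) (s : MultiDeg E F V n) :
    U.assoc.twistDeg n (f • s) = f.comp 𝒜.φ • U.assoc.twistDeg n s :=
  Subtype.ext (multiTwist_smul _ f s.1)

/-- The inverse of the twist on multisections of degree `n`. -/
def twistDegInv (n : ℕ) : MultiDeg E F V n →ₗ[ℝ] MultiDeg E F V n where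
  toFun s := ⟨U.multiTwistInv s, multiTwist_mem U.αinv_smul n s.1 s.2⟩
  map_add' s t := Subtype.ext (map_add U.multiTwistInv s.1 t.1)
  map_smul' c s := Subtype.ext (map_smul U.multiTwistInv c s.1)

theorem twistDeg_twistDegInv {n : ℕ} (s : MultiDeg E F V n) :
    U.assoc.twistDeg n (U.twistDegInv n s) = s :=
  Subtype.ext (U.multiTwist_multiTwistInv s.1)

theorem twistDegInv_twistDeg {n : ℕ} (s : MultiDeg E F V n) :
    U.twistDegInv n (U.assoc.twistDeg n s) = s :=
  Subtype.ext (U.multiTwistInv_multiTwist s.1)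

theorem twistDeg_injective (n : ℕ) : Function.Injective (U.assoc.twistDeg n) :=
  Function.LeftInverse.injective U.twistDegInv_twistDeg

theorem twistDeg_connection {d : SmoothSec E F V →ₗ[ℝ] SmoothFun E M} {n : ℕ}
    (a : SmoothSec E F V) (s : MultiDeg E F V n) :
    (U.assoc.twistDeg n (U.A.connection d n a s) : Multisections E F V) =
      U.A.multiBracket (secMulti (𝒜.α a)) (U.assoc.twistDeg n s) -
        SmoothFun.pullback 𝒜.φ (d a) • (U.assoc.twistDeg n s).1 := by
  change 𝒜.multiTwist (U.A.multiBracket (secMulti a) s - d a • s.1) = _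
  rw [map_sub, U.multiTwist_multiBracket, HomLieAlgebroid.multiTwist_secMulti]
  exact congrArg _ (multiTwist_smul _ _ _)

/-- The representation on top degree multisections given by a divergence operator. -/
theorem isRep {d : SmoothSec E F V →ₗ[ℝ] SmoothFun E M} (hd : U.A.IsDivergence d)
    (hdα : IsEquivariant 𝒜 d) {n : ℕ} (hn : Module.finrank ℝ F = n) :
    𝒜.IsRep (S := MultiDeg E F V n) (U.assoc.twistDeg n)
      ((U.A.connection d n).compr₂ (U.assoc.twistDeg n)) := by
  have h := hd.isFlatConnection hn
  have hα : ∀ a s, U.A.connection d n (𝒜.α a) (U.assoc.twistDeg n s) =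
      U.assoc.twistDeg n (U.A.connection d n a s) := fun a s => Subtype.ext (by
    rw [U.twistDeg_connection, LieRinehart.coe_connection, hdα])
  refine ⟨fun f x s => ?_, fun x f s => ?_, isHomLieRep_compr₂ U.α_br h.flat hα⟩
  · rw [LinearMap.compr₂_apply, h.smul_left, U.twistDeg_smul]
    rfl
  · rw [LinearMap.compr₂_apply, h.smul_right, map_add, U.twistDeg_smul, U.twistDeg_smul,
      ← U.pullback_anchor]
    rfl

/-- Representations on the top degree multisections are given by equivariant divergence
operators. -/
theorem exists_divergence_of_isRep {n : ℕ} (hn : Module.finrank ℝ F = n)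
    (nabla : U.assoc.RepOnPower n) :
    ∃ d : SmoothSec E F V →ₗ[ℝ] SmoothFun E M, U.A.IsDivergence d ∧ IsEquivariant 𝒜 d ∧
      nabla.1 = (U.A.connection d n).compr₂ (U.assoc.twistDeg n) := by
  have hrep := nabla.2
  let N : SmoothSec E F V →ₗ[ℝ] MultiDeg E F V n →ₗ[ℝ] MultiDeg E F V n :=
    nabla.1.compr₂ (U.twistDegInv n)
  have h1 : ∀ a s, U.assoc.twistDeg n (N a s) = nabla.1 a s :=
    fun a s => U.twistDeg_twistDegInv _
  have h2 : ∀ a s, N (𝒜.α a) (U.assoc.twistDeg n s) = U.assoc.twistDeg n (N a s) :=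
    hrep.homLieRep.untwist_map_twist U.twistDeg_twistDegInv U.twistDegInv_twistDeg
  have h3 : U.A.IsFlatConnection (S := MultiDeg E F V n) N := by
    refine ⟨fun f a s => ?_, fun a f s => ?_, hrep.homLieRep.untwist_flat
      U.twistDeg_twistDegInv U.twistDegInv_twistDeg U.α_br⟩
    · apply U.twistDeg_injective
      rw [h1, hrep.smul_left, U.twistDeg_smul, h1]
    · apply U.twistDeg_injective
      rw [h1, hrep.smul_right, map_add, U.twistDeg_smul, U.twistDeg_smul, h1, ← U.pullback_anchor]
      rfl
  obtain ⟨d, hd, h4⟩ := h3.exists_divergence hn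
  refine ⟨d, hd, fun a => ?_, ?_⟩
  -- Every top degree `s` is the twist of some `t`. Comparing `N (α a)` on `s` with the twist of `N
  -- a t`, the Lie derivative terms agree and the divergence terms remain.
  · refine eq_of_smul_top (F := F) (V := V) hn fun s hs => ?_
    obtain ⟨t, ht⟩ : ∃ t, U.assoc.twistDeg n t = ⟨s, hs⟩ := ⟨_, U.twistDeg_twistDegInv ⟨s, hs⟩⟩
    have h5 := congrArg Subtype.val (h2 a t)
    rw [h4, U.twistDeg_connection, LieRinehart.coe_connection, ht] at h5
    exact sub_right_injective h5
  · rw [← h4]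
    ext1 a
    ext1 s
    exact (h1 a s).symm

end HomLieAlgebroid.Untwisting

end Twisted

end

/-! ### Main theorem -/

theorem mainTheorem4
    {E : Type*} [NormedAddCommGroup E] [NormedSpace ℝ E] [FiniteDimensional ℝ E]
    {M : Type*} [TopologicalSpace M] [T2Space M] [SecondCountableTopology M]
    [ChartedSpace E M] [IsManifold 𝓘(ℝ, E) ∞ M]
    {F : Type*} [NormedAddCommGroup F] [NormedSpace ℝ F] [FiniteDimensional ℝ F]
    {V : M → Type*} [TopologicalSpace (TotalSpace F V)] [∀ m, TopologicalSpace (V m)]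
    [∀ m, AddCommGroup (V m)] [∀ m, Module ℝ (V m)] [FiberBundle F V] [VectorBundle ℝ F V]
    [ContMDiffVectorBundle ∞ F V 𝓘(ℝ, E)]
    (n : ℕ) (hn : Module.finrank ℝ F = n)
    (𝒜 : HomLieAlgebroid E F V) (h𝒜 : 𝒜.IsRegular) :
    ∃ G : AssocHomGerstenhaber 𝒜, (∀ G' : AssocHomGerstenhaber 𝒜, G' = G) ∧
      ∃ Φ : G.ExactGenerator ≃ G.RepOnPower n,
        ∀ (D : G.ExactGenerator) (a : SmoothSec E F V) (X : MultiDeg E F V n),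
          (((Φ D).1 a X : MultiDeg E F V n) : Multisections E F V) =
            G.bracket (secMulti a) X - D.1 (secMulti a) * G.twist X := by
  obtain ⟨U⟩ := h𝒜.nonempty_untwisting
  refine ⟨U.assoc, fun G' => G'.unique U.assoc, ?_⟩
  choose d hd hdα hD using U.exists_divergence
  let Φ : U.assoc.ExactGenerator → U.assoc.RepOnPower n := fun D =>
    ⟨(U.A.connection (d D) n).compr₂ (U.assoc.twistDeg n), U.isRep (hd D) (hdα D) hn⟩
  have hΦ : ∀ (D : U.assoc.ExactGenerator) (a : SmoothSec E F V) (X : MultiDeg E F V n),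
      ((Φ D).1 a X : Multisections E F V) =
        U.assoc.bracket (secMulti a) X - D.1 (secMulti a) * U.assoc.twist X := fun D a X => by
    -- The twist is multiplicative and sends the function `d D a` to `D a`, so `τ(L_a X - d(a) X)`
    -- is the prescribed formula.
    change 𝒜.multiTwist (U.A.multiBracket (secMulti a) X - d D a • X.1) = _
    rw [map_sub, ← funMulti_mul, map_mul, ← (hd D).multiDiv_secMulti, hD D]
    rfl
  -- The representation determines `d`, since functions act faithfully in top degree, and `d`
  -- determines the generator.
  have hinj : Function.Injective Φ := fun D D' h => by
    have h1 : d D = d D' := by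
      ext1 a
      refine eq_of_smul_top (F := F) (V := V) hn fun s hs => ?_
      have h2 := U.twistDeg_injective n
        (congrArg (fun N : U.assoc.RepOnPower n => N.1 a ⟨s, hs⟩) h)
      exact sub_right_injective (congrArg Subtype.val h2)
    have h2 : ∀ (d' : SmoothSec E F V →ₗ[ℝ] SmoothFun E M) (hd' : U.A.IsDivergence d'),
        d D = d' → (hd D).multiDiv = hd'.multiDiv := by
      rintro _ _ rfl
      rfl
    exact Subtype.ext (by rw [hD D, hD D', h2 _ (hd D') h1])
  have hsurj : Function.Surjective Φ := fun N => by
    obtain ⟨d', hd', hd'α, hN⟩ := U.exists_divergence_of_isRep hn N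
    refine ⟨⟨_, U.isExactGenerator hd' hd'α⟩, Subtype.ext ?_⟩
    rw [hN]
    ext1 a
    ext1 X
    refine Subtype.ext ?_
    rw [hΦ]
    change 𝒜.multiTwist _ - 𝒜.multiTwist (hd'.multiDiv (secMulti a)) * 𝒜.multiTwist X.1 =
      𝒜.multiTwist (U.A.multiBracket (secMulti a) X - d' a • X.1)
    rw [map_sub, hd'.multiDiv_secMulti, ← map_mul, funMulti_mul]
  exact ⟨Equiv.ofBijective Φ ⟨hinj, hsurj⟩, hΦ⟩
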